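/- **Conventions.** A contact metric manifold $\tilde M^{2m+1}(\varphi,\xi,\eta,\langle\,,\rangle)$ satisfies $\varphi^2=-I+\eta\otimes\xi$, $\eta(\xi)=1$, $\varphi\xi=0$, $\eta\circ\varphi=0$, $\langle X,Y\rangle=\langle\varphi X,\varphi Y\rangle+\eta(X)\eta(Y)$, $\langle X,\xi\rangle=\eta(X)$ and $\langle X,\varphi Y\rangle=d\eta(X,Y)$, where $d\eta(X,Y)=\tfrac12\left(X\eta(Y)-Y\eta(X)-\eta([X,Y])\right)$. Put $h=\tfrac12\mathcal L_\xi\varphi$ and $\tilde R(X,Y)Z=\tilde\nabla_X\tilde\nabla_YZ-\tilde\nabla_Y\tilde\nabla_XZ-\tilde\nabla_{[X,Y]}Z$. For real constants $\kappa,\mu,c$, $\tilde M$ is a $(\kappa,\mu)$-contact space form $\tilde M(c)$ if $\tilde R(X,Y)\xi=\kappa\{\langle Y,\xi\rangle X-\langle X,\xi\rangle Y\}+\mu\{\langle Y,\xi\rangle hX-\langle X,\xi\rangle hY\}$ for all $X,Y$, and every plane spanned by $X,\varphi X$ with $X$ a unit vector orthogonal to $\xi$ has sectional curvature $c$. Let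 $M$ be an $n$-dimensional Riemannian manifold isometrically immersed in $\tilde M$, with second fundamental form $\sigma$ (the normal part of $\tilde\nabla_XY$), shape operators $\langle A_NX,Y\rangle=\langle\sigma(X,Y),N\rangle$, and sectional curvature $K$. At $p\in M$, for an orthonormal basis $(e_i)$ of $T_pM$, let $\tau=\sum_{i<j}K(e_i\wedge e_j)$ and $H=\frac1n\sum_i\sigma(e_i,e_i)$. Let $PX$, $h^TX$, $(\varphi h)^TX$ be the tangential parts of $\varphi X$, $hX$, $\varphi hX$, and for an endomorphism $Q$ of $T_pM$ let $\|Q\|^2=\sum_{i,j}\langle e_i,Qe_j\rangle^2$. For a plane $\pi\subset T_pM$ with orthonormal basis $(u_1,u_2)$ put $\alpha(\pi)=\langle u_1,Pu_2\rangle^2$, $\beta(\pi)=\eta(u_1)^2+\eta(u_2)^2$, $$\gamma(\pi)=\eta(u_1)^2\langle h^Tu_2,u_2\rangle+\eta(u_2)^2\langle h^Tu_1,u_1\rangle-2\eta(u_1)\eta(u_2)\langle h^Tu_1,u_2\rangle,$$ and let $\mathrm{trace}(h|_\pi)$, $\det(h|_\pi)$, $\det((\varphi h)|_\pi)$ be the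 trace and determinants of the $2\times2$ matrices $(\langle u_i,hu_j\rangle)$ and $(\langle u_i,\varphi hu_j\rangle)$. None of these quantities depends on the choice of orthonormal bases. **Theorem.** Let $M$ be an $n$-dimensional ($n\ge3$) submanifold isometrically immersed in a $(2m+1)$-dimensional $(\kappa,\mu)$-contact space form $\tilde M(c)$ such that $\xi$ is tangent to $M$. Then, for each point $p\in M$ and each plane section $\pi\subset T_pM$, $$\begin{aligned} \tau-K(\pi)\le{}&\frac{n^2(n-2)}{2(n-1)}\|H\|^2+\frac18n(n-3)(c+3)+(n-1)\kappa\\ &+\frac{3(c-1)}{8}\left\{\|P\|^2-2\alpha(\pi)\right\}+\frac14(c+3-4\kappa)\beta(\pi)-(\mu-1)\gamma(\pi)\\ &-\frac12\left\{2\,\mathrm{trace}(h|_\pi)+\det(h|_\pi)-\det((\varphi h)|_\pi)\right\}+(\mu+n-2)\,\mathrm{trace}(h^T)\\ &+\frac14\left\{\|(\varphi h)^T\|^2-\|h^T\|^2-\left(\mathrm{trace}((\varphi h)^T)\right)^2+\left(\mathrm{trace}(h^T)\right)^2\right\}. \end{aligned}$$ Equality holds at $p$ if and only if there exist an orthonormal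 basis $\{e_1,\dots,e_n\}$ of $T_pM$ and an orthonormal basis $\{e_{n+1},\dots,e_{2m+1}\}$ of the normal space $T_p^\perp M$ such that (a) $\pi=\mathrm{Span}\{e_1,e_2\}$ and (b) the shape operators $A_r=A_{e_r}$ have, in the basis $\{e_1,\dots,e_n\}$, the forms $$A_{n+1}=\begin{pmatrix}a&0&0\\0&b&0\\0&0&(a+b)I_{n-2}\end{pmatrix},\qquad A_r=\begin{pmatrix}c_r&d_r&0\\d_r&-c_r&0\\0&0&0_{n-2}\end{pmatrix},\quad r=n+2,\dots,2m+1,$$ for some real numbers $a,b,c_r,d_r$ (when $n=2m+1$ there are no normal directions and condition (b) is empty). -/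

import Mathlib

set_option maxSynthPendingDepth 3

open scoped Manifold ContDiff

noncomputable section

namespace KMContact

/-! ### Riemannian geometry in an open subset of a vector space

`g y` is the metric at the point `y`, written as a bilinear form on the model space `E`. -/

section Coordinates

variable {E : Type*} [NormedAddCommGroup E] [NormedSpace ℝ E]

/-- The Koszul form `koszul g y u v w = ½ (∂_u g(v, w) + ∂_v g(u, w) - ∂_w g(u, v))` at `y`
(Christoffel symbols of the first kind). -/
def koszul (g : E → E →L[ℝ] E →L[ℝ] ℝ) (y : E) : E →L[ℝ] E →L[ℝ] E →L[ℝ] ℝ :=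
  (1 / 2 : ℝ) • (fderiv ℝ g y + (fderiv ℝ g y).flip
    - ((ContinuousLinearMap.flipₗᵢ ℝ E E ℝ).toContinuousLinearEquiv :
        (E →L[ℝ] E →L[ℝ] ℝ) →L[ℝ] (E →L[ℝ] E →L[ℝ] ℝ)) ∘L (fderiv ℝ g y).flip)

theorem koszul_apply (g : E → E →L[ℝ] E →L[ℝ] ℝ) (y u v w : E) :
    koszul g y u v w =
      (1 / 2) * (fderiv ℝ g y u v w + fderiv ℝ g y v u w - fderiv ℝ g y w u v) := by
  simp [koszul]

/-- The Christoffel symbols of the second kind: `christoffel g y u v` is the value at `y` of the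
Levi-Civita derivative `∇_u v` of the constant vector field `v`, i.e. the vector with
`g (∇_u v, w) = koszul g y u v w` for all `w`. -/
def christoffel (g : E → E →L[ℝ] E →L[ℝ] ℝ) (y : E) : E →L[ℝ] E →L[ℝ] E :=
  (ContinuousLinearMap.compL ℝ E (E →L[ℝ] ℝ) E (g y).inverse) ∘L (koszul g y)

theorem christoffel_apply (g : E → E →L[ℝ] E →L[ℝ] ℝ) (y u v : E) :
    christoffel g y u v = (g y).inverse (koszul g y u v) := by
  simp [christoffel]

/-- The curvature tensor `R(u, v) w = ∇_u ∇_v w - ∇_v ∇_u w - ∇_[u, v] w` of the Levi-Civita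
connection at `y` (computed with constant vector fields `u, v, w`, so that `[u, v] = 0`). -/
def curvature (g : E → E →L[ℝ] E →L[ℝ] ℝ) (y u v w : E) : E :=
  fderiv ℝ (fun z => christoffel g z v w) y u - fderiv ℝ (fun z => christoffel g z u w) y v
    + christoffel g y u (christoffel g y v w) - christoffel g y v (christoffel g y u w)

/-- The exterior derivative of a 1-form, with the normalization
`dη(X, Y) = ½ (X η(Y) - Y η(X) - η([X, Y]))` usual in contact metric geometry. -/
def extDeriv (η : E → E →L[ℝ] ℝ) (y u v : E) : ℝ :=
  (1 / 2) * (fderiv ℝ η y u v - fderiv ℝ η y v u)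

/-- The Lie derivative `(L_ξ φ) X = [ξ, φ X] - φ [ξ, X]` of a (1,1)-tensor field `φ` along a
vector field `ξ`, evaluated on constant vector fields `X`. -/
def lieDeriv (ξ : E → E) (φ : E → E →L[ℝ] E) (y : E) : E →L[ℝ] E :=
  fderiv ℝ φ y (ξ y) - fderiv ℝ ξ y ∘L φ y + φ y ∘L fderiv ℝ ξ y

/-- The pullback of a bilinear form by a linear map. -/
def pullback {V : Type*} [NormedAddCommGroup V] [NormedSpace ℝ V]
    (B : V →L[ℝ] V →L[ℝ] ℝ) (T : E →L[ℝ] V) : E →L[ℝ] E →L[ℝ] ℝ :=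
  B.bilinearComp T T

/-- For inner products `gE`, `gV` and an isometric linear map `T`, the tangential part of `w`: the
vector `w^T` of `E` with `gE (w^T, u) = gV (w, T u)` for all `u`. -/
def tangentialPart {V : Type*} [NormedAddCommGroup V] [NormedSpace ℝ V]
    (gE : E →L[ℝ] E →L[ℝ] ℝ) (gV : V →L[ℝ] V →L[ℝ] ℝ) (T : E →L[ℝ] V) : V →L[ℝ] E :=
  gE.inverse ∘L ((ContinuousLinearMap.compL ℝ E V ℝ).flip T) ∘L gV

theorem tangentialPart_apply {V : Type*} [NormedAddCommGroup V] [NormedSpace ℝ V]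
    (gE : E →L[ℝ] E →L[ℝ] ℝ) (gV : V →L[ℝ] V →L[ℝ] ℝ) (T : E →L[ℝ] V) (w : V) :
    tangentialPart gE gV T w = gE.inverse (gV w ∘L T) := by
  simp [tangentialPart]

/-- The normal part `w - T w^T` of the values of a bilinear map `B`. -/
def normalPart {V : Type*} [NormedAddCommGroup V] [NormedSpace ℝ V]
    (gE : E →L[ℝ] E →L[ℝ] ℝ) (gV : V →L[ℝ] V →L[ℝ] ℝ) (T : E →L[ℝ] V)
    (B : E →L[ℝ] E →L[ℝ] V) : E →L[ℝ] E →L[ℝ] V :=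
  (ContinuousLinearMap.compL ℝ E V V
    (ContinuousLinearMap.id ℝ V - T ∘L tangentialPart gE gV T)) ∘L B

theorem normalPart_apply {V : Type*} [NormedAddCommGroup V] [NormedSpace ℝ V]
    (gE : E →L[ℝ] E →L[ℝ] ℝ) (gV : V →L[ℝ] V →L[ℝ] ℝ) (T : E →L[ℝ] V)
    (B : E →L[ℝ] E →L[ℝ] V) (u v : E) :
    normalPart gE gV T B u v = B u v - T (tangentialPart gE gV T (B u v)) := by
  simp [normalPart]

end Coordinates

/-! ### Smooth manifolds with tensor fields, and their expressions in charts -/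

section Charts

/-- The Euclidean model space. -/
abbrev Mod (d : ℕ) : Type := EuclideanSpace ℝ (Fin d)

/-- A smooth Riemannian metric on a `d`-dimensional manifold. -/
abbrev Metric (d : ℕ) (N : Type*) [TopologicalSpace N] [ChartedSpace (Mod d) N]
    [IsManifold (𝓡 d) ∞ N] :=
  Bundle.ContMDiffRiemannianMetric (𝓡 d) ∞ (Mod d) (fun p : N => TangentSpace (𝓡 d) p)

variable {d : ℕ} {N : Type*} [TopologicalSpace N] [ChartedSpace (Mod d) N]

/-- The derivative at the point `y` of the chart domain of the inverse of the preferred chart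
around `x₀`: it sends coordinate vectors to tangent vectors. -/
def frame (x₀ : N) (y : Mod d) :
    Mod d →L[ℝ] TangentSpace (𝓡 d) ((extChartAt (𝓡 d) x₀).symm y) :=
  mfderiv 𝓘(ℝ, Mod d) (𝓡 d) (extChartAt (𝓡 d) x₀).symm y

/-- The derivative of the preferred chart around `x₀` at the point with coordinates `y`: it sends
tangent vectors to coordinate vectors. -/
def coframe (x₀ : N) (y : Mod d) :
    TangentSpace (𝓡 d) ((extChartAt (𝓡 d) x₀).symm y) →L[ℝ] Mod d :=
  mfderiv (𝓡 d) 𝓘(ℝ, Mod d) (extChartAt (𝓡 d) x₀) ((extChartAt (𝓡 d) x₀).symm y)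

/-- The metric in the preferred chart around `x₀`. -/
def metricIn [IsManifold (𝓡 d) ∞ N] (g : Metric d N) (x₀ : N) (y : Mod d) :
    Mod d →L[ℝ] Mod d →L[ℝ] ℝ :=
  pullback (E := Mod d) (V := Mod d) (g.inner ((extChartAt (𝓡 d) x₀).symm y)) (frame x₀ y)

theorem metricIn_apply [IsManifold (𝓡 d) ∞ N] (g : Metric d N) (x₀ : N) (y u v : Mod d) :
    metricIn g x₀ y u v =
      g.inner ((extChartAt (𝓡 d) x₀).symm y) (frame x₀ y u) (frame x₀ y v) := rfl

/-- A vector field in the preferred chart around `x₀`. -/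
def fieldIn (ξ : ∀ p : N, TangentSpace (𝓡 d) p) (x₀ : N) (y : Mod d) : Mod d :=
  coframe x₀ y (ξ ((extChartAt (𝓡 d) x₀).symm y))

/-- A 1-form in the preferred chart around `x₀`. -/
def formIn (η : ∀ p : N, TangentSpace (𝓡 d) p →L[ℝ] ℝ) (x₀ : N) (y : Mod d) : Mod d →L[ℝ] ℝ :=
  η ((extChartAt (𝓡 d) x₀).symm y) ∘L frame x₀ y

/-- A (1,1)-tensor field in the preferred chart around `x₀`. -/
def endoIn (φ : ∀ p : N, TangentSpace (𝓡 d) p →L[ℝ] TangentSpace (𝓡 d) p) (x₀ : N) (y : Mod d) :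
    Mod d →L[ℝ] Mod d :=
  coframe x₀ y ∘L φ ((extChartAt (𝓡 d) x₀).symm y) ∘L frame x₀ y

/-- The curvature tensor of a Riemannian manifold at `p`. In Mathlib `TangentSpace (𝓡 d) p` is the
model space, identified with the tangent space by the derivative of the preferred chart around `p`,
so tensors at `p` are given by their expression in that chart at the point `p`. -/
def riemann [IsManifold (𝓡 d) ∞ N] (g : Metric d N) (p : N) (u v w : TangentSpace (𝓡 d) p) :
    TangentSpace (𝓡 d) p :=
  curvature (E := Mod d) (metricIn g p) (extChartAt (𝓡 d) p p) u v w

/-- `e` is an orthonormal family of tangent vectors at `p`. -/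
def IsOrthonormal [IsManifold (𝓡 d) ∞ N] (g : Metric d N) {p : N} {k : ℕ}
    (e : Fin k → TangentSpace (𝓡 d) p) : Prop :=
  ∀ i j, g.inner p (e i) (e j) = if i = j then 1 else 0

/-- The sectional curvature `K` of the plane spanned by the orthonormal pair `u, v`. -/
def sectional [IsManifold (𝓡 d) ∞ N] (g : Metric d N) (p : N) (u v : TangentSpace (𝓡 d) p) : ℝ :=
  g.inner p (riemann g p u v v) u

/-- The scalar curvature `τ = ∑_{i < j} K(e_i, e_j)`, where `e` is an orthonormal basis of the
tangent space at `p`. -/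
def scalarCurvature [IsManifold (𝓡 d) ∞ N] (g : Metric d N) (p : N)
    (e : Fin d → TangentSpace (𝓡 d) p) : ℝ :=
  ∑ i, ∑ j, if i < j then sectional g p (e i) (e j) else 0

end Charts

/-! ### Contact metric geometry -/

section Contact

variable {D : ℕ} {N : Type*} [TopologicalSpace N] [ChartedSpace (Mod D) N]
  [IsManifold (𝓡 D) ∞ N]

/-- An almost contact metric structure `(φ, ξ, η, g)` on a Riemannian manifold `(N, g)`. -/
structure AlmostContactMetric (g : Metric D N) where
  phi : ∀ p : N, TangentSpace (𝓡 D) p →L[ℝ] TangentSpace (𝓡 D) p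
  xi : ∀ p : N, TangentSpace (𝓡 D) p
  eta : ∀ p : N, TangentSpace (𝓡 D) p →L[ℝ] ℝ
  contMDiff_phi : ContMDiff (𝓡 D) ((𝓡 D).prod 𝓘(ℝ, Mod D →L[ℝ] Mod D)) ∞
    (fun p => Bundle.TotalSpace.mk' (Mod D →L[ℝ] Mod D)
      (E := fun p : N => TangentSpace (𝓡 D) p →L[ℝ] TangentSpace (𝓡 D) p) p (phi p))
  contMDiff_xi : ContMDiff (𝓡 D) ((𝓡 D).prod 𝓘(ℝ, Mod D)) ∞
    (fun p => Bundle.TotalSpace.mk' (Mod D) (E := fun p : N => TangentSpace (𝓡 D) p) p (xi p))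
  contMDiff_eta : ContMDiff (𝓡 D) ((𝓡 D).prod 𝓘(ℝ, Mod D →L[ℝ] ℝ)) ∞
    (fun p => Bundle.TotalSpace.mk' (Mod D →L[ℝ] ℝ)
      (E := fun p : N => TangentSpace (𝓡 D) p →L[ℝ] Bundle.Trivial N ℝ p) p (eta p))
  phi_phi : ∀ p u, phi p (phi p u) = -u + eta p u • xi p
  eta_xi : ∀ p, eta p (xi p) = 1
  phi_xi : ∀ p, phi p (xi p) = 0
  eta_phi : ∀ p u, eta p (phi p u) = 0
  inner_phi_phi : ∀ p u v,
    g.inner p u v = g.inner p (phi p u) (phi p v) + eta p u * eta p v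
  inner_xi : ∀ p u, g.inner p u (xi p) = eta p u

namespace AlmostContactMetric

variable {g : Metric D N} (S : AlmostContactMetric g)

/-- The tensor `h = ½ L_ξ φ` in the preferred chart around `x₀`. -/
def hIn (x₀ : N) (y : Mod D) : Mod D →L[ℝ] Mod D :=
  (1 / 2 : ℝ) • lieDeriv (fieldIn S.xi x₀) (endoIn S.phi x₀) y

/-- The tensor `h = ½ L_ξ φ` at the point `p`. -/
def h (p : N) : TangentSpace (𝓡 D) p →L[ℝ] TangentSpace (𝓡 D) p :=
  S.hIn p (extChartAt (𝓡 D) p p)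

/-- The structure is a contact metric structure: `⟨X, φ Y⟩ = dη(X, Y)`. The identity of tensor
fields is expressed at all points of all preferred charts. -/
def IsContactMetric : Prop :=
  ∀ x₀ : N, ∀ y ∈ (extChartAt (𝓡 D) x₀).target, ∀ u v : Mod D,
    metricIn g x₀ y u (endoIn S.phi x₀ y v) = extDeriv (formIn S.eta x₀) y u v

/-- `ξ` belongs to the `(κ, μ)`-nullity distribution:
`R(X, Y) ξ = κ (⟨Y, ξ⟩ X - ⟨X, ξ⟩ Y) + μ (⟨Y, ξ⟩ h X - ⟨X, ξ⟩ h Y)` for all `X, Y`. -/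
def XiMemNullity (κ μ : ℝ) : Prop :=
  ∀ x₀ : N, ∀ y ∈ (extChartAt (𝓡 D) x₀).target, ∀ u v : Mod D,
    curvature (metricIn g x₀) y u v (fieldIn S.xi x₀ y) =
      κ • (metricIn g x₀ y v (fieldIn S.xi x₀ y) • u
            - metricIn g x₀ y u (fieldIn S.xi x₀ y) • v)
      + μ • (metricIn g x₀ y v (fieldIn S.xi x₀ y) • S.hIn x₀ y u
            - metricIn g x₀ y u (fieldIn S.xi x₀ y) • S.hIn x₀ y v)

/-- The sectional curvature of every plane spanned by `X` and `φ X`, with `X` a unit vector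
orthogonal to `ξ`, is equal to `c`. -/
def ConstPhiSectional (c : ℝ) : Prop :=
  ∀ x₀ : N, ∀ y ∈ (extChartAt (𝓡 D) x₀).target, ∀ u : Mod D,
    metricIn g x₀ y u u = 1 → metricIn g x₀ y u (fieldIn S.xi x₀ y) = 0 →
    metricIn g x₀ y
      (curvature (metricIn g x₀) y u (endoIn S.phi x₀ y u) (endoIn S.phi x₀ y u)) u = c

/-- A `(κ, μ)`-contact space form: a contact metric manifold such that `ξ` belongs to the
`(κ, μ)`-nullity distribution, of constant `φ`-sectional curvature `c`. -/
def IsSpaceForm (κ μ c : ℝ) : Prop :=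
  S.IsContactMetric ∧ S.XiMemNullity κ μ ∧ S.ConstPhiSectional c

end AlmostContactMetric

end Contact

/-! ### Submanifolds -/

section Submanifold

variable {n D : ℕ} {M N : Type*}
  [TopologicalSpace M] [ChartedSpace (Mod n) M] [IsManifold (𝓡 n) ∞ M]
  [TopologicalSpace N] [ChartedSpace (Mod D) N] [IsManifold (𝓡 D) ∞ N]
  (gM : Metric n M) (gN : Metric D N) (f : M → N) (p : M)

/-- `f` is a smooth isometric immersion of `(M, gM)` into `(N, gN)`. -/
def IsIsometricImmersion : Prop :=
  ContMDiff (𝓡 n) (𝓡 D) ∞ f ∧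
    ∀ (q : M) (u v : TangentSpace (𝓡 n) q),
      gN.inner (f q) (mfderiv (𝓡 n) (𝓡 D) f q u) (mfderiv (𝓡 n) (𝓡 D) f q v) = gM.inner q u v

/-- The tangential part of a vector `w` of the ambient manifold at `f p`: the vector of `T_p M`
with `⟨w^T, X⟩ = ⟨w, df X⟩` for all `X` in `T_p M`. -/
def tangential :
    TangentSpace (𝓡 D) (f p) →L[ℝ] TangentSpace (𝓡 n) p :=
  tangentialPart (E := Mod n) (V := Mod D) (gM.inner p) (gN.inner (f p))
    (mfderiv (𝓡 n) (𝓡 D) f p)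

/-- The tangential part `Q^T` of an endomorphism `Q` of the ambient tangent space, as an
endomorphism of `T_p M`. -/
def tangentialEndo
    (Q : TangentSpace (𝓡 D) (f p) →L[ℝ] TangentSpace (𝓡 D) (f p)) :
    TangentSpace (𝓡 n) p →L[ℝ] TangentSpace (𝓡 n) p :=
  tangential gM gN f p ∘L Q ∘L mfderiv (𝓡 n) (𝓡 D) f p

/-- The ambient covariant derivative `∇~_u (df v)` at `p`, where `v` is extended as a constant
vector field in the preferred chart around `p`: with `F` the expression of `f` in the preferred
charts around `p` and `f p`, it is `D²F(u, v) + Γ(DF u, DF v)`. -/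
def ambientDeriv :
    TangentSpace (𝓡 n) p →L[ℝ] TangentSpace (𝓡 n) p →L[ℝ] TangentSpace (𝓡 D) (f p) :=
  let F : Mod n → Mod D := writtenInExtChartAt (𝓡 n) (𝓡 D) p f
  let x : Mod n := extChartAt (𝓡 n) p p
  let Γ := christoffel (E := Mod D) (metricIn gN (f p)) (extChartAt (𝓡 D) (f p) (f p))
  fderiv ℝ (fderiv ℝ F) x + Γ.bilinearComp (fderiv ℝ F x) (fderiv ℝ F x)

/-- The second fundamental form, defined by the Gauss formula `∇~_X Y = ∇_X Y + σ(X, Y)`: `σ(u, v)`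
is the normal part of the ambient covariant derivative. -/
def secondFF :
    TangentSpace (𝓡 n) p →L[ℝ] TangentSpace (𝓡 n) p →L[ℝ] TangentSpace (𝓡 D) (f p) :=
  normalPart (E := Mod n) (V := Mod D) (gM.inner p) (gN.inner (f p))
    (mfderiv (𝓡 n) (𝓡 D) f p) (ambientDeriv gN f p)

/-- The shape operator `A_ν` in the normal direction `ν`: `⟨A_ν X, Y⟩ = ⟨σ(X, Y), ν⟩`. -/
def shapeOperator (ν : TangentSpace (𝓡 D) (f p)) (u : TangentSpace (𝓡 n) p) :
    TangentSpace (𝓡 n) p :=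
  (gM.inner p).inverse (gN.inner (f p) ν ∘L secondFF gM gN f p u)

/-- The matrix of the shape operator `A_ν` in the orthonormal basis `e` of `T_p M`. -/
def shapeMatrix (ν : TangentSpace (𝓡 D) (f p)) (e : Fin n → TangentSpace (𝓡 n) p) :
    Matrix (Fin n) (Fin n) ℝ :=
  Matrix.of fun i j => gM.inner p (e i) (shapeOperator gM gN f p ν (e j))

/-- The mean curvature vector `H = (1/n) trace σ`, computed in the orthonormal basis `e`. -/
def meanCurvature (e : Fin n → TangentSpace (𝓡 n) p) : TangentSpace (𝓡 D) (f p) :=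
  (1 / (n : ℝ)) • ∑ i, secondFF gM gN f p (e i) (e i)

/-- `‖Q‖² = ∑_{i,j} ⟨e_i, Q e_j⟩²` in the orthonormal basis `e`. -/
def normSq (Q : TangentSpace (𝓡 n) p →L[ℝ] TangentSpace (𝓡 n) p)
    (e : Fin n → TangentSpace (𝓡 n) p) : ℝ :=
  ∑ i, ∑ j, gM.inner p (e i) (Q (e j)) ^ 2

/-- The trace `∑ ⟨e_i, Q e_i⟩` in the orthonormal basis `e`. -/
def traceOf (Q : TangentSpace (𝓡 n) p →L[ℝ] TangentSpace (𝓡 n) p)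
    (e : Fin n → TangentSpace (𝓡 n) p) : ℝ :=
  ∑ i, gM.inner p (e i) (Q (e i))

/-- The matrix of `Q` restricted to (and projected on) the plane with orthonormal basis `b`. -/
def planeMatrix (Q : TangentSpace (𝓡 n) p →L[ℝ] TangentSpace (𝓡 n) p)
    (b : Fin 2 → TangentSpace (𝓡 n) p) : Matrix (Fin 2) (Fin 2) ℝ :=
  Matrix.of fun i j => gM.inner p (b i) (Q (b j))

variable {gN} (S : AlmostContactMetric gN)

/-- `P X` is the tangential part of `φ X`. -/
def opP : TangentSpace (𝓡 n) p →L[ℝ] TangentSpace (𝓡 n) p :=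
  tangentialEndo gM gN f p (S.phi (f p))

/-- `h^T X` is the tangential part of `h X`. -/
def opH : TangentSpace (𝓡 n) p →L[ℝ] TangentSpace (𝓡 n) p :=
  tangentialEndo gM gN f p (S.h (f p))

/-- `(φ h)^T X` is the tangential part of `φ h X`. -/
def opPhiH : TangentSpace (𝓡 n) p →L[ℝ] TangentSpace (𝓡 n) p :=
  tangentialEndo gM gN f p (S.phi (f p) ∘L S.h (f p))

/-- The value of `η` on a tangent vector of the submanifold. -/
def etaM (u : TangentSpace (𝓡 n) p) : ℝ := S.eta (f p) (mfderiv (𝓡 n) (𝓡 D) f p u)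

/-- `α(π) = ⟨e₁, P e₂⟩²`, where `b = (e₁, e₂)` is an orthonormal basis of `π`. -/
def alpha (b : Fin 2 → TangentSpace (𝓡 n) p) : ℝ :=
  gM.inner p (b 0) (opP gM f p S (b 1)) ^ 2

/-- `β(π) = η(e₁)² + η(e₂)²`. -/
def beta (b : Fin 2 → TangentSpace (𝓡 n) p) : ℝ :=
  etaM f p S (b 0) ^ 2 + etaM f p S (b 1) ^ 2

/-- `γ(π) = η(e₁)² ⟨h^T e₂, e₂⟩ + η(e₂)² ⟨h^T e₁, e₁⟩ - 2 η(e₁) η(e₂) ⟨h^T e₁, e₂⟩`. -/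
def gamma (b : Fin 2 → TangentSpace (𝓡 n) p) : ℝ :=
  etaM f p S (b 0) ^ 2 * gM.inner p (opH gM f p S (b 1)) (b 1)
    + etaM f p S (b 1) ^ 2 * gM.inner p (opH gM f p S (b 0)) (b 0)
    - 2 * etaM f p S (b 0) * etaM f p S (b 1) * gM.inner p (opH gM f p S (b 0)) (b 1)

/-- The upper bound for `τ - K(π)`; `e` is an orthonormal basis of `T_p M` and `b` an orthonormal
basis of `π`. -/
def chenBound (κ μ c : ℝ) (e : Fin n → TangentSpace (𝓡 n) p)
    (b : Fin 2 → TangentSpace (𝓡 n) p) : ℝ :=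
  (n : ℝ) ^ 2 * ((n : ℝ) - 2) / (2 * ((n : ℝ) - 1))
      * gN.inner (f p) (meanCurvature gM gN f p e) (meanCurvature gM gN f p e)
    + (1 / 8) * n * ((n : ℝ) - 3) * (c + 3) + ((n : ℝ) - 1) * κ
    + 3 * (c - 1) / 8 * (normSq gM p (opP gM f p S) e - 2 * alpha gM f p S b)
    + (1 / 4) * (c + 3 - 4 * κ) * beta f p S b
    - (μ - 1) * gamma gM f p S b
    - (1 / 2) * (2 * (planeMatrix gM p (opH gM f p S) b).trace
        + (planeMatrix gM p (opH gM f p S) b).det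
        - (planeMatrix gM p (opPhiH gM f p S) b).det)
    + (μ + n - 2) * traceOf gM p (opH gM f p S) e
    + (1 / 4) * (normSq gM p (opPhiH gM f p S) e - normSq gM p (opH gM f p S) e
        - traceOf gM p (opPhiH gM f p S) e ^ 2 + traceOf gM p (opH gM f p S) e ^ 2)

end Submanifold

/-- The block matrix `diag(a, b, (a + b) I_{n-2})`. -/
def chenForm₁ (n : ℕ) (a b : ℝ) : Matrix (Fin n) (Fin n) ℝ :=
  Matrix.diagonal fun i => if i.val = 0 then a else if i.val = 1 then b else a + b

/-- The block matrix with upper left block `(c, d; d, -c)` and all other entries zero. -/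
def chenForm₂ (n : ℕ) (c d : ℝ) : Matrix (Fin n) (Fin n) ℝ :=
  Matrix.of fun i j =>
    if i.val = 0 ∧ j.val = 0 then c
    else if i.val = 1 ∧ j.val = 1 then -c
    else if (i.val = 0 ∧ j.val = 1) ∨ (i.val = 1 ∧ j.val = 0) then d
    else 0

end KMContact

end

/-!
The inequality holds because the difference between its two sides is a negative sum of squares in
the components of the second fundamental form: all terms that involve the ambient curvature cancel.

*The ambient curvature.* Everything local happens in one chart, on an open subset of a vector space
(`IsMetricOn`, `IsContactOn`, `IsKappaMuOn`). The nullity condition determines `∇ φ` and `∇ (φ h)`,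
and the Ricci identity then tells how far the curvature is from commuting with `φ`. An explicit
curvature-like form `modelForm` has the same defect and the same `φ`-sectional curvature `c`, so its
difference with the curvature is of Kähler type with vanishing holomorphic sectional curvature, and
has vanishing sectional curvature (`IsCurvatureForm.eq_zero_of_holomorphic`). The outcome is the
formula `IsKappaMuOn.inner_curvature` for the sectional curvatures of a `(κ, μ)`-contact space form.

*The Gauss equation* `IsIsometricOn.gauss` relates the curvatures of the submanifold and of the
ambient space. The passage from manifolds to charts is made by `AlmostContactMetric.isKappaMuOn` and
`IsIsometricImmersion.isIsometricOn`; at the base point of a chart, the tangent space is the model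
space itself, so that the local formulas can be read as pointwise statements.

*Summation.* As `ξ` is tangent, `∑ η(e_i)² = 1` and `∑ η(e_i) ⟨h e_i, e_j⟩ = ⟨h ξ, e_j⟩ = 0` for an
orthonormal basis `e` of the tangent space. Summing the Gauss equation over the planes spanned by
the basis, the ambient terms become those of the bound, and only
`∑_{i<j} (⟨σ_ii, σ_jj⟩ - |σ_ij|²) - ⟨σ_00, σ_11⟩ + |σ_01|² - (n - 2) / (2 (n - 1)) |∑ σ_ii|²`
remains (`scalarCurvature_sub_sectional_sub_chenBound`).

*Chen's inequality* (`chen_inequality`) says that this number is never positive: by `chen_defect` it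
is minus a sum of squares. It vanishes if and only if `σ_00 + σ_11` and all `σ_ii` with `i ≥ 2` agree
and all off-diagonal `σ_ij` other than `σ_01` vanish. Taking the first normal vector along the trace
of `σ`, and rotating `e_0, e_1` in the plane `π` so as to diagonalize the corresponding shape
operator, these conditions become the stated forms of the shape operators.
-/

set_option linter.unusedSectionVars false

namespace KMContact

/-! ### Levi-Civita calculus on an open subset of a vector space -/

theorem minSmoothness_two_le_infty : minSmoothness ℝ 2 ≤ ∞ := by
  simpa using (ENat.LEInfty.out : (2 : WithTop ℕ∞) ≤ ∞)

section MetricOn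

variable {E : Type*} [NormedAddCommGroup E] [NormedSpace ℝ E] [FiniteDimensional ℝ E]

/-- `g` is a smooth Riemannian metric on the open set `U`. -/
structure IsMetricOn (g : E → E →L[ℝ] E →L[ℝ] ℝ) (U : Set E) : Prop where
  isOpen : IsOpen U
  contDiffOn : ContDiffOn ℝ ∞ g U
  symm : ∀ y ∈ U, ∀ u v, g y u v = g y v u
  pos : ∀ y ∈ U, ∀ v, v ≠ 0 → 0 < g y v v

/-- A positive definite form is invertible, so that `christoffel` and `tangentialPart`, defined with
`ContinuousLinearMap.inverse`, take their intended values. -/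
theorem isInvertible_of_pos {B : E →L[ℝ] E →L[ℝ] ℝ} (hB : ∀ v, v ≠ 0 → 0 < B v v) :
    B.IsInvertible := by
  have hinj : Function.Injective (B : E →ₗ[ℝ] (E →L[ℝ] ℝ)) := by
    rw [← LinearMap.ker_eq_bot, LinearMap.ker_eq_bot']
    intro v hv
    by_contra h
    have h1 := hB v h
    have h2 : B v = 0 := hv
    simp [h2] at h1
  have hfin : Module.finrank ℝ E = Module.finrank ℝ (E →L[ℝ] ℝ) := by
    rw [← LinearEquiv.finrank_eq (LinearMap.toContinuousLinearMap (𝕜 := ℝ) (E := E) (F' := ℝ))]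
    exact (Subspace.dual_finrank_eq (K := ℝ) (V := E)).symm
  refine ⟨(LinearEquiv.ofInjectiveOfFinrankEq (B : E →ₗ[ℝ] (E →L[ℝ] ℝ)) hinj
    hfin).toContinuousLinearEquiv, ?_⟩
  ext v w
  rfl

theorem apply_inverse_of_pos {B : E →L[ℝ] E →L[ℝ] ℝ} (hB : ∀ v, v ≠ 0 → 0 < B v v)
    (l : E →L[ℝ] ℝ) (w : E) : B (B.inverse l) w = l w := by
  rw [(isInvertible_of_pos hB).self_apply_inverse]

theorem eq_of_forall_apply_eq {B : E →L[ℝ] E →L[ℝ] ℝ} (hB : ∀ v, v ≠ 0 → 0 < B v v)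
    {v w : E} (h : ∀ z, B v z = B w z) : v = w := by
  by_contra hne
  have := hB (v - w) (sub_ne_zero.2 hne)
  simp [h] at this

theorem fderiv_apply_apply {V W : Type*} [NormedAddCommGroup V] [NormedSpace ℝ V]
    [NormedAddCommGroup W] [NormedSpace ℝ W] {B : E → V →L[ℝ] W →L[ℝ] ℝ} {a : E → V} {b : E → W}
    {y : E} (hB : DifferentiableAt ℝ B y) (ha : DifferentiableAt ℝ a y)
    (hb : DifferentiableAt ℝ b y) (u : E) :
    fderiv ℝ (fun z => B z (a z) (b z)) y u =
      fderiv ℝ B y u (a y) (b y) + B y (fderiv ℝ a y u) (b y) + B y (a y) (fderiv ℝ b y u) := by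
  rw [fderiv_clm_apply (hB.clm_apply ha) hb, fderiv_clm_apply hB ha]
  simp
  ring

/-- The Levi-Civita derivative of a vector field. -/
noncomputable def covVec (g : E → E →L[ℝ] E →L[ℝ] ℝ) (Z : E → E) (y u : E) : E :=
  fderiv ℝ Z y u + christoffel g y u (Z y)

/-- The Levi-Civita derivative of a field of endomorphisms. -/
noncomputable def covEndo (g : E → E →L[ℝ] E →L[ℝ] ℝ) (φ : E → E →L[ℝ] E) (y u : E) : E →L[ℝ] E :=
  fderiv ℝ φ y u + christoffel g y u ∘L φ y - φ y ∘L christoffel g y u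

namespace IsMetricOn

variable {g : E → E →L[ℝ] E →L[ℝ] ℝ} {U : Set E} (hg : IsMetricOn g U)
include hg

theorem mem_nhds {y : E} (hy : y ∈ U) : U ∈ nhds y := hg.isOpen.mem_nhds hy

theorem contDiffAt {y : E} (hy : y ∈ U) : ContDiffAt ℝ ∞ g y :=
  hg.contDiffOn.contDiffAt (hg.mem_nhds hy)

theorem differentiableAt {y : E} (hy : y ∈ U) : DifferentiableAt ℝ g y :=
  (hg.contDiffAt hy).differentiableAt (by simp)

theorem ext {y : E} (hy : y ∈ U) {v w : E} (h : ∀ z, g y v z = g y w z) : v = w :=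
  eq_of_forall_apply_eq (hg.pos y hy) h

theorem fderiv_symm {y : E} (hy : y ∈ U) (u v w : E) :
    fderiv ℝ g y u v w = fderiv ℝ g y u w v := by
  have h1 := fderiv_apply_apply (hg.differentiableAt hy) (differentiableAt_const v)
    (differentiableAt_const w) u
  have h2 := fderiv_apply_apply (hg.differentiableAt hy) (differentiableAt_const w)
    (differentiableAt_const v) u
  simp only [fderiv_fun_const, Pi.zero_apply, zero_apply, map_zero, add_zero] at h1 h2
  rw [← h1, ← h2]
  congr 1
  apply Filter.EventuallyEq.fderiv_eq
  filter_upwards [hg.mem_nhds hy] with z hz using hg.symm z hz v w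

theorem apply_christoffel {y : E} (hy : y ∈ U) (u v w : E) :
    g y (christoffel g y u v) w = koszul g y u v w := by
  rw [christoffel_apply, apply_inverse_of_pos (hg.pos y hy)]

theorem christoffel_symm {y : E} (hy : y ∈ U) (u v : E) :
    christoffel g y u v = christoffel g y v u := by
  apply hg.ext hy
  intro z
  rw [hg.apply_christoffel hy, hg.apply_christoffel hy, koszul_apply, koszul_apply,
    hg.fderiv_symm hy z u v]
  ring

/-- The Levi-Civita connection is compatible with the metric. -/
theorem fderiv_eq {y : E} (hy : y ∈ U) (u v w : E) :
    fderiv ℝ g y u v w = g y (christoffel g y u v) w + g y v (christoffel g y u w) := by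
  rw [hg.symm y hy v, hg.apply_christoffel hy, hg.apply_christoffel hy, koszul_apply, koszul_apply,
    hg.fderiv_symm hy u w v, hg.fderiv_symm hy v u w, hg.fderiv_symm hy w u v]
  ring

theorem contDiffAt_christoffel {y : E} (hy : y ∈ U) : ContDiffAt ℝ ∞ (christoffel g) y := by
  have h1 : ContDiffAt ℝ ∞ (fderiv ℝ g) y := (hg.contDiffAt hy).fderiv_right (by simp)
  have h2 : ContDiffAt ℝ ∞ (koszul g) y := by
    have hfl : ContDiffAt ℝ ∞ (fun z => (fderiv ℝ g z).flip) y :=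
      (ContinuousLinearMap.flipₗᵢ ℝ E E (E →L[ℝ] ℝ)).toContinuousLinearEquiv.contDiff.contDiffAt.comp
        y h1
    unfold koszul
    exact ((h1.add hfl).sub (contDiffAt_const.clm_comp hfl)).const_smul _
  have h3 : ContDiffAt ℝ ∞ (fun z => (g z).inverse) y :=
    (isInvertible_of_pos (hg.pos y hy)).contDiffAt_map_inverse.comp y (hg.contDiffAt hy)
  unfold christoffel
  exact (((ContinuousLinearMap.compL ℝ E (E →L[ℝ] ℝ) E).contDiff.contDiffAt.comp y h3)).clm_comp h2

theorem differentiableAt_christoffel {y : E} (hy : y ∈ U) :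
    DifferentiableAt ℝ (christoffel g) y :=
  (hg.contDiffAt_christoffel hy).differentiableAt (by simp)

theorem fderiv_metric {a b : E → E} {y : E} (hy : y ∈ U) (ha : DifferentiableAt ℝ a y)
    (hb : DifferentiableAt ℝ b y) (u : E) :
    fderiv ℝ (fun z => g z (a z) (b z)) y u =
      g y (covVec g a y u) (b y) + g y (a y) (covVec g b y u) := by
  rw [fderiv_apply_apply (hg.differentiableAt hy) ha hb, hg.fderiv_eq hy]
  simp [covVec]
  ring

theorem fderiv_christoffel_apply {y : E} (hy : y ∈ U) (u v w : E) :
    fderiv ℝ (fun z => christoffel g z v w) y u = fderiv ℝ (christoffel g) y u v w := by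
  rw [fderiv_clm_apply ((hg.differentiableAt_christoffel hy).clm_apply
    (differentiableAt_const _)) (differentiableAt_const _),
    fderiv_clm_apply (hg.differentiableAt_christoffel hy) (differentiableAt_const _)]
  simp

theorem curvature_eq {y : E} (hy : y ∈ U) (u v w : E) :
    curvature g y u v w = fderiv ℝ (christoffel g) y u v w - fderiv ℝ (christoffel g) y v u w
      + christoffel g y u (christoffel g y v w) - christoffel g y v (christoffel g y u w) := by
  rw [curvature, hg.fderiv_christoffel_apply hy, hg.fderiv_christoffel_apply hy]

theorem fderiv_christoffel_symm {y : E} (hy : y ∈ U) (u v w : E) :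
    fderiv ℝ (christoffel g) y u v w = fderiv ℝ (christoffel g) y u w v := by
  rw [← hg.fderiv_christoffel_apply hy, ← hg.fderiv_christoffel_apply hy]
  congr 1
  apply Filter.EventuallyEq.fderiv_eq
  filter_upwards [hg.mem_nhds hy] with z hz using hg.christoffel_symm hz v w

/-- The first Bianchi identity. -/
theorem curvature_bianchi {y : E} (hy : y ∈ U) (u v w : E) :
    curvature g y u v w + curvature g y v w u + curvature g y w u v = 0 := by
  simp only [hg.curvature_eq hy]
  rw [hg.fderiv_christoffel_symm hy u v w, hg.fderiv_christoffel_symm hy v w u,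
    hg.fderiv_christoffel_symm hy w u v, hg.christoffel_symm hy v w, hg.christoffel_symm hy w u,
    hg.christoffel_symm hy v u]
  abel

end IsMetricOn

theorem covEndo_clm_apply (g : E → E →L[ℝ] E →L[ℝ] ℝ) {φ : E → E →L[ℝ] E} {Z : E → E} {y : E}
    (hφ : DifferentiableAt ℝ φ y) (hZ : DifferentiableAt ℝ Z y) (u : E) :
    covVec g (fun z => φ z (Z z)) y u = covEndo g φ y u (Z y) + φ y (covVec g Z y u) := by
  simp only [covVec, covEndo]
  rw [fderiv_clm_apply hφ hZ]
  simp
  abel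

theorem covEndo_comp (g : E → E →L[ℝ] E →L[ℝ] ℝ) {φ ψ : E → E →L[ℝ] E} {y : E}
    (hφ : DifferentiableAt ℝ φ y) (hψ : DifferentiableAt ℝ ψ y) (u : E) :
    covEndo g (fun z => φ z ∘L ψ z) y u = covEndo g φ y u ∘L ψ y + φ y ∘L covEndo g ψ y u := by
  ext w
  simp only [covEndo]
  rw [fderiv_clm_comp hφ hψ]
  simp
  abel

theorem covEndo_add (g : E → E →L[ℝ] E →L[ℝ] ℝ) {φ ψ : E → E →L[ℝ] E} {y : E}
    (hφ : DifferentiableAt ℝ φ y) (hψ : DifferentiableAt ℝ ψ y) (u : E) :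
    covEndo g (fun z => φ z + ψ z) y u = covEndo g φ y u + covEndo g ψ y u := by
  ext w
  simp only [covEndo]
  rw [fderiv_fun_add hφ hψ]
  simp
  abel

theorem covEndo_neg (g : E → E →L[ℝ] E →L[ℝ] ℝ) (φ : E → E →L[ℝ] E) (y u : E) :
    covEndo g (fun z => - φ z) y u = - covEndo g φ y u := by
  ext w
  simp only [covEndo]
  rw [fderiv_fun_neg]
  simp
  abel

theorem covEndo_congr (g : E → E →L[ℝ] E →L[ℝ] ℝ) {φ ψ : E → E →L[ℝ] E} {y : E}
    (h : φ =ᶠ[nhds y] ψ) (u : E) : covEndo g φ y u = covEndo g ψ y u := by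
  simp only [covEndo, h.fderiv_eq, h.eq_of_nhds]

namespace IsMetricOn

variable {g : E → E →L[ℝ] E →L[ℝ] ℝ} {U : Set E} (hg : IsMetricOn g U)
include hg

/-- Second derivatives of the metric commute, so `R(u, v)` is skew for the metric. -/
theorem curvature_skew {y : E} (hy : y ∈ U) (u v w z : E) :
    g y (curvature g y u v w) z = - g y w (curvature g y u v z) := by
  have key : ∀ u v : E, fderiv ℝ (fderiv ℝ g) y u v w z =
      g y (christoffel g y u (christoffel g y v w)) z
      + g y (christoffel g y v w) (christoffel g y u z)
      + g y (fderiv ℝ (christoffel g) y u v w) z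
      + (g y (christoffel g y u w) (christoffel g y v z)
      + g y w (christoffel g y u (christoffel g y v z))
      + g y w (fderiv ℝ (christoffel g) y u v z)) := by
    intro u v
    have hΓ : ∀ w, DifferentiableAt ℝ (fun x => christoffel g x v w) y := fun w =>
      ((hg.differentiableAt_christoffel hy).clm_apply (differentiableAt_const _)).clm_apply
        (differentiableAt_const _)
    have hgg : DifferentiableAt ℝ (fderiv ℝ g) y :=
      ((hg.contDiffAt hy).fderiv_right (m := ∞) (by simp)).differentiableAt (by simp)
    have h1 : fderiv ℝ (fun x => fderiv ℝ g x v w z) y u = fderiv ℝ (fderiv ℝ g) y u v w z := by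
      rw [fderiv_apply_apply (hgg.clm_apply (differentiableAt_const _)) (differentiableAt_const _)
        (differentiableAt_const _), fderiv_clm_apply hgg (differentiableAt_const _)]
      simp
    have h2 : (fun x => fderiv ℝ g x v w z) =ᶠ[nhds y]
        (fun x => g x (christoffel g x v w) z + g x w (christoffel g x v z)) := by
      filter_upwards [hg.mem_nhds hy] with x hx using hg.fderiv_eq hx v w z
    have hd := hg.differentiableAt hy
    rw [← h1, h2.fderiv_eq, fderiv_fun_add
      ((hd.clm_apply (hΓ w)).clm_apply (differentiableAt_const _))
      ((hd.clm_apply (differentiableAt_const _)).clm_apply (hΓ z))]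
    rw [add_apply, hg.fderiv_metric hy (hΓ w) (differentiableAt_const _),
      hg.fderiv_metric hy (differentiableAt_const _) (hΓ z)]
    simp only [covVec, hg.fderiv_christoffel_apply hy]
    simp
    ring
  have hsymm : fderiv ℝ (fderiv ℝ g) y u v = fderiv ℝ (fderiv ℝ g) y v u :=
    ((hg.contDiffAt hy).isSymmSndFDerivAt minSmoothness_two_le_infty).eq u v
  have h1 := key u v
  rw [hsymm, key v u] at h1
  simp only [hg.curvature_eq hy, map_add, map_sub, add_apply, sub_apply]
  linarith

/-- The Ricci identity for a vector field: `R(u, v) ξ` is the commutator of covariant derivatives. -/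
theorem curvature_ricci_vec {ξ : E → E} {y : E} (hy : y ∈ U) (hξ : ContDiffAt ℝ ∞ ξ y) (u v : E) :
    curvature g y u v (ξ y) = covVec g (fun z => covVec g ξ z v) y u
      - covVec g (fun z => covVec g ξ z u) y v := by
  have hgg : DifferentiableAt ℝ (fderiv ℝ ξ) y :=
    (hξ.fderiv_right (m := ∞) (by simp)).differentiableAt (by simp)
  have hdξ : DifferentiableAt ℝ ξ y := hξ.differentiableAt (by simp)
  have hΓ := hg.differentiableAt_christoffel hy
  have key : ∀ u v, covVec g (fun z => covVec g ξ z v) y u =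
      fderiv ℝ (fderiv ℝ ξ) y u v + fderiv ℝ (christoffel g) y u v (ξ y)
        + christoffel g y v (fderiv ℝ ξ y u) + christoffel g y u (fderiv ℝ ξ y v)
        + christoffel g y u (christoffel g y v (ξ y)) := by
    intro u v
    simp only [covVec]
    rw [fderiv_fun_add (hgg.clm_apply (differentiableAt_const _))
      ((hΓ.clm_apply (differentiableAt_const _)).clm_apply hdξ),
      fderiv_clm_apply hgg (differentiableAt_const _),
      fderiv_clm_apply (hΓ.clm_apply (differentiableAt_const _)) hdξ,
      fderiv_clm_apply hΓ (differentiableAt_const _)]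
    simp
    abel
  have hsymm : fderiv ℝ (fderiv ℝ ξ) y u v = fderiv ℝ (fderiv ℝ ξ) y v u :=
    (hξ.isSymmSndFDerivAt minSmoothness_two_le_infty).eq u v
  rw [key, key, hsymm, hg.curvature_eq hy]
  abel

/-- The Ricci identity for a field of endomorphisms. -/
theorem curvature_ricci_endo {φ : E → E →L[ℝ] E} {y : E} (hy : y ∈ U) (hφ : ContDiffAt ℝ ∞ φ y)
    (u v w : E) :
    curvature g y u v (φ y w) - φ y (curvature g y u v w) =
      covEndo g (fun z => covEndo g φ z v) y u w - covEndo g (fun z => covEndo g φ z u) y v w := by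
  have hgg : DifferentiableAt ℝ (fderiv ℝ φ) y :=
    (hφ.fderiv_right (m := ∞) (by simp)).differentiableAt (by simp)
  have hdφ : DifferentiableAt ℝ φ y := hφ.differentiableAt (by simp)
  have hΓ := hg.differentiableAt_christoffel hy
  have key : ∀ u v, covEndo g (fun z => covEndo g φ z v) y u w =
      fderiv ℝ (fderiv ℝ φ) y u v w
        + fderiv ℝ (christoffel g) y u v (φ y w) - φ y (fderiv ℝ (christoffel g) y u v w)
        + (christoffel g y v (fderiv ℝ φ y u w) + christoffel g y u (fderiv ℝ φ y v w))
        - (fderiv ℝ φ y u (christoffel g y v w) + fderiv ℝ φ y v (christoffel g y u w))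
        + christoffel g y u (christoffel g y v (φ y w))
        + φ y (christoffel g y v (christoffel g y u w))
        - (christoffel g y u (φ y (christoffel g y v w))
          + christoffel g y v (φ y (christoffel g y u w))) := by
    intro u v
    have hΓv : DifferentiableAt ℝ (fun z => christoffel g z v) y :=
      hΓ.clm_apply (differentiableAt_const _)
    have hgv : DifferentiableAt ℝ (fun z => fderiv ℝ φ z v) y :=
      hgg.clm_apply (differentiableAt_const _)
    simp only [covEndo]
    rw [fderiv_fun_sub (hgv.fun_add (hΓv.clm_comp hdφ)) (hdφ.clm_comp hΓv),
      fderiv_fun_add hgv (hΓv.clm_comp hdφ), fderiv_clm_comp hΓv hdφ, fderiv_clm_comp hdφ hΓv,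
      fderiv_clm_apply hgg (differentiableAt_const _),
      fderiv_clm_apply hΓ (differentiableAt_const _)]
    simp
    abel
  have hsymm : fderiv ℝ (fderiv ℝ φ) y u v = fderiv ℝ (fderiv ℝ φ) y v u :=
    (hφ.isSymmSndFDerivAt minSmoothness_two_le_infty).eq u v
  rw [key, key, hsymm, hg.curvature_eq hy, hg.curvature_eq hy]
  simp only [map_add, map_sub]
  abel

end IsMetricOn

end MetricOn

/-! ### Contact metric structures on an open set -/

section ContactOn

variable {E : Type*} [NormedAddCommGroup E] [NormedSpace ℝ E] [FiniteDimensional ℝ E]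

/-- `(φ, ξ, η, g)` is a smooth contact metric structure on the open set `U`. -/
structure IsContactOn (g : E → E →L[ℝ] E →L[ℝ] ℝ) (φ : E → E →L[ℝ] E) (ξ : E → E)
    (η : E → E →L[ℝ] ℝ) (U : Set E) : Prop extends IsMetricOn g U where
  contDiffOn_phi : ContDiffOn ℝ ∞ φ U
  contDiffOn_xi : ContDiffOn ℝ ∞ ξ U
  contDiffOn_eta : ContDiffOn ℝ ∞ η U
  phi_phi : ∀ y ∈ U, ∀ u, φ y (φ y u) = -u + η y u • ξ y
  eta_xi : ∀ y ∈ U, η y (ξ y) = 1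
  phi_xi : ∀ y ∈ U, φ y (ξ y) = 0
  eta_phi : ∀ y ∈ U, ∀ u, η y (φ y u) = 0
  inner_phi_phi : ∀ y ∈ U, ∀ u v, g y u v = g y (φ y u) (φ y v) + η y u * η y v
  inner_xi : ∀ y ∈ U, ∀ u, g y u (ξ y) = η y u
  contact : ∀ y ∈ U, ∀ u v, g y u (φ y v) = extDeriv η y u v

/-- The covariant derivative `u ↦ ∇_u ξ` of a vector field. -/
noncomputable def nabla (g : E → E →L[ℝ] E →L[ℝ] ℝ) (ξ : E → E) (y : E) : E →L[ℝ] E :=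
  fderiv ℝ ξ y + (christoffel g y).flip (ξ y)

theorem nabla_apply (g : E → E →L[ℝ] E →L[ℝ] ℝ) (ξ : E → E) (y u : E) :
    nabla g ξ y u = covVec g ξ y u := by
  simp [nabla, covVec]

theorem covVec_const (g : E → E →L[ℝ] E →L[ℝ] ℝ) (v y u : E) :
    covVec g (fun _ => v) y u = christoffel g y u v := by
  simp [covVec]

/-- The tensor `h = ½ L_ξ φ`. -/
noncomputable def hTensor (φ : E → E →L[ℝ] E) (ξ : E → E) (y : E) : E →L[ℝ] E :=
  (1 / 2 : ℝ) • lieDeriv ξ φ y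

namespace IsContactOn

variable {g : E → E →L[ℝ] E →L[ℝ] ℝ} {φ : E → E →L[ℝ] E} {ξ : E → E} {η : E → E →L[ℝ] ℝ}
  {U : Set E} (hc : IsContactOn g φ ξ η U) {y : E} (hy : y ∈ U)
include hc hy

theorem contDiffAt_phi : ContDiffAt ℝ ∞ φ y := hc.contDiffOn_phi.contDiffAt (hc.mem_nhds hy)
theorem contDiffAt_xi : ContDiffAt ℝ ∞ ξ y := hc.contDiffOn_xi.contDiffAt (hc.mem_nhds hy)
theorem contDiffAt_eta : ContDiffAt ℝ ∞ η y := hc.contDiffOn_eta.contDiffAt (hc.mem_nhds hy)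
theorem differentiableAt_phi : DifferentiableAt ℝ φ y :=
  (hc.contDiffAt_phi hy).differentiableAt (by simp)
theorem differentiableAt_xi : DifferentiableAt ℝ ξ y :=
  (hc.contDiffAt_xi hy).differentiableAt (by simp)
theorem differentiableAt_eta : DifferentiableAt ℝ η y :=
  (hc.contDiffAt_eta hy).differentiableAt (by simp)

theorem differentiableAt_phi_apply (w : E) : DifferentiableAt ℝ (fun z => φ z w) y :=
  (hc.differentiableAt_phi hy).clm_apply (differentiableAt_const _)

theorem phi_skew (u v : E) : g y (φ y u) v = - g y u (φ y v) := by
  rw [hc.inner_phi_phi y hy u (φ y v), hc.phi_phi y hy v]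
  simp [hc.inner_xi y hy, hc.eta_phi y hy]

theorem inner_xi_left (u : E) : g y (ξ y) u = η y u := by
  rw [hc.symm y hy, hc.inner_xi y hy]

theorem covVec_phi_apply (u w : E) :
    covVec g (fun z => φ z w) y u = covEndo g φ y u w + φ y (christoffel g y u w) := by
  rw [covEndo_clm_apply g (hc.differentiableAt_phi hy) (differentiableAt_const w), covVec_const]

theorem fderiv_eta (u v : E) :
    fderiv ℝ η y u v = η y (christoffel g y u v) + g y (nabla g ξ y u) v := by
  have h1 : fderiv ℝ (fun z => η z v) y u = fderiv ℝ η y u v := by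
    rw [fderiv_clm_apply (hc.differentiableAt_eta hy) (differentiableAt_const _)]
    simp
  have h2 : (fun z => η z v) =ᶠ[nhds y] (fun z => g z v (ξ z)) := by
    filter_upwards [hc.mem_nhds hy] with z hz using (hc.inner_xi z hz v).symm
  rw [← h1, h2.fderiv_eq,
    hc.fderiv_metric hy (differentiableAt_const _) (hc.differentiableAt_xi hy), covVec_const,
    hc.inner_xi y hy, nabla_apply, hc.symm y hy v]

theorem eta_nabla (u : E) : η y (nabla g ξ y u) = 0 := by
  have h2 : (fun z => g z (ξ z) (ξ z)) =ᶠ[nhds y] (fun _ => (1 : ℝ)) := by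
    filter_upwards [hc.mem_nhds hy] with z hz
    rw [hc.inner_xi z hz, hc.eta_xi z hz]
  have h3 := hc.fderiv_metric hy (hc.differentiableAt_xi hy) (hc.differentiableAt_xi hy) u
  rw [h2.fderiv_eq, hc.inner_xi_left hy, hc.inner_xi y hy, ← nabla_apply] at h3
  simp at h3
  linarith

/-- The skew part of `∇ ξ` is `dη`, that is, `-φ`; hence `nabla g ξ y + φ y` is the symmetric part of
`∇ ξ`. -/
theorem nabla_antisymm (u v : E) :
    g y (nabla g ξ y u) v - g y (nabla g ξ y v) u = 2 * g y u (φ y v) := by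
  rw [hc.contact y hy, extDeriv, hc.fderiv_eta hy, hc.fderiv_eta hy, hc.christoffel_symm hy u v]
  ring

theorem nabla_xi : nabla g ξ y (ξ y) = 0 := by
  apply hc.ext hy
  intro z
  have h := hc.nabla_antisymm hy (ξ y) z
  rw [hc.inner_xi y hy, hc.eta_nabla hy, hc.inner_xi_left hy, hc.eta_phi y hy] at h
  simp
  linarith

/-- The covariant derivative of `φ`, with all indices lowered, is skew in its last two
arguments. -/
theorem covEndo_phi_skew (u v w : E) :
    g y (covEndo g φ y u v) w = - g y v (covEndo g φ y u w) := by
  have h2 : (fun z => g z (φ z v) w + g z v (φ z w)) =ᶠ[nhds y] (fun _ => (0 : ℝ)) := by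
    filter_upwards [hc.mem_nhds hy] with z hz
    rw [hc.phi_skew hz]
    ring
  have hd := hc.differentiableAt hy
  have hv := hc.differentiableAt_phi_apply hy v
  have hw := hc.differentiableAt_phi_apply hy w
  have h3 := congrArg (fun L : E →L[ℝ] ℝ => L u) h2.fderiv_eq
  rw [fderiv_fun_add ((hd.clm_apply hv).clm_apply (differentiableAt_const _))
    ((hd.clm_apply (differentiableAt_const _)).clm_apply hw), add_apply,
    hc.fderiv_metric hy hv (differentiableAt_const _),
    hc.fderiv_metric hy (differentiableAt_const _) hw] at h3
  simp only [covVec_const, hc.covVec_phi_apply hy, map_add, add_apply] at h3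
  have e1 := hc.phi_skew hy (christoffel g y u v) w
  have e2 := hc.phi_skew hy v (christoffel g y u w)
  simp at h3
  linarith

theorem fderiv_inner_phi (u v w : E) :
    fderiv ℝ (fun z => g z v (φ z w)) y u = g y v (covEndo g φ y u w)
      + g y (christoffel g y u v) (φ y w) + g y v (φ y (christoffel g y u w)) := by
  rw [hc.fderiv_metric hy (differentiableAt_const _) (hc.differentiableAt_phi_apply hy w),
    covVec_const, hc.covVec_phi_apply hy, map_add]
  ring

/-- The fundamental 2-form `dη` is closed. -/
theorem covEndo_phi_cyclic (u v w : E) :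
    g y v (covEndo g φ y u w) + g y w (covEndo g φ y v u) + g y u (covEndo g φ y w v) = 0 := by
  have hη : DifferentiableAt ℝ (fderiv ℝ η) y :=
    ((hc.contDiffAt_eta hy).fderiv_right (m := ∞) (by simp)).differentiableAt (by simp)
  have hηa : ∀ v w, DifferentiableAt ℝ (fun z => fderiv ℝ η z v w) y := fun v w =>
    (hη.clm_apply (differentiableAt_const _)).clm_apply (differentiableAt_const _)
  have hηb : ∀ u v w, fderiv ℝ (fun z => fderiv ℝ η z v w) y u = fderiv ℝ (fderiv ℝ η) y u v w := by
    intro u v w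
    rw [fderiv_clm_apply (hη.clm_apply (differentiableAt_const _)) (differentiableAt_const _),
      fderiv_clm_apply hη (differentiableAt_const _)]
    simp
  have hsymm : ∀ u v, fderiv ℝ (fderiv ℝ η) y u v = fderiv ℝ (fderiv ℝ η) y v u := fun u v =>
    ((hc.contDiffAt_eta hy).isSymmSndFDerivAt minSmoothness_two_le_infty).eq u v
  have key : ∀ u v w, fderiv ℝ (fun z => g z v (φ z w)) y u =
      (1 / 2) * (fderiv ℝ (fderiv ℝ η) y u v w - fderiv ℝ (fderiv ℝ η) y u w v) := by
    intro u v w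
    have h2 : (fun z => g z v (φ z w)) =ᶠ[nhds y]
        (fun z => (1 / 2) * (fderiv ℝ η z v w - fderiv ℝ η z w v)) := by
      filter_upwards [hc.mem_nhds hy] with z hz using hc.contact z hz v w
    rw [h2.fderiv_eq, fderiv_const_mul ((hηa v w).fun_sub (hηa w v)),
      fderiv_fun_sub (hηa v w) (hηa w v)]
    simp [hηb]
  have h1 := key u v w
  have h2 := key v w u
  have h3 := key w u v
  rw [hc.fderiv_inner_phi hy] at h1 h2 h3
  rw [hsymm u v, hsymm u w] at h1
  rw [hsymm v w] at h2
  have e1 := hc.phi_skew hy v (christoffel g y u w)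
  have e2 := hc.phi_skew hy w (christoffel g y v u)
  have e3 := hc.phi_skew hy u (christoffel g y w v)
  rw [hc.christoffel_symm hy u w, hc.symm y hy] at e1
  rw [hc.christoffel_symm hy v u, hc.symm y hy] at e2
  rw [hc.christoffel_symm hy w v, hc.symm y hy] at e3
  rw [hc.christoffel_symm hy u w] at h1
  rw [hc.christoffel_symm hy v u] at h2
  rw [hc.christoffel_symm hy w v] at h3
  linarith

theorem covEndo_phi_xi (u : E) : covEndo g φ y u (ξ y) = - φ y (nabla g ξ y u) := by
  have h2 : (fun z => φ z (ξ z)) =ᶠ[nhds y] (fun _ => (0 : E)) := by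
    filter_upwards [hc.mem_nhds hy] with z hz using hc.phi_xi z hz
  have h3 := covEndo_clm_apply g (hc.differentiableAt_phi hy) (hc.differentiableAt_xi hy) u
  rw [covVec, h2.fderiv_eq, hc.phi_xi y hy] at h3
  simp at h3
  rw [nabla_apply, eq_neg_iff_add_eq_zero]
  exact h3.symm

/-- The derivative of `⟨φ v, φ w⟩ = ⟨v, w⟩ - η(v) η(w)`. -/
theorem covEndo_phi_phi (u v w : E) :
    g y (covEndo g φ y u v) (φ y w) + g y (φ y v) (covEndo g φ y u w) =
      - (g y (nabla g ξ y u) v * η y w + η y v * g y (nabla g ξ y u) w) := by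
  have h2 : (fun z => g z (φ z v) (φ z w)) =ᶠ[nhds y] (fun z => g z v w - η z v * η z w) := by
    filter_upwards [hc.mem_nhds hy] with z hz
    rw [hc.inner_phi_phi z hz v w]
    ring
  have hd := hc.differentiableAt hy
  have hv := hc.differentiableAt_phi_apply hy v
  have hw := hc.differentiableAt_phi_apply hy w
  have hη := hc.differentiableAt_eta hy
  have hη' : ∀ v, DifferentiableAt ℝ (fun z => η z v) y := fun v =>
    hη.clm_apply (differentiableAt_const _)
  have hηe : ∀ v, fderiv ℝ (fun z => η z v) y u = fderiv ℝ η y u v := by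
    intro v
    rw [fderiv_clm_apply hη (differentiableAt_const _)]
    simp
  have h3 := congrArg (fun L : E →L[ℝ] ℝ => L u) h2.fderiv_eq
  rw [hc.fderiv_metric hy hv hw, fderiv_fun_sub ((hd.clm_apply (differentiableAt_const _)).clm_apply
    (differentiableAt_const _)) ((hη' v).fun_mul (hη' w)), sub_apply,
    hc.fderiv_metric hy (differentiableAt_const _) (differentiableAt_const _),
    fderiv_fun_mul (hη' v) (hη' w)] at h3
  simp only [covVec_const, hc.covVec_phi_apply hy, map_add, add_apply, smul_apply, hηe,
    hc.fderiv_eta hy, smul_eq_mul] at h3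
  have e1 := hc.inner_phi_phi y hy (christoffel g y u v) w
  have e2 := hc.inner_phi_phi y hy v (christoffel g y u w)
  linarith

/-- The symmetric part of `∇ ξ`. -/
theorem nabla_add_phi_symm (u v : E) :
    g y (nabla g ξ y u + φ y u) v = g y u (nabla g ξ y v + φ y v) := by
  have h := hc.nabla_antisymm hy u v
  have h1 := hc.phi_skew hy u v
  rw [hc.symm y hy (nabla g ξ y v)] at h
  simp only [map_add, add_apply]
  linarith

/-- Closedness of `dη` determines `∇_ξ φ`. -/
theorem inner_covEndo_xi (v w : E) : g y (covEndo g φ y (ξ y) v) w =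
    - g y (φ y (nabla g ξ y v + φ y v) + (nabla g ξ y (φ y v) + φ y (φ y v))) w := by
  have h1 := hc.covEndo_phi_cyclic hy (ξ y) w v
  have h2 := hc.covEndo_phi_skew hy v (ξ y) w
  rw [hc.covEndo_phi_xi hy w] at h1
  rw [hc.covEndo_phi_xi hy v] at h2
  have h3 := hc.nabla_add_phi_symm hy (φ y v) w
  have h4 := hc.phi_skew hy (nabla g ξ y v) w
  have h5 := hc.phi_skew hy v (nabla g ξ y w)
  have h6 := hc.phi_skew hy (φ y v) w
  have h7 := hc.symm y hy w (covEndo g φ y (ξ y) v)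
  have h8 := hc.symm y hy (φ y v) (φ y w)
  simp only [map_add, map_neg, add_apply, neg_apply] at *
  linarith

/-- `∇_ξ φ = 0`, and `φ` anticommutes with the symmetric part of `∇ ξ`. -/
theorem covEndo_phi_along_xi : covEndo g φ y (ξ y) = 0 ∧
    ∀ v, φ y (nabla g ξ y v + φ y v) = - (nabla g ξ y (φ y v) + φ y (φ y v)) := by
  have hS : ∀ v, φ y (φ y (nabla g ξ y v + φ y v)) = - (nabla g ξ y v + φ y v) := by
    intro v
    rw [hc.phi_phi y hy, map_add, hc.eta_nabla hy, hc.eta_phi y hy]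
    simp
  have hcov : ∀ v, covEndo g φ y (ξ y) v =
      - (φ y (nabla g ξ y v + φ y v) + (nabla g ξ y (φ y v) + φ y (φ y v))) := by
    intro v
    apply hc.ext hy
    intro w
    rw [hc.inner_covEndo_xi hy]
    simp
  have hanti : ∀ v, φ y (nabla g ξ y v + φ y v) = - (nabla g ξ y (φ y v) + φ y (φ y v)) := by
    intro v
    have h1 : nabla g ξ y v + φ y v = φ y (nabla g ξ y (φ y v) + φ y (φ y v)) := by
      apply hc.ext hy
      intro w
      have h2 := hc.covEndo_phi_phi hy (ξ y) v w
      have h3 := hc.covEndo_phi_skew hy (ξ y) (φ y v) w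
      rw [hc.nabla_xi hy, hcov v] at h2
      rw [hcov (φ y v)] at h3
      have h4 := hc.phi_skew hy (nabla g ξ y v) w
      have h5 := hc.phi_skew hy (φ y (nabla g ξ y v + φ y v)) w
      have h6 := hc.phi_skew hy (nabla g ξ y (φ y v) + φ y (φ y v)) w
      have h7 : nabla g ξ y (φ y (φ y v)) + φ y (φ y (φ y v)) = - (nabla g ξ y v + φ y v) := by
        rw [hc.phi_phi y hy]
        simp [hc.nabla_xi hy, hc.phi_xi y hy]
        abel
      rw [h7] at h3
      rw [hS v] at h5
      simp only [map_add, map_neg, add_apply, neg_apply, map_zero, zero_mul, mul_zero,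
        zero_apply] at *
      linarith
    rw [h1, hc.phi_phi y hy, map_add, hc.eta_nabla hy, hc.eta_phi y hy]
    simp
  refine ⟨?_, hanti⟩
  ext v
  rw [hcov v, hanti v]
  simp

/-- `h` is `φ` composed with the symmetric part of `∇ ξ`. -/
theorem hTensor_eq (v : E) : hTensor φ ξ y v = φ y (nabla g ξ y v + φ y v) := by
  have h1 := (hc.covEndo_phi_along_xi hy).2 v
  have h2 := congrArg (fun L : E →L[ℝ] E => L v) (hc.covEndo_phi_along_xi hy).1
  have h3 : nabla g ξ y (φ y v) = - φ y (nabla g ξ y v + φ y v) - φ y (φ y v) := by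
    rw [h1]; abel
  have h4 : fderiv ℝ φ y (ξ y) v - fderiv ℝ ξ y (φ y v) + φ y (fderiv ℝ ξ y v) =
      - nabla g ξ y (φ y v) + φ y (nabla g ξ y v) := by
    have h5 : fderiv ℝ φ y (ξ y) v = φ y (christoffel g y (ξ y) v)
        - christoffel g y (ξ y) (φ y v) := by
      simp [covEndo] at h2
      rw [sub_eq_zero] at h2
      rw [← h2]; abel
    rw [h5, hc.christoffel_symm hy (ξ y) v, hc.christoffel_symm hy (ξ y) (φ y v)]
    simp [nabla]
    abel
  simp only [hTensor, lieDeriv, smul_apply, add_apply, sub_apply, ContinuousLinearMap.comp_apply]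
  rw [h4, h3]
  simp only [map_add]
  module

theorem phi_hTensor (v : E) : φ y (hTensor φ ξ y v) = - (nabla g ξ y v + φ y v) := by
  rw [hc.hTensor_eq hy, hc.phi_phi y hy, map_add, hc.eta_nabla hy, hc.eta_phi y hy]
  simp

/-- `∇_v ξ = - φ v - φ h v`. -/
theorem nabla_eq (v : E) : nabla g ξ y v = - φ y v - φ y (hTensor φ ξ y v) := by
  rw [hc.phi_hTensor hy]; abel

theorem hTensor_phi (v : E) : hTensor φ ξ y (φ y v) = - φ y (hTensor φ ξ y v) := by
  rw [hc.hTensor_eq hy, hc.phi_hTensor hy, ← neg_neg (nabla g ξ y (φ y v) + _),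
    ← (hc.covEndo_phi_along_xi hy).2, map_neg, hc.phi_phi y hy, map_add, hc.eta_nabla hy,
    hc.eta_phi y hy]
  simp

theorem hTensor_xi : hTensor φ ξ y (ξ y) = 0 := by
  rw [hc.hTensor_eq hy, hc.nabla_xi hy, hc.phi_xi y hy]; simp

theorem eta_hTensor (v : E) : η y (hTensor φ ξ y v) = 0 := by
  rw [hc.hTensor_eq hy, hc.eta_phi y hy]

theorem hTensor_symm (u v : E) : g y (hTensor φ ξ y u) v = g y u (hTensor φ ξ y v) := by
  have h := (hc.covEndo_phi_along_xi hy).2 v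
  rw [hc.hTensor_eq hy, hc.hTensor_eq hy, hc.phi_skew hy, hc.nabla_add_phi_symm hy, h, map_neg]

theorem contDiffAt_hTensor : ContDiffAt ℝ ∞ (hTensor φ ξ) y := by
  have h1 : ContDiffAt ℝ ∞ (fderiv ℝ φ) y := (hc.contDiffAt_phi hy).fderiv_right (by simp)
  have h2 : ContDiffAt ℝ ∞ (fderiv ℝ ξ) y := (hc.contDiffAt_xi hy).fderiv_right (by simp)
  have h3 := hc.contDiffAt_phi hy
  have h4 := hc.contDiffAt_xi hy
  unfold hTensor lieDeriv
  exact (((h1.clm_apply h4).sub (h2.clm_comp h3)).add (h3.clm_comp h2)).const_smul _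

theorem differentiableAt_hTensor : DifferentiableAt ℝ (hTensor φ ξ) y :=
  (hc.contDiffAt_hTensor hy).differentiableAt (by simp)

end IsContactOn

end ContactOn

/-! ### The nullity condition -/

section Nullity

variable {E : Type*} [NormedAddCommGroup E] [NormedSpace ℝ E] [FiniteDimensional ℝ E]

theorem covEndo_add_left (g : E → E →L[ℝ] E →L[ℝ] ℝ) (φ : E → E →L[ℝ] E) (y u v : E) :
    covEndo g φ y (u + v) = covEndo g φ y u + covEndo g φ y v := by
  ext w
  simp [covEndo]
  abel

theorem covEndo_smul_left (g : E → E →L[ℝ] E →L[ℝ] ℝ) (φ : E → E →L[ℝ] E) (y : E) (a : ℝ) (u : E) :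
    covEndo g φ y (a • u) = a • covEndo g φ y u := by
  ext w
  simp [covEndo, smul_sub]

theorem IsMetricOn.covEndo_symm {g : E → E →L[ℝ] E →L[ℝ] ℝ} {U : Set E} (hg : IsMetricOn g U)
    {ψ : E → E →L[ℝ] E} {y : E} (hy : y ∈ U) (hd : DifferentiableAt ℝ ψ y)
    (hψ : ∀ z ∈ U, ∀ v w, g z (ψ z v) w = g z v (ψ z w)) (u v w : E) :
    g y (covEndo g ψ y u v) w = g y v (covEndo g ψ y u w) := by
  have h2 : (fun z => g z (ψ z v) w) =ᶠ[nhds y] (fun z => g z v (ψ z w)) := by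
    filter_upwards [hg.mem_nhds hy] with z hz using hψ z hz v w
  have hd' : ∀ v, DifferentiableAt ℝ (fun z => ψ z v) y := fun v =>
    hd.clm_apply (differentiableAt_const _)
  have h3 := congrArg (fun L : E →L[ℝ] ℝ => L u) h2.fderiv_eq
  rw [hg.fderiv_metric hy (hd' v) (differentiableAt_const _),
    hg.fderiv_metric hy (differentiableAt_const _) (hd' w)] at h3
  simp only [covEndo_clm_apply g hd (differentiableAt_const _), covVec_const, map_add,
    add_apply] at h3
  have e1 := hψ y hy (christoffel g y u v) w
  have e2 := hψ y hy v (christoffel g y u w)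
  linarith

/-- A contact metric structure whose Reeb field `ξ` belongs to the `(κ, μ)`-nullity
distribution. -/
structure IsKappaMuOn (κ μ : ℝ) (g : E → E →L[ℝ] E →L[ℝ] ℝ) (φ : E → E →L[ℝ] E) (ξ : E → E)
    (η : E → E →L[ℝ] ℝ) (U : Set E) : Prop extends IsContactOn g φ ξ η U where
  nullity : ∀ y ∈ U, ∀ u v, curvature g y u v (ξ y) =
    κ • (g y v (ξ y) • u - g y u (ξ y) • v)
      + μ • (g y v (ξ y) • hTensor φ ξ y u - g y u (ξ y) • hTensor φ ξ y v)

/-- The tensor `φ h`. -/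
noncomputable def phiH (φ : E → E →L[ℝ] E) (ξ : E → E) (y : E) : E →L[ℝ] E :=
  φ y ∘L hTensor φ ξ y

theorem phiH_apply (φ : E → E →L[ℝ] E) (ξ : E → E) (y v : E) :
    phiH φ ξ y v = φ y (hTensor φ ξ y v) := rfl

namespace IsContactOn

variable {g : E → E →L[ℝ] E →L[ℝ] ℝ} {φ : E → E →L[ℝ] E} {ξ : E → E} {η : E → E →L[ℝ] ℝ}
  {U : Set E} (hc : IsContactOn g φ ξ η U) {y : E} (hy : y ∈ U)
include hc hy

theorem differentiableAt_phiH : DifferentiableAt ℝ (phiH φ ξ) y :=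
  (hc.differentiableAt_phi hy).clm_comp (hc.differentiableAt_hTensor hy)

theorem phiH_phi (v : E) : phiH φ ξ y (φ y v) = - φ y (phiH φ ξ y v) := by
  rw [phiH_apply, phiH_apply, hc.hTensor_phi hy, map_neg]

theorem phiH_symm (u v : E) : g y (phiH φ ξ y u) v = g y u (phiH φ ξ y v) := by
  rw [phiH_apply, phiH_apply, hc.phi_skew hy, hc.hTensor_symm hy, hc.hTensor_phi hy, map_neg,
    neg_neg]

theorem eta_phiH (v : E) : η y (phiH φ ξ y v) = 0 := hc.eta_phi y hy _

theorem phi_phi_of_eta {v : E} (hv : η y v = 0) : φ y (φ y v) = - v := by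
  rw [hc.phi_phi y hy, hv]; simp

theorem nabla_eventuallyEq :
    nabla g ξ =ᶠ[nhds y] fun z => - (φ z + phiH φ ξ z) := by
  filter_upwards [hc.mem_nhds hy] with z hz
  ext v
  rw [hc.nabla_eq hz]
  simp [phiH_apply]
  abel

theorem covEndo_nabla (u : E) :
    covEndo g (nabla g ξ) y u = - (covEndo g φ y u + covEndo g (phiH φ ξ) y u) := by
  rw [covEndo_congr g (hc.nabla_eventuallyEq hy), covEndo_neg,
    covEndo_add g (hc.differentiableAt_phi hy) (hc.differentiableAt_phiH hy)]

theorem differentiableAt_nabla : DifferentiableAt ℝ (nabla g ξ) y :=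
  (hc.nabla_eventuallyEq hy).differentiableAt_iff.2
    ((hc.differentiableAt_phi hy).add (hc.differentiableAt_phiH hy)).neg

/-- Codazzi-type form of the Ricci identity: `R(u, v) ξ = (∇_u A) v - (∇_v A) u` with `A = ∇ ξ`. -/
theorem curvature_xi (u v : E) : curvature g y u v (ξ y) =
    covEndo g (nabla g ξ) y u v - covEndo g (nabla g ξ) y v u := by
  rw [hc.curvature_ricci_vec hy (hc.contDiffAt_xi hy)]
  have h : ∀ v, (fun z => covVec g ξ z v) = fun z => nabla g ξ z v := by
    intro v
    ext z
    rw [nabla_apply]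
  rw [h, h, covEndo_clm_apply g (hc.differentiableAt_nabla hy) (differentiableAt_const _),
    covEndo_clm_apply g (hc.differentiableAt_nabla hy) (differentiableAt_const _), covVec_const,
    covVec_const, hc.christoffel_symm hy u v]
  abel

/-- The derivative of `φ h φ = - φ φ h`. -/
theorem covEndo_phiH_phi (u v : E) :
    covEndo g (phiH φ ξ) y u (φ y v) + phiH φ ξ y (covEndo g φ y u v) =
      - (covEndo g φ y u (phiH φ ξ y v) + φ y (covEndo g (phiH φ ξ) y u v)) := by
  have h2 : (fun z => phiH φ ξ z ∘L φ z) =ᶠ[nhds y] fun z => - (φ z ∘L phiH φ ξ z) := by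
    filter_upwards [hc.mem_nhds hy] with z hz
    ext w
    exact hc.phiH_phi hz w
  have h3 := covEndo_congr g h2 u
  rw [covEndo_neg, covEndo_comp g (hc.differentiableAt_phi hy) (hc.differentiableAt_phiH hy),
    covEndo_comp g (hc.differentiableAt_phiH hy) (hc.differentiableAt_phi hy)] at h3
  simpa using congrArg (fun L : E →L[ℝ] E => L v) h3

theorem covEndo_hTensor_phi_xi (v : E) :
    covEndo g (hTensor φ ξ) y (ξ y) (φ y v) = - φ y (covEndo g (hTensor φ ξ) y (ξ y) v) := by
  have h2 : (fun z => hTensor φ ξ z ∘L φ z) =ᶠ[nhds y] fun z => - (φ z ∘L hTensor φ ξ z) := by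
    filter_upwards [hc.mem_nhds hy] with z hz
    ext w
    exact hc.hTensor_phi hz w
  have h3 := covEndo_congr g h2 (ξ y)
  rw [covEndo_neg, covEndo_comp g (hc.differentiableAt_phi hy) (hc.differentiableAt_hTensor hy),
    covEndo_comp g (hc.differentiableAt_hTensor hy) (hc.differentiableAt_phi hy),
    (hc.covEndo_phi_along_xi hy).1] at h3
  simpa using congrArg (fun L : E →L[ℝ] E => L v) h3

theorem covEndo_phiH_along_xi (v : E) :
    covEndo g (phiH φ ξ) y (ξ y) v = φ y (covEndo g (hTensor φ ξ) y (ξ y) v) := by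
  have : covEndo g (phiH φ ξ) y (ξ y) = _ :=
    covEndo_comp g (hc.differentiableAt_phi hy) (hc.differentiableAt_hTensor hy) (ξ y)
  rw [(hc.covEndo_phi_along_xi hy).1] at this
  simpa using congrArg (fun L : E →L[ℝ] E => L v) this

theorem covEndo_nabla_xi (u : E) :
    covEndo g (nabla g ξ) y u (ξ y) = - nabla g ξ y (nabla g ξ y u) := by
  have h2 : (fun z => nabla g ξ z (ξ z)) =ᶠ[nhds y] (fun _ => (0 : E)) := by
    filter_upwards [hc.mem_nhds hy] with z hz using hc.nabla_xi hz
  have h3 := covEndo_clm_apply g (hc.differentiableAt_nabla hy) (hc.differentiableAt_xi hy) u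
  rw [covVec, h2.fderiv_eq, hc.nabla_xi hy] at h3
  simp at h3
  rw [nabla_apply g ξ y u, eq_neg_iff_add_eq_zero]
  exact h3.symm

theorem nabla_nabla (u : E) : nabla g ξ y (nabla g ξ y u) =
    φ y (φ y u) + hTensor φ ξ y (hTensor φ ξ y u) := by
  have h1 : ∀ v, φ y (φ y (hTensor φ ξ y v)) = - hTensor φ ξ y v := fun v =>
    hc.phi_phi_of_eta hy (hc.eta_hTensor hy v)
  rw [hc.nabla_eq hy, hc.nabla_eq hy]
  simp only [map_sub, map_neg, hc.hTensor_phi hy, h1]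
  abel

/-- On vectors orthogonal to `ξ`, `∇_{φ u} φ = (∇_u φ) ∘ φ`. This is a formal consequence of the
skewness of `∇_u φ`, of its anticommuting with `φ`, and of the cyclic identity for `dη`. -/
theorem covEndo_phi_left {u v w : E} (hu : η y u = 0) (hv : η y v = 0) (hw : η y w = 0) :
    g y (covEndo g φ y (φ y u) v) w = g y (covEndo g φ y u (φ y v)) w := by
  have t1 : ∀ u v w, g y (covEndo g φ y u v) w = - g y (covEndo g φ y u w) v := by
    intro u v w
    rw [hc.covEndo_phi_skew hy, hc.symm y hy v]
  have t2 : ∀ u v w, η y v = 0 → η y w = 0 →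
      g y (covEndo g φ y u v) (φ y w) = g y (covEndo g φ y u (φ y v)) w := by
    intro u v w hv hw
    have h := hc.covEndo_phi_phi hy u v w
    rw [hv, hw, hc.symm y hy (φ y v), t1 u w (φ y v)] at h
    linarith
  have t3 : ∀ u v w, g y (covEndo g φ y u w) v + g y (covEndo g φ y v u) w
      + g y (covEndo g φ y w v) u = 0 := by
    intro u v w
    have h := hc.covEndo_phi_cyclic hy u v w
    rw [hc.symm y hy v, hc.symm y hy w, hc.symm y hy u] at h
    exact h
  have a1 := t3 (φ y u) v w
  have a2 := t3 u (φ y v) w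
  have a3 := t3 u v (φ y w)
  have a4 := t3 (φ y u) (φ y v) (φ y w)
  have q : ∀ a u v, η y u = 0 → η y v = 0 →
      g y (covEndo g φ y a (φ y u)) (φ y v) = - g y (covEndo g φ y a u) v := by
    intro a u v hu hv
    rw [t2 a (φ y u) v (hc.eta_phi y hy u) hv, hc.phi_phi_of_eta hy hu]
    simp
  rw [q _ w v hw hv, q _ u w hu hw, q _ v u hv hu] at a4
  have b1 := t2 u v w hv hw
  have b2 := t2 v w u hw hu
  have b3 := t2 w u v hu hv
  have c1 := t1 u v (φ y w)
  have c2 := t1 v w (φ y u)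
  have c3 := t1 w u (φ y v)
  have d1 := t1 u w (φ y v)
  have d2 := t1 v u (φ y w)
  have d3 := t1 w v (φ y u)
  have e1 := t1 (φ y u) v w
  have e2 := t1 (φ y v) w u
  have e3 := t1 (φ y w) u v
  linarith

end IsContactOn

namespace IsKappaMuOn

variable {κ μ : ℝ} {g : E → E →L[ℝ] E →L[ℝ] ℝ} {φ : E → E →L[ℝ] E} {ξ : E → E} {η : E → E →L[ℝ] ℝ}
  {U : Set E} (hk : IsKappaMuOn κ μ g φ ξ η U) {y : E} (hy : y ∈ U)
include hk hy

theorem curvature_xi_eq (u v : E) : curvature g y u v (ξ y) =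
    κ • (η y v • u - η y u • v) + μ • (η y v • hTensor φ ξ y u - η y u • hTensor φ ξ y v) := by
  rw [hk.nullity y hy, hk.inner_xi y hy, hk.inner_xi y hy]

/-- `h² = (κ - 1) φ²`: compare `R(u, ξ) ξ` with its conjugate by `φ`. -/
theorem hTensor_hTensor (u : E) :
    hTensor φ ξ y (hTensor φ ξ y u) = (κ - 1) • φ y (φ y u) := by
  have hc := hk.toIsContactOn
  have key : ∀ u, - nabla g ξ y (nabla g ξ y u) + φ y (covEndo g (hTensor φ ξ) y (ξ y) u) =
      κ • (u - η y u • ξ y) + μ • hTensor φ ξ y u := by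
    intro u
    have h1 := hc.curvature_xi hy u (ξ y)
    rw [hk.curvature_xi_eq hy, hc.covEndo_nabla_xi hy, hc.covEndo_nabla hy,
      (hc.covEndo_phi_along_xi hy).1, hc.hTensor_xi hy, hc.eta_xi y hy] at h1
    simp only [neg_apply, hc.covEndo_phiH_along_xi hy, zero_add, smul_zero,
      sub_zero, one_smul, sub_neg_eq_add] at h1
    exact h1.symm
  have e1 := key u
  have e2 := congrArg (φ y) (key (φ y u))
  have h1 : ∀ v, φ y (φ y (hTensor φ ξ y v)) = - hTensor φ ξ y v := fun v =>
    hc.phi_phi_of_eta hy (hc.eta_hTensor hy v)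
  have h2 : ∀ v, φ y (φ y (φ y v)) = - φ y v := fun v =>
    hc.phi_phi_of_eta hy (hc.eta_phi y hy v)
  have h3 : u - η y u • ξ y = - φ y (φ y u) := by
    rw [hc.phi_phi y hy]; abel
  rw [h3] at e1
  simp only [hc.nabla_nabla hy, hc.eta_phi y hy, hc.hTensor_phi hy, hc.covEndo_hTensor_phi_xi hy,
    map_add, map_neg, map_smul, h1, h2, zero_smul, sub_zero, neg_neg] at e1 e2
  linear_combination (norm := module) (-1 / 2 : ℝ) • e1 + (1 / 2 : ℝ) • e2

/-- As `R(u, v) ξ = 0` for `u, v` orthogonal to `ξ`, `∇ φ` is determined by `∇ (φ h)`. -/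
theorem covEndo_phi_left_symm {u v : E} (hu : η y u = 0) (hv : η y v = 0) (w : E) :
    g y (covEndo g φ y w u) v = g y (covEndo g (phiH φ ξ) y u v) w
      - g y (covEndo g (phiH φ ξ) y v u) w := by
  have hc := hk.toIsContactOn
  have h1 := hc.curvature_xi hy u v
  rw [hk.curvature_xi_eq hy, hu, hv, hc.covEndo_nabla hy, hc.covEndo_nabla hy] at h1
  have h2 := congrArg (fun z => g y z w) h1
  have h3 := hc.covEndo_phi_cyclic hy u v w
  have h4 := hc.symm y hy v (covEndo g φ y u w)
  have h5 := hc.covEndo_phi_skew hy u w v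
  have h6 := hc.covEndo_phi_skew hy w v u
  have h7 := hc.symm y hy w (covEndo g φ y u v)
  have h8 := hc.symm y hy w (covEndo g φ y v u)
  have h9 := hc.symm y hy v (covEndo g φ y w u)
  have h10 := hc.symm y hy u (covEndo g φ y w v)
  simp at h2
  linarith

/-- All components `T(u, v, w) = ⟨(∇_u φ) v, w⟩` on vectors orthogonal to `ξ` vanish. If `κ ≠ 1`,
then `T(u, v, φ h w)` is symmetric in `u, v`, and `(φ h)² = 1 - κ` on these vectors, so `T` is
symmetric in its first two and skew in its last two arguments. If `κ = 1`, then `h = 0`. -/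
theorem covEndo_phi_horizontal {u v w : E} (hu : η y u = 0) (hv : η y v = 0) (hw : η y w = 0) :
    g y (covEndo g φ y u v) w = 0 := by
  have hc := hk.toIsContactOn
  have hφ := hc.eta_phi y hy
  have hs : ∀ u v w, g y (covEndo g (phiH φ ξ) y u v) w = g y (covEndo g (phiH φ ξ) y u w) v := by
    intro u v w
    rw [hc.covEndo_symm hy (hc.differentiableAt_phiH hy) (fun z hz => hc.phiH_symm hz),
      hc.symm y hy v]
  have t1 : ∀ u v w, g y (covEndo g φ y u v) w = - g y (covEndo g φ y u w) v := by
    intro u v w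
    rw [hc.covEndo_phi_skew hy, hc.symm y hy v]
  have t2 : ∀ u v w, η y v = 0 → η y w = 0 →
      g y (covEndo g φ y u v) (φ y w) = g y (covEndo g φ y u (φ y v)) w := by
    intro u v w hv hw
    have h := hc.covEndo_phi_phi hy u v w
    rw [hv, hw, hc.symm y hy (φ y v), t1 u w (φ y v)] at h
    linarith
  by_cases hκ : κ = 1
  · -- here `h = 0`, so the symmetric part of `∇ ξ` vanishes identically
    have hzero : ∀ z ∈ U, phiH φ ξ z = 0 := by
      intro z hz
      ext v
      have : hTensor φ ξ z v = 0 := by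
        by_contra hne
        have h1 := hk.pos z hz _ hne
        rw [hc.hTensor_symm hz, hk.hTensor_hTensor hz, hκ] at h1
        simp at h1
      simp [phiH_apply, this]
    have h2 : phiH φ ξ =ᶠ[nhds y] fun _ => 0 := by
      filter_upwards [hc.mem_nhds hy] with z hz using hzero z hz
    have h3 : ∀ u, covEndo g (phiH φ ξ) y u = 0 := by
      intro u
      rw [covEndo_congr g h2]
      simp [covEndo]
    rw [hk.covEndo_phi_left_symm hy hv hw, h3, h3]
    simp
  · have key : ∀ u v w, η y u = 0 → η y v = 0 → η y w = 0 →
        g y (covEndo g φ y u v) (phiH φ ξ y w) = g y (covEndo g φ y v u) (phiH φ ξ y w) := by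
      intro u v w hu hv hw
      have hψ := fun v => hc.eta_phiH hy v
      have q : ∀ u v w, η y v = 0 → g y (covEndo g φ y u v) (phiH φ ξ y w)
          + g y (covEndo g φ y u (phiH φ ξ y v)) w =
          - (g y (covEndo g (phiH φ ξ) y u (φ y v)) w
            - g y (covEndo g (phiH φ ξ) y u v) (φ y w)) := by
        intro u v w hv
        have h1 := congrArg (fun z => g y z w) (hc.covEndo_phiH_phi hy u v)
        simp only [map_add, map_neg, add_apply, neg_apply] at h1
        rw [hc.phiH_symm hy, hc.phi_skew hy] at h1
        linarith
      have r := fun u v w hu hv => hk.covEndo_phi_left_symm hy (u := u) (v := v) hu hv w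
      have l := fun u v w hu hv hw => hc.covEndo_phi_left hy (u := u) (v := v) (w := w) hu hv hw
      have ff := fun v hv => hc.phi_phi_of_eta hy (v := v) hv
      -- subtract `q` at `(φ u, φ v)`, where the first term on its left has the opposite sign and
      -- the second one the same sign
      have p : ∀ u v, η y u = 0 → η y v = 0 → 2 * g y (covEndo g φ y u v) (phiH φ ξ y w) =
          (g y (covEndo g (phiH φ ξ) y u v) (φ y w) - g y (covEndo g (phiH φ ξ) y u (φ y v)) w)
          - (g y (covEndo g (phiH φ ξ) y (φ y u) (φ y v)) (φ y w)
            + g y (covEndo g (phiH φ ξ) y (φ y u) v) w) := by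
        intro u v hu hv
        have a1 := q u v w hv
        have a2 := q (φ y u) (φ y v) w (hφ v)
        rw [ff v hv, l u (φ y v) _ hu (hφ v) (hψ w), ff v hv, hc.phiH_phi hy] at a2
        have a3 := l u (phiH φ ξ y v) w hu (hψ v) hw
        have a4 := l u (φ y (phiH φ ξ y v)) w hu (hφ _) hw
        rw [ff _ (hψ v)] at a4
        simp only [map_neg, neg_apply] at a2 a4
        linarith
      have p1 := p u v hu hv
      have p2 := p v u hv hu
      have r1 := r u v (φ y w) hu hv
      have r2 := r (φ y u) (φ y v) (φ y w) (hφ u) (hφ v)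
      have r3 := r u (φ y v) w hu (hφ v)
      have r4 := r (φ y u) v w (hφ u) hv
      have l1 := l w u v hw hu hv
      have l2 := t2 (φ y w) (φ y u) v (hφ u) hv
      have l3 := t2 w u v hu hv
      rw [ff u hu] at l2
      simp only [map_neg, neg_apply] at l2
      linarith
    have hsymm : ∀ u v w, η y u = 0 → η y v = 0 → η y w = 0 →
        g y (covEndo g φ y u v) w = g y (covEndo g φ y v u) w := by
      intro u v w hu hv hw
      have h1 : phiH φ ξ y (phiH φ ξ y w) = (1 - κ) • w := by
        rw [phiH_apply, phiH_apply, hc.hTensor_phi hy, hk.hTensor_hTensor hy,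
          hc.phi_phi_of_eta hy hw]
        simp only [map_smul, map_neg, hc.phi_phi_of_eta hy hw]
        module
      have h2 := key u v (phiH φ ξ y w) hu hv (hc.eta_phiH hy w)
      rw [h1, map_smul, map_smul, smul_eq_mul, smul_eq_mul] at h2
      exact mul_left_cancel₀ (sub_ne_zero.2 (Ne.symm hκ)) h2
    have a1 := hsymm u v w hu hv hw
    have a2 := hsymm v w u hv hw hu
    have a3 := hsymm w u v hw hu hv
    have b1 := t1 u v w
    have b2 := t1 v w u
    have b3 := t1 w u v
    linarith

end IsKappaMuOn

end Nullity

/-! ### Curvature-like forms -/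

section CurvatureForm

variable {E : Type*} [AddCommGroup E] [Module ℝ E]

/-- An additive form with the symmetries of a Riemannian curvature tensor. -/
structure IsCurvatureForm (R : E → E → E → E → ℝ) : Prop where
  add : ∀ x x' y z w, R (x + x') y z w = R x y z w + R x' y z w
  skew : ∀ x y z w, R x y z w = - R y x z w
  skew' : ∀ x y z w, R x y z w = - R x y w z
  bianchi : ∀ x y z w, R x y z w + R y z x w + R z x y w = 0

namespace IsCurvatureForm

variable {R R' : E → E → E → E → ℝ}

theorem sub (hR : IsCurvatureForm R) (hR' : IsCurvatureForm R') :
    IsCurvatureForm (fun x y z w => R x y z w - R' x y z w) where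
  add x x' y z w := by rw [hR.add, hR'.add]; ring
  skew x y z w := by rw [hR.skew, hR'.skew]; ring
  skew' x y z w := by rw [hR.skew', hR'.skew']; ring
  bianchi x y z w := by linarith [hR.bianchi x y z w, hR'.bianchi x y z w]

variable (hR : IsCurvatureForm R)
include hR

theorem pair_symm (x y z w : E) : R x y z w = R z w x y := by
  have b1 := hR.bianchi x y z w
  have b2 := hR.bianchi y z w x
  have b3 := hR.bianchi z w x y
  have b4 := hR.bianchi w x y z
  have s1 := hR.skew' y z x w
  have s2 := hR.skew' z x y w
  have s3 := hR.skew' z w y x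
  have s4 := hR.skew' w y z x
  have s5 := hR.skew' w x z y
  have s6 := hR.skew' x z w y
  have s7 := hR.skew' x y w z
  have s8 := hR.skew' y w x z
  have t1 := hR.skew z x w y
  have t2 := hR.skew w y x z
  have t3 := hR.skew x z y w
  have t4 := hR.skew y w z x
  linarith

theorem add₂ (x y y' z w : E) : R x (y + y') z w = R x y z w + R x y' z w := by
  rw [hR.skew, hR.add, hR.skew y, hR.skew y']; ring

theorem add₃ (x y z z' w : E) : R x y (z + z') w = R x y z w + R x y z' w := by
  rw [hR.pair_symm, hR.add, hR.pair_symm z, hR.pair_symm z']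

theorem add₄ (x y z w w' : E) : R x y z (w + w') = R x y z w + R x y z w' := by
  rw [hR.skew', hR.add₃, hR.skew' x y w, hR.skew' x y w']; ring

theorem neg (x y z w : E) : R (-x) y z w = - R x y z w := by
  have h0 := hR.add 0 0 y z w
  have h1 := hR.add x (-x) y z w
  rw [add_zero] at h0
  rw [add_neg_cancel] at h1
  linarith

theorem neg₂ (x y z w : E) : R x (-y) z w = - R x y z w := by
  rw [hR.skew, hR.neg, hR.skew y, neg_neg]

theorem neg₃ (x y z w : E) : R x y (-z) w = - R x y z w := by
  rw [hR.pair_symm, hR.neg, hR.pair_symm z]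

theorem neg₄ (x y z w : E) : R x y z (-w) = - R x y z w := by
  rw [hR.skew', hR.neg₃, hR.skew' x y w, neg_neg]

/-- A curvature-like form of Kähler type whose holomorphic sectional curvature vanishes has
vanishing sectional curvature. The form is only assumed to be of Kähler type on a subspace `P`. -/
theorem eq_zero_of_holomorphic {P : Submodule ℝ E} {J : E →ₗ[ℝ] E} (hJP : ∀ x ∈ P, J x ∈ P)
    (hJJ : ∀ x ∈ P, J (J x) = -x)
    (hK : ∀ x ∈ P, ∀ y ∈ P, ∀ z ∈ P, ∀ w ∈ P, R x y (J z) (J w) = R x y z w)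
    (hH : ∀ x ∈ P, R x (J x) (J x) x = 0) {x y : E} (hx : x ∈ P) (hy : y ∈ P) :
    R x y y x = 0 := by
  have key : ∀ x ∈ P, ∀ y ∈ P, R x y y x + 3 * R x (J y) (J y) x = 0 := by
    intro x hx y hy
    have hJx := hJP x hx
    have hJy := hJP y hy
    have h1 := hH _ (P.add_mem hx hy)
    have h2 := hH _ (P.sub_mem hx hy)
    have hx0 := hH x hx
    have hy0 := hH y hy
    rw [sub_eq_add_neg] at h2
    simp only [map_add, map_neg, hR.add, hR.add₂, hR.add₃, hR.add₄, hR.neg, hR.neg₂, hR.neg₃,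
      hR.neg₄] at h1 h2
    -- all mixed terms are sectional curvatures of `(x, y)` and `(x, J y)`
    have k1 : R (J x) y y (J x) = R x (J y) (J y) x := by
      rw [← hK _ hJx y hy y hy _ hJx, hJJ x hx, hR.neg₄, hR.pair_symm, ← hK _ hJy x hx _ hJx y hy,
        hJJ x hx, hR.neg₃, hR.skew', hR.skew (J y) x]
      linarith [hR.skew' x (J y) (J y) x]
    have k2 : R x (J y) (J x) y = R x (J y) (J y) x := by
      rw [← hK x hx _ hJy _ hJx y hy, hJJ x hx, hR.neg₃, hR.skew']
      ring
    have k3 : R x (J x) (J y) y = R x y y x + R x (J y) (J y) x := by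
      have b := hR.bianchi x (J x) (J y) y
      have b1 : R (J x) (J y) x y = - R x y y x := by
        rw [hR.pair_symm, hK x hx y hy x hx y hy, hR.skew']
      have b2 : R (J y) x (J x) y = - R x (J y) (J x) y := hR.skew _ _ _ _
      linarith
    have k4 : R y (J x) (J y) x = R x (J y) (J x) y := by
      rw [hR.pair_symm, hR.skew, hR.skew']
      linarith [hR.skew' x (J y) y (J x)]
    have k5 : R y (J y) (J x) x = R x (J x) (J y) y := by
      rw [hR.pair_symm, hR.skew, hR.skew']
      linarith [hR.skew' x (J x) y (J y)]
    have k6 : R y (J x) (J x) y = R (J x) y y (J x) := by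
      rw [hR.skew, hR.skew' _ _ y]
    linarith
  have h1 := key x hx y hy
  have h2 := key x hx (J y) (hJP y hy)
  rw [hJJ y hy, hR.neg₂, hR.neg₃] at h2
  linarith

end IsCurvatureForm

end CurvatureForm

/-! ### Sectional curvature of contact space forms -/

section SpaceForm

variable {E : Type*} [NormedAddCommGroup E] [NormedSpace ℝ E] [FiniteDimensional ℝ E]

theorem IsMetricOn.isCurvatureForm {g : E → E →L[ℝ] E →L[ℝ] ℝ} {U : Set E} (hg : IsMetricOn g U)
    {y : E} (hy : y ∈ U) : IsCurvatureForm (fun u v w z => g y (curvature g y u v w) z) where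
  add x x' u z w := by
    simp only [hg.curvature_eq hy, map_add, map_sub, add_apply, sub_apply]
    ring
  skew x u z w := by
    simp only [hg.curvature_eq hy, map_add, map_sub, add_apply, sub_apply]
    ring
  skew' x u z w := by
    rw [hg.curvature_skew hy, hg.symm y hy z]
  bianchi x u z w := by
    rw [← add_apply, ← add_apply, ← map_add, ← map_add, hg.curvature_bianchi hy]
    simp

/-- The curvature form of a `(κ, μ)`-contact space form, in terms of the metric `G` and of
`Ω(x, y) = ⟨x, φ y⟩`, `A(x, y) = ⟨h x, y⟩`, `B(x, y) = ⟨φ h x, y⟩`, on vectors orthogonal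
to `ξ`. -/
noncomputable def modelForm (c : ℝ) (G Ω A B : E → E → ℝ) (x y z w : E) : ℝ :=
  (c + 3) / 4 * (G y z * G x w - G x z * G y w)
    - (c - 1) / 4 * (2 * Ω x y * Ω z w + Ω x z * Ω y w - Ω y z * Ω x w)
    - 1 / 2 * (A x z * A y w - A y z * A x w - B x z * B y w + B y z * B x w)
    - (G x z * A y w - G y z * A x w + A x z * G y w - A y z * G x w)

theorem isCurvatureForm_modelForm (c : ℝ) {G Ω A B : E → E → ℝ}
    (hG : ∀ x y, G x y = G y x) (hΩ : ∀ x y, Ω x y = - Ω y x) (hA : ∀ x y, A x y = A y x)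
    (hB : ∀ x y, B x y = B y x) (aG : ∀ x x' y, G (x + x') y = G x y + G x' y)
    (aΩ : ∀ x x' y, Ω (x + x') y = Ω x y + Ω x' y) (aA : ∀ x x' y, A (x + x') y = A x y + A x' y)
    (aB : ∀ x x' y, B (x + x') y = B x y + B x' y) : IsCurvatureForm (modelForm c G Ω A B) where
  add x x' y z w := by
    simp only [modelForm, aG, aΩ, aA, aB]
    ring
  skew x y z w := by
    simp only [modelForm]
    rw [hΩ y x]
    ring
  skew' x y z w := by
    simp only [modelForm]
    rw [hΩ w z]
    ring
  bianchi x y z w := by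
    simp only [modelForm]
    rw [hG z x, hG y x, hG z y, hA z x, hA y x, hA z y, hB z x, hB y x, hB z y, hΩ z x, hΩ y x,
      hΩ z y]
    ring

namespace IsKappaMuOn

variable {κ μ : ℝ} {g : E → E →L[ℝ] E →L[ℝ] ℝ} {φ : E → E →L[ℝ] E} {ξ : E → E} {η : E → E →L[ℝ] ℝ}
  {U : Set E} (hk : IsKappaMuOn κ μ g φ ξ η U) {y : E} (hy : y ∈ U)
include hk hy

/-- `(∇_u φ) v = ⟨u + h u, v⟩ ξ - η(v) (u + h u)`. -/
theorem inner_covEndo_phi (u v w : E) : g y (covEndo g φ y u v) w =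
    g y (u + hTensor φ ξ y u) v * η y w - η y v * g y (u + hTensor φ ξ y u) w := by
  have hc := hk.toIsContactOn
  have hdec : ∀ v, ∃ v', η y v' = 0 ∧ v = v' + η y v • ξ y := by
    intro v
    exact ⟨v - η y v • ξ y, by simp [hc.eta_xi y hy], by abel⟩
  have hxi : ∀ w, g y (covEndo g φ y u (ξ y)) w =
      - g y (u + hTensor φ ξ y u) w + η y u * η y w := by
    intro w
    rw [hc.covEndo_phi_xi hy, hc.nabla_eq hy]
    simp only [map_sub, map_neg, hc.phi_phi y hy, hc.eta_hTensor hy, map_add, map_smul, add_apply,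
      neg_apply, smul_apply, smul_eq_mul, hc.inner_xi_left hy, sub_apply]
    ring
  obtain ⟨u', hu', hu⟩ := hdec u
  obtain ⟨v', hv', hv⟩ := hdec v
  obtain ⟨w', hw', hw⟩ := hdec w
  have hu0 : covEndo g φ y u = covEndo g φ y u' := by
    rw [hu, covEndo_add_left, covEndo_smul_left, (hc.covEndo_phi_along_xi hy).1]
    simp
  have h1 := hk.covEndo_phi_horizontal hy hu' hv' hw'
  have h2 := hxi v'
  have h3 := hc.covEndo_phi_skew hy u v' (ξ y)
  have h4 := hxi w
  have hLξ : g y (u + hTensor φ ξ y u) (ξ y) = η y u := by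
    rw [hc.inner_xi y hy, map_add, hc.eta_hTensor hy, add_zero]
  have e1 : g y (covEndo g φ y u v) w = g y (covEndo g φ y u v') w
      + η y v * g y (covEndo g φ y u (ξ y)) w := by
    conv_lhs => rw [hv]
    simp
  have e2 : g y (covEndo g φ y u v') w = g y (covEndo g φ y u v') w'
      + η y w * g y (covEndo g φ y u v') (ξ y) := by
    conv_lhs => rw [hw]
    simp
  have e3 : g y (u + hTensor φ ξ y u) v = g y (u + hTensor φ ξ y u) v' + η y v * η y u := by
    conv_lhs => rw [hv]
    rw [map_add, map_smul, hLξ, smul_eq_mul]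
  rw [hc.symm y hy v'] at h3
  rw [← hu0] at h1
  rw [hv'] at h2
  rw [e1, e2, h1, h3, h2, h4, e3]
  ring

/-- The failure of `R(u, v)` to commute with `φ`, on vectors orthogonal to `ξ`. -/
theorem curvature_phi (u v : E) {w z : E} (hw : η y w = 0) (hz : η y z = 0) :
    g y (curvature g y u v (φ y w) - φ y (curvature g y u v w)) z =
      g y (v + hTensor φ ξ y v) w * g y (nabla g ξ y u) z
        - g y (nabla g ξ y u) w * g y (v + hTensor φ ξ y v) z
        - (g y (u + hTensor φ ξ y u) w * g y (nabla g ξ y v) z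
        - g y (nabla g ξ y v) w * g y (u + hTensor φ ξ y u) z) := by
  have hc := hk.toIsContactOn
  have key : ∀ u v, g y (covEndo g (fun x => covEndo g φ x v) y u w) z =
      g y (v + hTensor φ ξ y v) w * g y (nabla g ξ y u) z
        - g y (nabla g ξ y u) w * g y (v + hTensor φ ξ y v) z := by
    intro u v
    have hgg : DifferentiableAt ℝ (fderiv ℝ φ) y :=
      ((hc.contDiffAt_phi hy).fderiv_right (m := ∞) (by simp)).differentiableAt (by simp)
    have hdφ := hc.differentiableAt_phi hy
    have hΓv : DifferentiableAt ℝ (fun z => christoffel g z v) y :=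
      (hc.differentiableAt_christoffel hy).clm_apply (differentiableAt_const _)
    have hd : DifferentiableAt ℝ (fun x => covEndo g φ x v) y := by
      unfold covEndo
      exact ((hgg.clm_apply (differentiableAt_const _)).add (hΓv.clm_comp hdφ)).sub
        (hdφ.clm_comp hΓv)
    have hdw : DifferentiableAt ℝ (fun x => covEndo g φ x v w) y :=
      hd.clm_apply (differentiableAt_const _)
    have h2 : (fun x => g x (covEndo g φ x v w) z) =ᶠ[nhds y]
        fun x => g x (v + hTensor φ ξ x v) w * η x z - η x w * g x (v + hTensor φ ξ x v) z := by
      filter_upwards [hc.mem_nhds hy] with x hx using hk.inner_covEndo_phi hx v w z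
    have h3 := congrArg (fun L : E →L[ℝ] ℝ => L u) h2.fderiv_eq
    have hη := hc.differentiableAt_eta hy
    have hη' : ∀ v, DifferentiableAt ℝ (fun z => η z v) y := fun v =>
      hη.clm_apply (differentiableAt_const _)
    have hηe : ∀ v, fderiv ℝ (fun z => η z v) y u = fderiv ℝ η y u v := by
      intro v
      rw [fderiv_clm_apply hη (differentiableAt_const _)]
      simp
    have hL : ∀ w, DifferentiableAt ℝ (fun x => g x (v + hTensor φ ξ x v) w) y := fun w =>
      ((hc.differentiableAt hy).clm_apply ((differentiableAt_const _).add
        ((hc.differentiableAt_hTensor hy).clm_apply (differentiableAt_const _)))).clm_apply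
        (differentiableAt_const _)
    rw [hc.fderiv_metric hy hdw (differentiableAt_const _),
      fderiv_fun_sub ((hL w).fun_mul (hη' z)) ((hη' w).fun_mul (hL z)), sub_apply,
      fderiv_fun_mul (hL w) (hη' z), fderiv_fun_mul (hη' w) (hL z),
      covEndo_clm_apply g hd (differentiableAt_const _), covVec_const, covVec_const] at h3
    simp only [add_apply, smul_apply, hw, hz, hηe, hc.fderiv_eta hy, smul_eq_mul, zero_mul,
      zero_add, add_zero] at h3
    rw [map_add, add_apply, hk.inner_covEndo_phi hy v (christoffel g y u w) z,
      hk.inner_covEndo_phi hy v w (christoffel g y u z), hw, hz] at h3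
    linarith
  rw [hc.curvature_ricci_endo hy (hc.contDiffAt_phi hy), map_sub, sub_apply, key, key]

/-- The sectional curvatures of a `(κ, μ)`-contact space form of `φ`-sectional curvature `c`. On
vectors orthogonal to `ξ`, the curvature and `modelForm` commute with `φ` up to the same error, so
their difference is of Kähler type; its holomorphic sectional curvature vanishes. -/
theorem inner_curvature {c : ℝ} (hsec : ∀ u, g y u u = 1 → g y u (ξ y) = 0 →
      g y (curvature g y u (φ y u) (φ y u)) u = c) (u v : E) :
    g y (curvature g y u v v) u =
      (c + 3) / 4 * (g y u u * g y v v - g y u v ^ 2)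
      - (c + 3 - 4 * κ) / 4 * (η y u ^ 2 * g y v v + η y v ^ 2 * g y u u
          - 2 * η y u * η y v * g y u v)
      + 3 * (c - 1) / 4 * g y u (φ y v) ^ 2
      + 1 / 2 * (g y (hTensor φ ξ y u) u * g y (hTensor φ ξ y v) v - g y (hTensor φ ξ y u) v ^ 2
        - (g y (φ y (hTensor φ ξ y u)) u * g y (φ y (hTensor φ ξ y v)) v
          - g y (φ y (hTensor φ ξ y u)) v ^ 2))
      + (g y u u * g y (hTensor φ ξ y v) v + g y v v * g y (hTensor φ ξ y u) u
        - 2 * g y u v * g y (hTensor φ ξ y u) v)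
      + (μ - 1) * (η y u ^ 2 * g y (hTensor φ ξ y v) v + η y v ^ 2 * g y (hTensor φ ξ y u) u
        - 2 * η y u * η y v * g y (hTensor φ ξ y u) v) := by
  have hc := hk.toIsContactOn
  set R : E → E → E → E → ℝ := fun u v w z => g y (curvature g y u v w) z with hRdef
  have hR : IsCurvatureForm R := hc.isCurvatureForm hy
  set G : E → E → ℝ := fun x z => g y x z with hGdef
  set Ω : E → E → ℝ := fun x z => g y x (φ y z) with hΩdef
  set A : E → E → ℝ := fun x z => g y (hTensor φ ξ y x) z with hAdef
  set B : E → E → ℝ := fun x z => g y (φ y (hTensor φ ξ y x)) z with hBdef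
  have hG : ∀ x z, G x z = G z x := fun x z => hc.symm y hy x z
  have hΩ : ∀ x z, Ω x z = - Ω z x := fun x z => by
    simp only [hΩdef]
    rw [← hc.phi_skew hy, hc.symm y hy]
  have hA : ∀ x z, A x z = A z x := fun x z => by
    simp only [hAdef]
    rw [hc.hTensor_symm hy, hc.symm y hy]
  have hB : ∀ x z, B x z = B z x := fun x z => by
    simp only [hBdef]
    rw [← phiH_apply, hc.phiH_symm hy, hc.symm y hy]
    rfl
  have hM : IsCurvatureForm (modelForm c G Ω A B) :=
    isCurvatureForm_modelForm c hG hΩ hA hB (by simp [hGdef]) (by simp [hΩdef]) (by simp [hAdef])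
      (by simp [hBdef])
  -- the forms on images under `φ`
  have hφ := hc.eta_phi y hy
  have G1 : ∀ x z, G x (φ y z) = Ω x z := fun x z => rfl
  have Ω1 : ∀ x z, η y z = 0 → Ω x (φ y z) = - G x z := fun x z hz => by
    simp only [hΩdef, hGdef, hc.phi_phi_of_eta hy hz, map_neg]
  have A1 : ∀ x z, A x (φ y z) = - B x z := fun x z => by
    simp only [hAdef, hBdef, hc.phi_skew hy, neg_neg]
  have B1 : ∀ x z, η y z = 0 → B x (φ y z) = A x z := fun x z hz => by
    simp only [hAdef, hBdef]
    rw [hc.phi_skew hy, hc.phi_phi_of_eta hy hz, map_neg, neg_neg]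
  have hRφ : ∀ x v w z, η y w = 0 → η y z = 0 → R x v (φ y w) (φ y z) = R x v w z +
      (- (G v w + A v w) * (G x z + A x z) - (Ω x w - B x w) * (Ω v z - B v z)
        + (G x w + A x w) * (G v z + A v z) + (Ω v w - B v w) * (Ω x z - B x z)) := by
    intro x v w z hw hz
    have h1 := hk.curvature_phi hy x v hw (hφ z)
    have hL : ∀ x w, g y (x + hTensor φ ξ y x) w = G x w + A x w := fun x w => by
      simp [hGdef, hAdef]
    have hN : ∀ x w, g y (nabla g ξ y x) w = Ω x w - B x w := fun x w => by
      rw [hc.nabla_eq hy, map_sub, map_neg, sub_apply, neg_apply, hc.phi_skew hy, neg_neg]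
    have hφφ : g y (φ y (curvature g y x v w)) (φ y z) = R x v w z := by
      rw [hc.phi_skew hy, hc.phi_phi_of_eta hy hz, map_neg, neg_neg]
    rw [map_sub, sub_apply, hφφ, hL, hL, hL, hL, hN, hN, hN, hN, G1, G1, A1, A1, Ω1 _ _ hz,
      Ω1 _ _ hz, B1 _ _ hz, B1 _ _ hz] at h1
    simp only [hRdef] at h1 ⊢
    linarith
  have hMφ : ∀ x v w z, η y w = 0 → η y z = 0 → modelForm c G Ω A B x v (φ y w) (φ y z) =
      modelForm c G Ω A B x v w z +
      (- (G v w + A v w) * (G x z + A x z) - (Ω x w - B x w) * (Ω v z - B v z)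
        + (G x w + A x w) * (G v z + A v z) + (Ω v w - B v w) * (Ω x z - B x z)) := by
    intro x v w z hw hz
    simp only [modelForm, G1, A1, Ω1 _ _ hz, Ω1 _ _ hw, B1 _ _ hw, B1 _ _ hz]
    rw [hG (φ y w) z, G1, hΩ z w]
    ring
  have hHol : ∀ x, η y x = 0 → R x (φ y x) (φ y x) x = c * G x x ^ 2 := by
    intro x hx
    by_cases hx0 : x = 0
    · subst hx0
      simp [hRdef, hGdef]
    · have hpos := hc.pos y hy x hx0
      set s := Real.sqrt (g y x x) with hs
      have hs0 : s ≠ 0 := (Real.sqrt_pos.2 hpos).ne'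
      have hss : s * s = G x x := Real.mul_self_sqrt hpos.le
      have hunit : g y (s⁻¹ • x) (s⁻¹ • x) = 1 := by
        simp only [map_smul, smul_apply, smul_eq_mul]
        rw [show g y x x = s * s from hss.symm]
        field_simp
      have h1 := hsec (s⁻¹ • x) hunit (by
        rw [hc.inner_xi y hy, map_smul, hx, smul_zero])
      have h2 : g y (curvature g y (s⁻¹ • x) (φ y (s⁻¹ • x)) (φ y (s⁻¹ • x))) (s⁻¹ • x) =
          s⁻¹ * (s⁻¹ * (s⁻¹ * (s⁻¹ * R x (φ y x) (φ y x) x))) := by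
        simp only [hRdef, hc.curvature_eq hy, map_smul, smul_apply, map_add, map_sub, add_apply,
          sub_apply, smul_eq_mul]
        ring
      rw [h2] at h1
      rw [← hss, ← h1]
      field_simp
  have hMHol : ∀ x, η y x = 0 → modelForm c G Ω A B x (φ y x) (φ y x) x = c * G x x ^ 2 := by
    intro x hx
    have h0 : Ω x x = 0 := by linarith [hΩ x x]
    simp only [modelForm, G1, A1, Ω1 _ _ hx, B1 _ _ hx]
    rw [hG (φ y x) x, hA (φ y x) x, hB (φ y x) x, hΩ (φ y x) x]
    simp only [G1, A1, Ω1 _ _ hx, B1 _ _ hx, h0]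
    ring
  have hor : ∀ u v, η y u = 0 → η y v = 0 → R u v v u = modelForm c G Ω A B u v v u := by
    intro u v hu hv
    have h := (hR.sub hM).eq_zero_of_holomorphic (P := LinearMap.ker (η y : E →ₗ[ℝ] ℝ))
      (J := (φ y : E →ₗ[ℝ] E)) (fun x _ => hφ x) (fun x hx => hc.phi_phi_of_eta hy hx)
      (fun x _ v _ w hw z hz => ?_) (fun x hx => ?_) (x := u) (y := v) hu hv
    · exact sub_eq_zero.1 h
    · have h1 := hRφ x v w z hw hz
      have h2 := hMφ x v w z hw hz
      simp only [ContinuousLinearMap.coe_coe]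
      linarith
    · simp only [ContinuousLinearMap.coe_coe]
      rw [hHol x hx, hMHol x hx, sub_self]
  -- split off the components along `ξ`
  have hN : ∀ u v w, R u v (ξ y) w = κ * (η y v * G u w - η y u * G v w)
      + μ * (η y v * A u w - η y u * A v w) := by
    intro u v w
    simp only [hRdef, hGdef, hAdef]
    rw [hk.curvature_xi_eq hy]
    simp
  have hsplit : ∀ u v, R u v v u = R (u - η y u • ξ y) (v - η y v • ξ y) (v - η y v • ξ y)
      (u - η y u • ξ y) - η y u * (κ * (η y v * G u (v - η y v • ξ y) - η y u * G v (v - η y v • ξ y))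
      + μ * (η y v * A u (v - η y v • ξ y) - η y u * A v (v - η y v • ξ y)))
      + η y v * (κ * (η y v * G u u - η y u * G v u) + μ * (η y v * A u u - η y u * A v u)) := by
    intro u v
    set a := η y u with ha
    set b := η y v with hb
    have hu0 : η y (u - a • ξ y) = 0 := by simp [hc.eta_xi y hy, ha]
    have hv0 : η y (v - b • ξ y) = 0 := by simp [hc.eta_xi y hy, hb]
    have smul3 : ∀ u v w z, ∀ a : ℝ, R u v (a • w) z = a * R u v w z := by
      intro u v w z a
      simp only [hRdef, hc.curvature_eq hy, map_smul, smul_apply, map_add, map_sub, add_apply,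
        sub_apply, smul_eq_mul]
      ring
    have smul4 : ∀ u v w z, ∀ a : ℝ, R u v w (a • z) = a * R u v w z := by
      intro u v w z a
      simp only [hRdef, map_smul, smul_eq_mul]
    have d3 : ∀ x z w, R x z v w = R x z (v - b • ξ y) w + b * R x z (ξ y) w := by
      intro x z w
      rw [← smul3, ← hR.add₃, sub_add_cancel]
    have d4 : ∀ x z w, R x z w u = R x z w (u - a • ξ y) + a * R x z w (ξ y) := by
      intro x z w
      rw [← smul4, ← hR.add₄, sub_add_cancel]
    have e1 := d3 u v u
    have e2 := d4 u v (v - b • ξ y)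
    have e3 := hR.skew' u v (v - b • ξ y) (ξ y)
    have e4 := hR.pair_symm u v (v - b • ξ y) (u - a • ξ y)
    have e5 : R (v - b • ξ y) (u - a • ξ y) u v = R (v - b • ξ y) (u - a • ξ y) (u - a • ξ y) v
        + a * R (v - b • ξ y) (u - a • ξ y) (ξ y) v := by
      rw [← smul3, ← hR.add₃, sub_add_cancel]
    have e6 : R (v - b • ξ y) (u - a • ξ y) (u - a • ξ y) v =
        R (v - b • ξ y) (u - a • ξ y) (u - a • ξ y) (v - b • ξ y)
        + b * R (v - b • ξ y) (u - a • ξ y) (u - a • ξ y) (ξ y) := by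
      rw [← smul4, ← hR.add₄, sub_add_cancel]
    have e7 := hR.skew' (v - b • ξ y) (u - a • ξ y) (u - a • ξ y) (ξ y)
    have e8 := hR.pair_symm (v - b • ξ y) (u - a • ξ y) (u - a • ξ y) (v - b • ξ y)
    rw [hN, hu0, hv0] at e7
    rw [hN (v - b • ξ y), hu0, hv0, e6, e7, e8] at e5
    rw [hN] at e1 e3
    rw [e1, e2, e3, e4, e5]
    ring
  have hGξ : ∀ u v, G (u - η y u • ξ y) (v - η y v • ξ y) = G u v - η y u * η y v := by
    intro u v
    simp only [hGdef, map_sub, map_smul, sub_apply, smul_apply, smul_eq_mul, hc.inner_xi y hy,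
      hc.inner_xi_left hy, hc.eta_xi y hy]
    ring
  have hΩξ : ∀ u v, Ω (u - η y u • ξ y) (v - η y v • ξ y) = Ω u v := by
    intro u v
    simp [hΩdef, hc.inner_xi_left hy, hc.phi_xi y hy, hφ]
  have hAξ : ∀ u v, A u (v - η y v • ξ y) = A u v := by
    intro u v
    simp [hAdef, hc.inner_xi y hy, hc.eta_hTensor hy]
  have hAξ' : ∀ u v, A (u - η y u • ξ y) v = A u v := by
    intro u v
    simp [hAdef, hc.hTensor_xi hy]
  have hBξ : ∀ u v, B (u - η y u • ξ y) (v - η y v • ξ y) = B u v := by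
    intro u v
    simp [hBdef, hc.hTensor_xi hy, hc.inner_xi y hy, hφ]
  have hGξ' : ∀ u v, G u (v - η y v • ξ y) = G u v - η y u * η y v := by
    intro u v
    simp only [hGdef, map_sub, map_smul, smul_eq_mul, hc.inner_xi y hy]
    ring
  have h0 : ∀ u, Ω u u = 0 := fun x => by linarith [hΩ x x]
  have hu0 : ∀ u, η y (u - η y u • ξ y) = 0 := fun u => by simp [hc.eta_xi y hy]
  have main := hsplit u v
  rw [hor _ _ (hu0 u) (hu0 v)] at main
  simp only [modelForm, hGξ, hΩξ, hBξ, hAξ, hAξ', hGξ', h0] at main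
  rw [hG v u, hA v u, hB v u, hΩ v u] at main
  refine main.trans ?_
  simp only [hGdef, hΩdef, hAdef, hBdef]
  ring

end IsKappaMuOn

end SpaceForm

/-! ### The Gauss equation in coordinates -/

section Gauss

variable {E : Type*} [NormedAddCommGroup E] [NormedSpace ℝ E] [FiniteDimensional ℝ E]
  {V : Type*} [NormedAddCommGroup V] [NormedSpace ℝ V] [FiniteDimensional ℝ V]

/-- `F` is a smooth isometric immersion of `(W, gE)` into `(U, gV)`, where `W` and `U` are open
sets with Riemannian metrics. -/
structure IsIsometricOn (gE : E → E →L[ℝ] E →L[ℝ] ℝ) (W : Set E) (gV : V → V →L[ℝ] V →L[ℝ] ℝ)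
    (U : Set V) (F : E → V) : Prop where
  source : IsMetricOn gE W
  target : IsMetricOn gV U
  contDiffOn : ContDiffOn ℝ ∞ F W
  mapsTo : Set.MapsTo F W U
  isometry : ∀ y ∈ W, ∀ u v, gE y u v = gV (F y) (fderiv ℝ F y u) (fderiv ℝ F y v)

/-- The covariant derivative of `DF(w)` along `F` in the direction `v`. -/
noncomputable def mapDeriv (gV : V → V →L[ℝ] V →L[ℝ] ℝ) (F : E → V) (y : E) : E →L[ℝ] E →L[ℝ] V :=
  fderiv ℝ (fderiv ℝ F) y + (christoffel gV (F y)).bilinearComp (fderiv ℝ F y) (fderiv ℝ F y)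

theorem mapDeriv_apply (gV : V → V →L[ℝ] V →L[ℝ] ℝ) (F : E → V) (y v w : E) :
    mapDeriv gV F y v w = fderiv ℝ (fderiv ℝ F) y v w
      + christoffel gV (F y) (fderiv ℝ F y v) (fderiv ℝ F y w) := by
  simp [mapDeriv]

namespace IsIsometricOn

variable {gE : E → E →L[ℝ] E →L[ℝ] ℝ} {W : Set E} {gV : V → V →L[ℝ] V →L[ℝ] ℝ} {U : Set V}
  {F : E → V} (hF : IsIsometricOn gE W gV U F) {y : E} (hy : y ∈ W)
include hF hy

theorem contDiffAt : ContDiffAt ℝ ∞ F y := hF.contDiffOn.contDiffAt (hF.source.mem_nhds hy)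

theorem differentiableAt : DifferentiableAt ℝ F y := (hF.contDiffAt hy).differentiableAt (by simp)

theorem contDiffAt_fderiv : ContDiffAt ℝ ∞ (fderiv ℝ F) y := (hF.contDiffAt hy).fderiv_right (by simp)

theorem differentiableAt_fderiv : DifferentiableAt ℝ (fderiv ℝ F) y :=
  (hF.contDiffAt_fderiv hy).differentiableAt (by simp)

theorem differentiableAt_fderiv_fderiv : DifferentiableAt ℝ (fderiv ℝ (fderiv ℝ F)) y :=
  ((hF.contDiffAt_fderiv hy).fderiv_right (m := ∞) (by simp)).differentiableAt (by simp)

theorem fderiv_apply_const (u w : E) :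
    fderiv ℝ (fun z => fderiv ℝ F z w) y u = fderiv ℝ (fderiv ℝ F) y u w := by
  rw [fderiv_clm_apply (hF.differentiableAt_fderiv hy) (differentiableAt_const _)]
  simp

theorem fderiv_fderiv_symm (u v : E) :
    fderiv ℝ (fderiv ℝ F) y u v = fderiv ℝ (fderiv ℝ F) y v u :=
  ((hF.contDiffAt hy).isSymmSndFDerivAt minSmoothness_two_le_infty).eq u v

theorem mapDeriv_symm (u v : E) : mapDeriv gV F y u v = mapDeriv gV F y v u := by
  rw [mapDeriv_apply, mapDeriv_apply, hF.fderiv_fderiv_symm hy,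
    hF.target.christoffel_symm (hF.mapsTo hy)]

/-- The metric is parallel along `F`. -/
theorem fderiv_metric {a b : E → V} (ha : DifferentiableAt ℝ a y) (hb : DifferentiableAt ℝ b y)
    (u : E) : fderiv ℝ (fun z => gV (F z) (a z) (b z)) y u =
      gV (F y) (fderiv ℝ a y u + christoffel gV (F y) (fderiv ℝ F y u) (a y)) (b y)
      + gV (F y) (a y) (fderiv ℝ b y u + christoffel gV (F y) (fderiv ℝ F y u) (b y)) := by
  have hg := hF.target.differentiableAt (hF.mapsTo hy)
  have hFd := hF.differentiableAt hy
  have h1 : fderiv ℝ (fun z => gV (F z)) y = fderiv ℝ gV (F y) ∘L fderiv ℝ F y :=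
    fderiv_comp y hg hFd
  have h2 : DifferentiableAt ℝ (fun z => gV (F z)) y := hg.comp y hFd
  rw [fderiv_apply_apply h2 ha hb, h1, ContinuousLinearMap.comp_apply,
    hF.target.fderiv_eq (hF.mapsTo hy)]
  simp only [map_add, add_apply]
  ring

theorem fderiv_source (u v w : E) : fderiv ℝ gE y u v w =
    gV (F y) (mapDeriv gV F y u v) (fderiv ℝ F y w)
      + gV (F y) (fderiv ℝ F y v) (mapDeriv gV F y u w) := by
  have h1 : fderiv ℝ (fun z => gE z v w) y u = fderiv ℝ gE y u v w := by
    rw [fderiv_apply_apply (hF.source.differentiableAt hy) (differentiableAt_const _)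
      (differentiableAt_const _)]
    simp
  have h2 : (fun z => gE z v w) =ᶠ[nhds y]
      fun z => gV (F z) (fderiv ℝ F z v) (fderiv ℝ F z w) := by
    filter_upwards [hF.source.mem_nhds hy] with z hz using hF.isometry z hz v w
  have hd : ∀ v, DifferentiableAt ℝ (fun z => fderiv ℝ F z v) y := fun v =>
    (hF.differentiableAt_fderiv hy).clm_apply (differentiableAt_const _)
  rw [← h1, h2.fderiv_eq, hF.fderiv_metric hy (hd v) (hd w), hF.fderiv_apply_const hy,
    hF.fderiv_apply_const hy, mapDeriv_apply, mapDeriv_apply]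

/-- The tangential part of the ambient derivative is the intrinsic one. -/
theorem inner_mapDeriv (v w z : E) : gV (F y) (mapDeriv gV F y v w) (fderiv ℝ F y z) =
    gE y (christoffel gE y v w) z := by
  have hsymm := hF.target.symm (F y) (hF.mapsTo hy)
  rw [hF.source.apply_christoffel hy, koszul_apply, hF.fderiv_source hy, hF.fderiv_source hy,
    hF.fderiv_source hy, hF.mapDeriv_symm hy w v, hF.mapDeriv_symm hy z v,
    hF.mapDeriv_symm hy z w, hsymm (fderiv ℝ F y v), hsymm (fderiv ℝ F y w),
    hsymm (mapDeriv gV F y v z)]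
  ring

theorem differentiableAt_mapDeriv : DifferentiableAt ℝ (mapDeriv gV F) y := by
  have h1 := hF.differentiableAt_fderiv hy
  have h2 : DifferentiableAt ℝ (fun z => christoffel gV (F z)) y :=
    (hF.target.differentiableAt_christoffel (hF.mapsTo hy)).comp y (hF.differentiableAt hy)
  have h3 : DifferentiableAt ℝ (fun z => (christoffel gV (F z)).bilinearComp (fderiv ℝ F z)
      (fderiv ℝ F z)) y := by
    have h4 : DifferentiableAt ℝ (fun z => (christoffel gV (F z) ∘L fderiv ℝ F z).flip) y :=
      (ContinuousLinearMap.flipₗᵢ ℝ E V V).toContinuousLinearEquiv.differentiableAt.comp y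
        (h2.clm_comp h1)
    exact (ContinuousLinearMap.flipₗᵢ ℝ E E V).toContinuousLinearEquiv.differentiableAt.comp y
      (h4.clm_comp h1)
  exact (hF.differentiableAt_fderiv_fderiv hy).add h3

/-- The curvature of the ambient space as the commutator of covariant derivatives along `F`. -/
theorem curvature_target (u v w : E) :
    curvature gV (F y) (fderiv ℝ F y u) (fderiv ℝ F y v) (fderiv ℝ F y w) =
      (fderiv ℝ (fun z => mapDeriv gV F z v w) y u
        + christoffel gV (F y) (fderiv ℝ F y u) (mapDeriv gV F y v w))
      - (fderiv ℝ (fun z => mapDeriv gV F z u w) y v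
        + christoffel gV (F y) (fderiv ℝ F y v) (mapDeriv gV F y u w)) := by
  have h1 := hF.differentiableAt_fderiv hy
  have h11 := hF.differentiableAt_fderiv_fderiv hy
  have hg := hF.target.differentiableAt_christoffel (hF.mapsTo hy)
  have hFd := hF.differentiableAt hy
  have h2 : DifferentiableAt ℝ (fun z => christoffel gV (F z)) y := hg.comp y hFd
  have h3 : fderiv ℝ (fun z => christoffel gV (F z)) y =
      fderiv ℝ (christoffel gV) (F y) ∘L fderiv ℝ F y := fderiv_comp y hg hFd
  have hd : ∀ v, DifferentiableAt ℝ (fun z => fderiv ℝ F z v) y := fun v =>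
    h1.clm_apply (differentiableAt_const _)
  have key : ∀ u v, fderiv ℝ (fun z => mapDeriv gV F z v w) y u =
      fderiv ℝ (fderiv ℝ (fderiv ℝ F)) y u v w
      + fderiv ℝ (christoffel gV) (F y) (fderiv ℝ F y u) (fderiv ℝ F y v) (fderiv ℝ F y w)
      + christoffel gV (F y) (fderiv ℝ (fderiv ℝ F) y u v) (fderiv ℝ F y w)
      + christoffel gV (F y) (fderiv ℝ F y v) (fderiv ℝ (fderiv ℝ F) y u w) := by
    intro u v
    simp only [mapDeriv_apply]
    rw [fderiv_fun_add ((h11.clm_apply (differentiableAt_const _)).clm_apply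
      (differentiableAt_const _)) ((h2.clm_apply (hd v)).clm_apply (hd w)),
      fderiv_clm_apply (h11.clm_apply (differentiableAt_const _)) (differentiableAt_const _),
      fderiv_clm_apply h11 (differentiableAt_const _),
      fderiv_clm_apply (h2.clm_apply (hd v)) (hd w), fderiv_clm_apply h2 (hd v), h3]
    simp [hF.fderiv_apply_const hy]
    abel
  have hsymm : fderiv ℝ (fderiv ℝ (fderiv ℝ F)) y u v = fderiv ℝ (fderiv ℝ (fderiv ℝ F)) y v u :=
    ((hF.contDiffAt_fderiv hy).isSymmSndFDerivAt minSmoothness_two_le_infty).eq u v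
  rw [key, key, hsymm, hF.target.curvature_eq (hF.mapsTo hy), mapDeriv_apply, mapDeriv_apply,
    hF.fderiv_fderiv_symm hy u v]
  simp only [map_add]
  abel

/-- The Gauss equation. -/
theorem gauss (u v w z : E) : gE y (curvature gE y u v w) z =
    gV (F y) (curvature gV (F y) (fderiv ℝ F y u) (fderiv ℝ F y v) (fderiv ℝ F y w))
      (fderiv ℝ F y z)
    + gV (F y) (mapDeriv gV F y v w - fderiv ℝ F y (christoffel gE y v w))
        (mapDeriv gV F y u z - fderiv ℝ F y (christoffel gE y u z))
    - gV (F y) (mapDeriv gV F y u w - fderiv ℝ F y (christoffel gE y u w))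
        (mapDeriv gV F y v z - fderiv ℝ F y (christoffel gE y v z)) := by
  have hsymm := hF.target.symm (F y) (hF.mapsTo hy)
  have hd : ∀ v, DifferentiableAt ℝ (fun z => fderiv ℝ F z v) y := fun v =>
    (hF.differentiableAt_fderiv hy).clm_apply (differentiableAt_const _)
  have hA : ∀ v w, DifferentiableAt ℝ (fun z => mapDeriv gV F z v w) y := fun v w =>
    ((hF.differentiableAt_mapDeriv hy).clm_apply (differentiableAt_const _)).clm_apply
      (differentiableAt_const _)
  have hΓ : ∀ v w, DifferentiableAt ℝ (fun x => christoffel gE x v w) y := fun v w =>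
    ((hF.source.differentiableAt_christoffel hy).clm_apply (differentiableAt_const _)).clm_apply
      (differentiableAt_const _)
  -- differentiate `⟨∇_v DF(w), DF z⟩ = ⟨Γ(v, w), z⟩`
  have key : ∀ u v, gV (F y) (fderiv ℝ (fun z => mapDeriv gV F z v w) y u
        + christoffel gV (F y) (fderiv ℝ F y u) (mapDeriv gV F y v w)) (fderiv ℝ F y z)
      + gV (F y) (mapDeriv gV F y v w) (mapDeriv gV F y u z) =
      gE y (fderiv ℝ (christoffel gE) y u v w + christoffel gE y u (christoffel gE y v w)) z
      + gE y (christoffel gE y v w) (christoffel gE y u z) := by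
    intro u v
    have h2 : (fun x => gV (F x) (mapDeriv gV F x v w) (fderiv ℝ F x z)) =ᶠ[nhds y]
        fun x => gE x (christoffel gE x v w) z := by
      filter_upwards [hF.source.mem_nhds hy] with x hx using hF.inner_mapDeriv hx v w z
    have h3 := congrArg (fun L : E →L[ℝ] ℝ => L u) h2.fderiv_eq
    rw [hF.fderiv_metric hy (hA v w) (hd z),
      hF.source.fderiv_metric hy (hΓ v w) (differentiableAt_const _), covVec_const, covVec,
      hF.source.fderiv_christoffel_apply hy, hF.fderiv_apply_const hy, ← mapDeriv_apply] at h3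
    exact h3
  have k1 := key u v
  have k2 := key v u
  have n : ∀ a b c d : E, gV (F y) (mapDeriv gV F y a b - fderiv ℝ F y (christoffel gE y a b))
      (mapDeriv gV F y c d - fderiv ℝ F y (christoffel gE y c d)) =
      gV (F y) (mapDeriv gV F y a b) (mapDeriv gV F y c d)
        - gE y (christoffel gE y a b) (christoffel gE y c d) := by
    intro a b c d
    simp only [map_sub, sub_apply]
    rw [hF.inner_mapDeriv hy, hsymm (fderiv ℝ F y _), hF.inner_mapDeriv hy, ← hF.isometry y hy,
      hF.source.symm y hy (christoffel gE y c d)]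
    ring
  rw [n, n, hF.curvature_target hy, hF.source.curvature_eq hy]
  simp only [map_add, map_sub, add_apply, sub_apply] at k1 k2 ⊢
  linarith

end IsIsometricOn

end Gauss

/-! ### Chen's inequality for vector-valued symmetric forms -/

section Chen

open Module Finset

variable {X Z : Type*} [NormedAddCommGroup X] [InnerProductSpace ℝ X] [FiniteDimensional ℝ X]
  [NormedAddCommGroup Z] [InnerProductSpace ℝ Z]

theorem exists_orthonormalBasis_of_orthonormal {ι : Type*} [Fintype ι] {u : ι → X}
    (hcard : finrank ℝ X = Fintype.card ι) (hu : Orthonormal ℝ u) :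
    ∃ e : OrthonormalBasis ι ℝ X, ∀ i, e i = u i := by
  obtain ⟨e, he⟩ := Orthonormal.exists_orthonormalBasis_extension_of_card_eq (v := u)
    (s := Set.univ) hcard (hu.comp _ Subtype.val_injective)
  exact ⟨e, fun i => he i (Set.mem_univ i)⟩

/-- The trace of a bilinear map does not depend on the orthonormal basis. -/
theorem sum_apply_self_eq {ι κ Y : Type*} [Fintype ι] [Fintype κ] [AddCommGroup Y] [Module ℝ Y]
    (f : X →ₗ[ℝ] X →ₗ[ℝ] Y) (u : OrthonormalBasis ι ℝ X) (e : OrthonormalBasis κ ℝ X) :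
    ∑ i, f (u i) (u i) = ∑ k, f (e k) (e k) := by
  classical
  have h1 : ∀ i, f (u i) (u i) =
      ∑ k, ∑ l, (inner ℝ (e k) (u i) * inner ℝ (u i) (e l)) • f (e k) (e l) := by
    intro i
    conv_lhs => rw [← e.sum_repr' (u i)]
    simp only [map_sum, LinearMap.sum_apply, map_smul, LinearMap.smul_apply, Finset.smul_sum,
      smul_smul, real_inner_comm (e _) (u i)]
    rw [Finset.sum_comm]
    refine Finset.sum_congr rfl fun k _ => Finset.sum_congr rfl fun l _ => ?_
    rw [mul_comm]
  simp only [h1]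
  rw [Finset.sum_comm]
  refine Finset.sum_congr rfl fun k _ => ?_
  rw [Finset.sum_comm]
  simp only [← Finset.sum_smul, u.sum_inner_mul_inner, e.inner_eq_ite, ite_smul, one_smul, zero_smul]
  simp

/-- The squared norm of a bilinear map does not depend on the orthonormal basis. -/
theorem sum_norm_sq_eq {ι κ : Type*} [Fintype ι] [Fintype κ]
    (s : X →ₗ[ℝ] X →ₗ[ℝ] Z) (u : OrthonormalBasis ι ℝ X) (e : OrthonormalBasis κ ℝ X) :
    ∑ i, ∑ j, ‖s (u i) (u j)‖ ^ 2 = ∑ i, ∑ j, ‖s (e i) (e j)‖ ^ 2 := by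
  have h1 : ∀ x, ∑ j, ‖s x (u j)‖ ^ 2 = ∑ j, ‖s x (e j)‖ ^ 2 := by
    intro x
    have := sum_apply_self_eq ((innerₗ Z).compl₁₂ (s x) (s x)) u e
    simpa [real_inner_self_eq_norm_sq] using this
  have h2 : ∀ x, ∑ j, ‖s (u j) x‖ ^ 2 = ∑ j, ‖s (e j) x‖ ^ 2 := by
    intro x
    have := sum_apply_self_eq ((innerₗ Z).compl₁₂ (s.flip x) (s.flip x)) u e
    simpa [real_inner_self_eq_norm_sq] using this
  simp only [h1]
  rw [Finset.sum_comm]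
  simp only [h2]
  rw [Finset.sum_comm]

/-- The Gauss-equation contribution of the plane spanned by `x, y`. -/
noncomputable def gaussTerm (s : X →ₗ[ℝ] X →ₗ[ℝ] Z) (x y : X) : ℝ :=
  inner ℝ (s x x) (s y y) - ‖s x y‖ ^ 2

/-- `gaussTerm` depends only on the plane spanned by an orthonormal pair. -/
theorem gaussTerm_eq_of_mem_span {s : X →ₗ[ℝ] X →ₗ[ℝ] Z} (hs : ∀ x y, s x y = s y x)
    {a b : Fin 2 → X} (ha : Orthonormal ℝ a) (hb : Orthonormal ℝ b)
    (h : ∀ i, a i ∈ Submodule.span ℝ {b 0, b 1}) :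
    gaussTerm s (a 0) (a 1) = gaussTerm s (b 0) (b 1) := by
  obtain ⟨p, q, h0⟩ := Submodule.mem_span_pair.1 (h 0)
  obtain ⟨r, t, h1⟩ := Submodule.mem_span_pair.1 (h 1)
  have hb0 : inner ℝ (b 0) (b 0) = (1 : ℝ) := by simp [hb.1]
  have hb1 : inner ℝ (b 1) (b 1) = (1 : ℝ) := by simp [hb.1]
  have hb01 : inner ℝ (b 0) (b 1) = (0 : ℝ) := hb.2 (by simp)
  have hb10 : inner ℝ (b 1) (b 0) = (0 : ℝ) := hb.2 (by simp)
  have ha0 : inner ℝ (a 0) (a 0) = (1 : ℝ) := by simp [ha.1]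
  have ha1 : inner ℝ (a 1) (a 1) = (1 : ℝ) := by simp [ha.1]
  have ha01 : inner ℝ (a 0) (a 1) = (0 : ℝ) := ha.2 (by simp)
  rw [← h0] at ha0
  rw [← h1] at ha1
  rw [← h0, ← h1] at ha01
  simp only [inner_add_left, inner_add_right, real_inner_smul_left, real_inner_smul_right, hb0, hb1,
    hb01, hb10] at ha0 ha1 ha01
  have hdet : (p * t - q * r) ^ 2 = 1 := by
    have : (p * t - q * r) ^ 2 = (p * p + q * q) * (r * r + t * t) - (p * r + q * t) ^ 2 := by ring
    rw [this]
    have e1 : p * p + q * q = 1 := by linarith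
    have e2 : r * r + t * t = 1 := by linarith
    have e3 : p * r + q * t = 0 := by linarith
    rw [e1, e2, e3]; norm_num
  have key : gaussTerm s (a 0) (a 1) = (p * t - q * r) ^ 2 * gaussTerm s (b 0) (b 1) := by
    rw [← h0, ← h1]
    simp only [gaussTerm, map_add, map_smul, LinearMap.add_apply, LinearMap.smul_apply,
      ← real_inner_self_eq_norm_sq, hs (b 1) (b 0)]
    simp only [inner_add_left, inner_add_right, real_inner_smul_left, real_inner_smul_right]
    rw [real_inner_comm (s (b 0) (b 0)) (s (b 0) (b 1)),
      real_inner_comm (s (b 0) (b 0)) (s (b 1) (b 1)),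
      real_inner_comm (s (b 0) (b 1)) (s (b 1) (b 1))]
    ring
  rw [key, hdet, one_mul]

/-- The defect in Chen's inequality is a sum of squares. -/
theorem chen_defect {k : ℕ} {s : X →ₗ[ℝ] X →ₗ[ℝ] Z} (hs : ∀ x y, s x y = s y x)
    (e : Fin (k + 2) → X) :
    (k : ℝ) / (k + 1) * ‖∑ i, s (e i) (e i)‖ ^ 2
      - (‖∑ i, s (e i) (e i)‖ ^ 2 - ∑ i, ∑ j, ‖s (e i) (e j)‖ ^ 2
        - 2 * gaussTerm s (e 0) (e 1)) =
      ‖s (e 0) (e 0) + s (e 1) (e 1) - (1 / (k + 1 : ℝ)) • ∑ i, s (e i) (e i)‖ ^ 2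
      + ∑ i : Fin k, ‖s (e i.succ.succ) (e i.succ.succ)
          - (1 / (k + 1 : ℝ)) • ∑ i, s (e i) (e i)‖ ^ 2
      + (2 * ∑ i : Fin k, ‖s (e 0) (e i.succ.succ)‖ ^ 2
        + 2 * ∑ i : Fin k, ‖s (e 1) (e i.succ.succ)‖ ^ 2
        + ∑ i : Fin k, ∑ j : Fin k, if i = j then 0 else ‖s (e i.succ.succ) (e j.succ.succ)‖ ^ 2) := by
  have hk : (k + 1 : ℝ) ≠ 0 := by positivity
  set t := ∑ i, s (e i) (e i) with ht
  have hsum : ∑ i : Fin k, s (e i.succ.succ) (e i.succ.succ) =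
      t - s (e 0) (e 0) - s (e 1) (e 1) := by
    rw [ht, Fin.sum_univ_succ, Fin.sum_univ_succ]
    simp
  have hdiag : ∑ i : Fin k, ‖s (e i.succ.succ) (e i.succ.succ) - (1 / (k + 1 : ℝ)) • t‖ ^ 2 =
      ∑ i : Fin k, ‖s (e i.succ.succ) (e i.succ.succ)‖ ^ 2
        - 2 * (1 / (k + 1 : ℝ)) * inner ℝ (t - s (e 0) (e 0) - s (e 1) (e 1)) t
        + k * ((1 / (k + 1 : ℝ)) ^ 2 * ‖t‖ ^ 2) := by
    rw [← hsum, sum_inner]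
    simp only [norm_sub_sq_real, real_inner_smul_right, norm_smul, mul_pow, Finset.sum_add_distrib,
      Finset.sum_sub_distrib, Finset.sum_const, Finset.card_univ, Fintype.card_fin, nsmul_eq_mul,
      Finset.mul_sum, Real.norm_eq_abs, sq_abs, mul_assoc]
  have hoff : ∑ i : Fin k, ∑ j : Fin k, ‖s (e i.succ.succ) (e j.succ.succ)‖ ^ 2 =
      ∑ i : Fin k, ‖s (e i.succ.succ) (e i.succ.succ)‖ ^ 2
      + ∑ i : Fin k, ∑ j : Fin k,
        if i = j then 0 else ‖s (e i.succ.succ) (e j.succ.succ)‖ ^ 2 := by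
    rw [← Finset.sum_add_distrib]
    refine Finset.sum_congr rfl fun i _ => ?_
    have h : ‖s (e i.succ.succ) (e i.succ.succ)‖ ^ 2 =
        ∑ j : Fin k, if i = j then ‖s (e i.succ.succ) (e j.succ.succ)‖ ^ 2 else 0 := by
      rw [Finset.sum_ite_eq]; simp
    rw [h, ← Finset.sum_add_distrib]
    refine Finset.sum_congr rfl fun j _ => ?_
    split_ifs <;> simp
  have hall : ∑ i, ∑ j, ‖s (e i) (e j)‖ ^ 2 = ‖s (e 0) (e 0)‖ ^ 2 + ‖s (e 1) (e 1)‖ ^ 2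
      + 2 * ‖s (e 0) (e 1)‖ ^ 2 + 2 * ∑ i : Fin k, ‖s (e 0) (e i.succ.succ)‖ ^ 2
      + 2 * ∑ i : Fin k, ‖s (e 1) (e i.succ.succ)‖ ^ 2
      + ∑ i : Fin k, ∑ j : Fin k, ‖s (e i.succ.succ) (e j.succ.succ)‖ ^ 2 := by
    simp only [Fin.sum_univ_succ, Finset.sum_add_distrib, Fin.succ_zero_eq_one]
    rw [hs (e 1) (e 0)]
    simp only [hs (e (Fin.succ _)) (e 0), hs (e (Fin.succ (Fin.succ _))) (e 1)]
    ring
  have h2 : ‖s (e 0) (e 0) + s (e 1) (e 1) - (1 / (k + 1 : ℝ)) • t‖ ^ 2 =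
      ‖s (e 0) (e 0)‖ ^ 2 + ‖s (e 1) (e 1)‖ ^ 2 + 2 * inner ℝ (s (e 0) (e 0)) (s (e 1) (e 1))
      - 2 * (1 / (k + 1 : ℝ)) * (inner ℝ (s (e 0) (e 0)) t + inner ℝ (s (e 1) (e 1)) t)
      + (1 / (k + 1 : ℝ)) ^ 2 * ‖t‖ ^ 2 := by
    rw [norm_sub_sq_real, norm_add_sq_real, real_inner_smul_right, inner_add_left, norm_smul,
      mul_pow, Real.norm_eq_abs, sq_abs]
    ring
  rw [hdiag, hall, hoff, h2, gaussTerm, inner_sub_left, inner_sub_left, real_inner_self_eq_norm_sq]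
  field_simp
  ring

/-- Chen's algebraic inequality, with the equality case, in an orthonormal basis adapted to the
plane. -/
theorem chen_adapted {k : ℕ} {s : X →ₗ[ℝ] X →ₗ[ℝ] Z} (hs : ∀ x y, s x y = s y x)
    (e : Fin (k + 2) → X) :
    (1 / 2) * (‖∑ i, s (e i) (e i)‖ ^ 2 - ∑ i, ∑ j, ‖s (e i) (e j)‖ ^ 2)
        - gaussTerm s (e 0) (e 1) ≤ (k : ℝ) / (2 * (k + 1)) * ‖∑ i, s (e i) (e i)‖ ^ 2 ∧
    ((1 / 2) * (‖∑ i, s (e i) (e i)‖ ^ 2 - ∑ i, ∑ j, ‖s (e i) (e j)‖ ^ 2)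
        - gaussTerm s (e 0) (e 1) = (k : ℝ) / (2 * (k + 1)) * ‖∑ i, s (e i) (e i)‖ ^ 2 ↔
      s (e 0) (e 0) + s (e 1) (e 1) = (1 / (k + 1 : ℝ)) • ∑ i, s (e i) (e i) ∧
      (∀ i : Fin k, s (e i.succ.succ) (e i.succ.succ) = (1 / (k + 1 : ℝ)) • ∑ i, s (e i) (e i)) ∧
      (∀ i : Fin k, s (e 0) (e i.succ.succ) = 0) ∧ (∀ i : Fin k, s (e 1) (e i.succ.succ) = 0) ∧
      (∀ i j : Fin k, i ≠ j → s (e i.succ.succ) (e j.succ.succ) = 0)) := by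
  have h := chen_defect hs e
  set t := ∑ i, s (e i) (e i) with ht
  have hc : (k : ℝ) / (2 * (k + 1)) * ‖t‖ ^ 2 = (1 / 2) * ((k : ℝ) / (k + 1) * ‖t‖ ^ 2) := by
    have hk : (k + 1 : ℝ) ≠ 0 := by positivity
    field_simp
  rw [hc]
  set a1 := ‖s (e 0) (e 0) + s (e 1) (e 1) - (1 / (k + 1 : ℝ)) • t‖ ^ 2 with ha1
  set a2 := ∑ i : Fin k, ‖s (e i.succ.succ) (e i.succ.succ) - (1 / (k + 1 : ℝ)) • t‖ ^ 2 with ha2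
  set a3 := ∑ i : Fin k, ‖s (e 0) (e i.succ.succ)‖ ^ 2 with ha3
  set a4 := ∑ i : Fin k, ‖s (e 1) (e i.succ.succ)‖ ^ 2 with ha4
  set a5 := ∑ i : Fin k, ∑ j : Fin k,
    if i = j then 0 else ‖s (e i.succ.succ) (e j.succ.succ)‖ ^ 2 with ha5
  have n1 : 0 ≤ a1 := by positivity
  have n2 : 0 ≤ a2 := by positivity
  have n3 : 0 ≤ a3 := by positivity
  have n4 : 0 ≤ a4 := by positivity
  have n5 : 0 ≤ a5 := by
    refine Finset.sum_nonneg fun i _ => Finset.sum_nonneg fun j _ => ?_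
    split_ifs <;> positivity
  have z1 : a1 = 0 ↔ s (e 0) (e 0) + s (e 1) (e 1) = (1 / (k + 1 : ℝ)) • t := by
    rw [ha1, sq_eq_zero_iff, norm_eq_zero, sub_eq_zero]
  have z2 : a2 = 0 ↔ ∀ i : Fin k, s (e i.succ.succ) (e i.succ.succ) = (1 / (k + 1 : ℝ)) • t := by
    rw [ha2, Finset.sum_eq_zero_iff_of_nonneg (fun i _ => by positivity)]
    simp only [Finset.mem_univ, true_imp_iff, sq_eq_zero_iff, norm_eq_zero, sub_eq_zero]
  have z3 : a3 = 0 ↔ ∀ i : Fin k, s (e 0) (e i.succ.succ) = 0 := by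
    rw [ha3, Finset.sum_eq_zero_iff_of_nonneg (fun i _ => by positivity)]
    simp only [Finset.mem_univ, true_imp_iff, sq_eq_zero_iff, norm_eq_zero]
  have z4 : a4 = 0 ↔ ∀ i : Fin k, s (e 1) (e i.succ.succ) = 0 := by
    rw [ha4, Finset.sum_eq_zero_iff_of_nonneg (fun i _ => by positivity)]
    simp only [Finset.mem_univ, true_imp_iff, sq_eq_zero_iff, norm_eq_zero]
  have z5 : a5 = 0 ↔ ∀ i j : Fin k, i ≠ j → s (e i.succ.succ) (e j.succ.succ) = 0 := by
    have hnn : ∀ i j : Fin k,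
        0 ≤ if i = j then 0 else ‖s (e i.succ.succ) (e j.succ.succ)‖ ^ 2 := by
      intro i j
      split_ifs <;> positivity
    rw [ha5, Finset.sum_eq_zero_iff_of_nonneg (fun i _ => Finset.sum_nonneg fun j _ => hnn i j)]
    simp only [Finset.sum_eq_zero_iff_of_nonneg (fun j _ => hnn _ j), Finset.mem_univ,
      true_imp_iff]
    refine forall_congr' fun i => forall_congr' fun j => ?_
    by_cases hij : i = j <;> simp [hij]
  rw [← z1, ← z2, ← z3, ← z4, ← z5]
  refine ⟨by linarith, fun heq => ?_, fun ⟨h1, h2, h3, h4, h5⟩ => by linarith⟩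
  refine ⟨?_, ?_, ?_, ?_, ?_⟩ <;> linarith

/-- An orthonormal pair can be rotated in its plane so as to diagonalize a symmetric form. -/
theorem exists_rotation (q : X →ₗ[ℝ] X →ₗ[ℝ] ℝ) (hq : ∀ x y, q x y = q y x) {b : Fin 2 → X}
    (hb : Orthonormal ℝ b) : ∃ a : Fin 2 → X, Orthonormal ℝ a ∧ q (a 0) (a 1) = 0 ∧
      Submodule.span ℝ {a 0, a 1} = Submodule.span ℝ {b 0, b 1} := by
  have hb0 : inner ℝ (b 0) (b 0) = (1 : ℝ) := by simp [hb.1]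
  have hb1 : inner ℝ (b 1) (b 1) = (1 : ℝ) := by simp [hb.1]
  have hb01 : inner ℝ (b 0) (b 1) = (0 : ℝ) := hb.2 (by simp)
  have hb10 : inner ℝ (b 1) (b 0) = (0 : ℝ) := hb.2 (by simp)
  set F : ℝ → ℝ := fun θ => Real.cos θ * Real.sin θ * (q (b 1) (b 1) - q (b 0) (b 0))
    + (Real.cos θ ^ 2 - Real.sin θ ^ 2) * q (b 0) (b 1) with hF
  have hcont : Continuous F := by fun_prop
  have hzero : ∃ θ, F θ = 0 := by
    have h0 : F 0 = q (b 0) (b 1) := by simp [hF]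
    have h1 : F (Real.pi / 2) = - q (b 0) (b 1) := by simp [hF]
    have hmem : (0 : ℝ) ∈ Set.uIcc (F 0) (F (Real.pi / 2)) := by
      rw [h0, h1, Set.mem_uIcc]
      rcases le_total 0 (q (b 0) (b 1)) with h | h
      · right; constructor <;> linarith
      · left; constructor <;> linarith
    obtain ⟨θ, _, hθ⟩ := intermediate_value_uIcc hcont.continuousOn hmem
    exact ⟨θ, hθ⟩
  obtain ⟨θ, hθ⟩ := hzero
  have hcs := Real.sin_sq_add_cos_sq θ
  refine ⟨![Real.cos θ • b 0 + Real.sin θ • b 1, (-Real.sin θ) • b 0 + Real.cos θ • b 1],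
    ?_, ?_, ?_⟩
  · rw [orthonormal_iff_ite]
    have h : ∀ p q r t : ℝ, inner ℝ (p • b 0 + q • b 1) (r • b 0 + t • b 1) = p * r + q * t := by
      intro p q r t
      simp only [inner_add_left, inner_add_right, real_inner_smul_left, real_inner_smul_right, hb0,
        hb1, hb01, hb10]
      ring
    intro i j
    fin_cases i <;> fin_cases j
    · exact (h _ _ _ _).trans (by simp; linarith)
    · exact (h _ _ _ _).trans (by simp; ring)
    · exact (h _ _ _ _).trans (by simp; ring)
    · exact (h _ _ _ _).trans (by simp; linarith)
  · simp only [Matrix.cons_val_zero, Matrix.cons_val_one, map_add, map_smul, LinearMap.add_apply,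
      LinearMap.smul_apply, smul_eq_mul, hq (b 1) (b 0)]
    rw [← hθ, hF]
    ring
  · apply le_antisymm
    · rw [Submodule.span_le]
      rintro x (rfl | rfl)
      · exact Submodule.mem_span_pair.2 ⟨_, _, rfl⟩
      · exact Submodule.mem_span_pair.2 ⟨_, _, rfl⟩
    · rw [Submodule.span_le]
      rintro x (rfl | rfl)
      · refine Submodule.mem_span_pair.2 ⟨Real.cos θ, -Real.sin θ, ?_⟩
        simp only [Matrix.cons_val_zero, Matrix.cons_val_one]
        linear_combination (norm := module) hcs • (b 0)
      · refine Submodule.mem_span_pair.2 ⟨Real.sin θ, Real.cos θ, ?_⟩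
        simp only [Matrix.cons_val_zero, Matrix.cons_val_one]
        linear_combination (norm := module) hcs • (b 1)

theorem exists_orthonormalBasis_extending_pair {l : ℕ} (hX : finrank ℝ X = l + 2) {a : Fin 2 → X}
    (ha : Orthonormal ℝ a) :
    ∃ e : OrthonormalBasis (Fin (l + 2)) ℝ X, e 0 = a 0 ∧ e 1 = a 1 := by
  have hv : Orthonormal ℝ (({0, 1} : Set (Fin (l + 2))).domRestrict
      fun i => if i = 0 then a 0 else a 1) := by
    have h := orthonormal_iff_ite.1 ha
    rw [orthonormal_iff_ite]
    rintro ⟨i, hi⟩ ⟨j, hj⟩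
    have hi' : i = 0 ∨ i = 1 := hi
    have hj' : j = 0 ∨ j = 1 := hj
    simp only [Set.domRestrict_apply, Subtype.mk.injEq]
    rcases hi' with rfl | rfl <;> rcases hj' with rfl | rfl <;> simp [h, ha.1]
  obtain ⟨e, he⟩ := Orthonormal.exists_orthonormalBasis_extension_of_card_eq
    (by simpa using hX) hv
  exact ⟨e, by simpa using he 0 (by simp), by simpa using he 1 (by simp)⟩

/-- An orthonormal basis whose first vector has the direction of `t`. -/
theorem exists_orthonormalBasis_along {k : ℕ} [FiniteDimensional ℝ Z] (hZ : finrank ℝ Z = k)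
    (t : Z) : ∃ ν : OrthonormalBasis (Fin k) ℝ Z, ∀ r, r.val ≠ 0 → inner ℝ t (ν r) = 0 := by
  subst hZ
  by_cases ht : t = 0
  · exact ⟨stdOrthonormalBasis ℝ Z, fun r _ => by simp [ht]⟩
  · have hpos : 0 < finrank ℝ Z := finrank_pos_iff_exists_ne_zero.2 ⟨t, ht⟩
    have hv : Orthonormal ℝ (({⟨0, hpos⟩} : Set (Fin (finrank ℝ Z))).domRestrict
        fun _ => (‖t‖⁻¹ : ℝ) • t) := by
      rw [orthonormal_iff_ite]
      rintro ⟨i, hi⟩ ⟨j, hj⟩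
      have : ‖t‖ ≠ 0 := norm_ne_zero_iff.2 ht
      simp [Set.mem_singleton_iff.1 hi, Set.mem_singleton_iff.1 hj, norm_smul, this]
    obtain ⟨ν, hν⟩ := Orthonormal.exists_orthonormalBasis_extension_of_card_eq (by simp) hv
    refine ⟨ν, fun r hr => ?_⟩
    have h0 := hν ⟨0, hpos⟩ (by simp)
    have h1 : inner ℝ (ν ⟨0, hpos⟩) (ν r) = (0 : ℝ) :=
      ν.orthonormal.2 fun h => hr (by rw [← h])
    have : ‖t‖ ≠ 0 := norm_ne_zero_iff.2 ht
    rw [h0, real_inner_smul_left] at h1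
    simpa [this] using h1

/-- The conditions on a symmetric matrix for equality in Chen's inequality. -/
structure IsChenMatrix {l : ℕ} (A : Matrix (Fin (l + 2)) (Fin (l + 2)) ℝ) : Prop where
  plane : A 0 0 + A 1 1 = 1 / (l + 1 : ℝ) * ∑ i, A i i
  diag : ∀ i : Fin l, A i.succ.succ i.succ.succ = 1 / (l + 1 : ℝ) * ∑ i, A i i
  zero : ∀ i : Fin l, A 0 i.succ.succ = 0
  one : ∀ i : Fin l, A 1 i.succ.succ = 0
  off : ∀ i j : Fin l, i ≠ j → A i.succ.succ j.succ.succ = 0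

theorem isChenMatrix_chenForm₁ {l : ℕ} (a b : ℝ) : IsChenMatrix (chenForm₁ (l + 2) a b) := by
  have hl : (l + 1 : ℝ) ≠ 0 := by positivity
  have htr : ∑ i, chenForm₁ (l + 2) a b i i = (l + 1) * (a + b) := by
    simp [chenForm₁, Fin.sum_univ_succ]
    ring
  refine ⟨?_, fun i => ?_, fun i => ?_, fun i => ?_, fun i j hij => ?_⟩
  · rw [htr]; simp [chenForm₁]; field_simp
  · rw [htr]; simp [chenForm₁]; field_simp
  · exact Matrix.diagonal_apply_ne _ (Fin.succ_ne_zero _).symm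
  · exact Matrix.diagonal_apply_ne _ (by simp [Fin.ext_iff])
  · exact Matrix.diagonal_apply_ne _ (by simpa using hij)

theorem isChenMatrix_chenForm₂ {l : ℕ} (c d : ℝ) : IsChenMatrix (chenForm₂ (l + 2) c d) := by
  have htr : ∑ i, chenForm₂ (l + 2) c d i i = 0 := by
    simp [chenForm₂, Fin.sum_univ_succ]
  refine ⟨?_, fun i => ?_, fun i => ?_, fun i => ?_, fun i j hij => ?_⟩
  · rw [htr]; simp [chenForm₂]
  · rw [htr]; simp [chenForm₂]
  all_goals simp [chenForm₂]

/-- Chen's inequality for a symmetric bilinear map with values in an inner product space `Z`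
(in the application, the normal space), with the normal forms of the equality case. -/
theorem chen_inequality [FiniteDimensional ℝ Z] {n k : ℕ} (hn : 3 ≤ n) (hX : finrank ℝ X = n)
    (hZ : finrank ℝ Z = k) {s : X →ₗ[ℝ] X →ₗ[ℝ] Z} (hs : ∀ x y, s x y = s y x)
    {u : Fin n → X} (hu : Orthonormal ℝ u) {b : Fin 2 → X} (hb : Orthonormal ℝ b) :
    (1 / 2) * (‖∑ i, s (u i) (u i)‖ ^ 2 - ∑ i, ∑ j, ‖s (u i) (u j)‖ ^ 2)
        - gaussTerm s (b 0) (b 1) ≤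
      ((n : ℝ) - 2) / (2 * ((n : ℝ) - 1)) * ‖∑ i, s (u i) (u i)‖ ^ 2 ∧
    ((1 / 2) * (‖∑ i, s (u i) (u i)‖ ^ 2 - ∑ i, ∑ j, ‖s (u i) (u j)‖ ^ 2)
        - gaussTerm s (b 0) (b 1) =
      ((n : ℝ) - 2) / (2 * ((n : ℝ) - 1)) * ‖∑ i, s (u i) (u i)‖ ^ 2 ↔
      ∃ (e : Fin n → X) (ν : Fin k → Z), Orthonormal ℝ e ∧ Orthonormal ℝ ν ∧
        Submodule.span ℝ {b 0, b 1} = Submodule.span ℝ {e ⟨0, Nat.zero_lt_of_lt hn⟩, e ⟨1, Nat.lt_of_succ_lt hn⟩} ∧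
        (∀ r, r.val = 0 → ∃ a₁ a₂ : ℝ,
          (Matrix.of fun i j => inner ℝ (s (e i) (e j)) (ν r)) = chenForm₁ n a₁ a₂) ∧
        (∀ r, r.val ≠ 0 → ∃ c₁ d₁ : ℝ,
          (Matrix.of fun i j => inner ℝ (s (e i) (e j)) (ν r)) = chenForm₂ n c₁ d₁)) := by
  obtain ⟨l, rfl⟩ : ∃ l, n = l + 2 := ⟨n - 2, by omega⟩
  obtain ⟨u', hu'⟩ := exists_orthonormalBasis_of_orthonormal (by simpa using hX) hu
  obtain rfl : (fun i => u' i) = u := funext hu'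
  have hcoef : (((l + 2 : ℕ) : ℝ) - 2) / (2 * (((l + 2 : ℕ) : ℝ) - 1)) = l / (2 * (l + 1)) := by
    push_cast
    congr 1 <;> ring
  rw [hcoef]
  -- in any orthonormal basis adapted to the plane, the quantities are the same
  have hadapt : ∀ (e : OrthonormalBasis (Fin (l + 2)) ℝ X),
      Submodule.span ℝ {b 0, b 1} = Submodule.span ℝ {e 0, e 1} →
      ∑ i, s (u' i) (u' i) = ∑ i, s (e i) (e i) ∧
      ∑ i, ∑ j, ‖s (u' i) (u' j)‖ ^ 2 = ∑ i, ∑ j, ‖s (e i) (e j)‖ ^ 2 ∧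
      gaussTerm s (b 0) (b 1) = gaussTerm s (e 0) (e 1) := by
    intro e he
    refine ⟨sum_apply_self_eq s u' e, sum_norm_sq_eq s u' e, ?_⟩
    have h01 : Orthonormal ℝ ![e 0, e 1] := by
      have h := e.inner_eq_ite
      rw [orthonormal_iff_ite]
      intro i j
      fin_cases i <;> fin_cases j <;> simp [h]
    refine gaussTerm_eq_of_mem_span (b := ![e 0, e 1]) hs hb h01 fun i => ?_
    simp only [Matrix.cons_val_zero, Matrix.cons_val_one]
    rw [← he]
    apply Submodule.subset_span
    fin_cases i <;> simp
  constructor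
  · obtain ⟨e, he0, he1⟩ := exists_orthonormalBasis_extending_pair hX hb
    obtain ⟨h1, h2, h3⟩ := hadapt e (by rw [he0, he1])
    rw [h1, h2, h3]
    exact (chen_adapted hs e).1
  constructor
  · intro heq
    set t := ∑ i, s (u' i) (u' i) with ht
    obtain ⟨ν, hν⟩ := exists_orthonormalBasis_along hZ t
    -- rotate in the plane so that the first shape operator becomes diagonal
    obtain ⟨a, ha, hdiag, hspan⟩ : ∃ a : Fin 2 → X, Orthonormal ℝ a ∧
        (∀ r, r.val = 0 → inner ℝ (s (a 0) (a 1)) (ν r) = 0) ∧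
        Submodule.span ℝ {a 0, a 1} = Submodule.span ℝ {b 0, b 1} := by
      rcases Nat.eq_zero_or_pos k with hk | hk
      · subst hk
        exact ⟨b, hb, fun r => r.elim0, rfl⟩
      · obtain ⟨a, ha, h0, hspan⟩ := exists_rotation
          (s.compr₂ ((innerₗ Z) (ν ⟨0, hk⟩))) (fun x y => by simp [hs x y]) hb
        refine ⟨a, ha, fun r hr => ?_, hspan⟩
        obtain rfl : r = ⟨0, hk⟩ := Fin.ext hr
        rw [real_inner_comm]
        simpa using h0
    obtain ⟨e, he0, he1⟩ := exists_orthonormalBasis_extending_pair hX ha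
    obtain ⟨h1, h2, h3⟩ := hadapt e (by rw [he0, he1, hspan])
    rw [h1, h2, h3] at heq
    rw [h1] at hν
    obtain ⟨c1, c2, c3, c4, c5⟩ := (chen_adapted hs e).2.1 heq
    set m := (1 / (l + 1 : ℝ)) • ∑ i, s (e i) (e i) with hm
    have hνm : ∀ r, r.val ≠ 0 → inner ℝ m (ν r) = 0 := by
      intro r hr
      rw [hm, real_inner_smul_left, hν r hr, mul_zero]
    have c3' : ∀ i : Fin l, s (e i.succ.succ) (e 0) = 0 := fun i => by rw [hs, c3]
    have c4' : ∀ i : Fin l, s (e i.succ.succ) (e 1) = 0 := fun i => by rw [hs, c4]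
    refine ⟨e, ν, e.orthonormal, ν.orthonormal, ?_, fun r hr => ?_, fun r hr => ?_⟩
    · rw [← hspan, ← he0, ← he1]
      rfl
    · have h01 := hdiag r hr
      rw [← he0, ← he1] at h01
      have h10 : inner ℝ (s (e 1) (e 0)) (ν r) = 0 := by rw [hs, h01]
      refine ⟨inner ℝ (s (e 0) (e 0)) (ν r), inner ℝ (s (e 1) (e 1)) (ν r), ?_⟩
      ext i j
      refine Fin.cases ?_ (fun i => ?_) i <;> refine Fin.cases ?_ (fun j => ?_) j
      · simp [chenForm₁]
      · refine Fin.cases ?_ (fun j => ?_) j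
        · simpa [chenForm₁] using h01
        · rw [chenForm₁, Matrix.diagonal_apply_ne _ (Fin.succ_ne_zero _).symm]
          simp [c3]
      · refine Fin.cases ?_ (fun i => ?_) i
        · simpa [chenForm₁] using h10
        · rw [chenForm₁, Matrix.diagonal_apply_ne _ (Fin.succ_ne_zero _)]
          simp [c3']
      · refine Fin.cases ?_ (fun i => ?_) i <;> refine Fin.cases ?_ (fun j => ?_) j
        · simp [chenForm₁]
        · rw [chenForm₁, Matrix.diagonal_apply_ne _ (by simp [Fin.ext_iff])]
          simp [c4]
        · rw [chenForm₁, Matrix.diagonal_apply_ne _ (by simp [Fin.ext_iff])]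
          simp [c4']
        · by_cases hij : i = j
          · subst hij
            simp [chenForm₁, c2, ← c1, inner_add_left]
          · simp [chenForm₁, c5 i j hij, hij]
    · have h11 : inner ℝ (s (e 1) (e 1)) (ν r) = - inner ℝ (s (e 0) (e 0)) (ν r) := by
        have := hνm r hr
        rw [← c1, inner_add_left] at this
        linarith
      refine ⟨inner ℝ (s (e 0) (e 0)) (ν r), inner ℝ (s (e 0) (e 1)) (ν r), ?_⟩
      ext i j
      refine Fin.cases ?_ (fun i => ?_) i <;> refine Fin.cases ?_ (fun j => ?_) j
      · simp [chenForm₂]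
      · refine Fin.cases ?_ (fun j => ?_) j
        · simp [chenForm₂]
        · simp [chenForm₂, c3]
      · refine Fin.cases ?_ (fun i => ?_) i
        · simp [chenForm₂, hs (e 1) (e 0)]
        · simp [chenForm₂, c3']
      · refine Fin.cases ?_ (fun i => ?_) i <;> refine Fin.cases ?_ (fun j => ?_) j
        · simpa [chenForm₂] using h11
        · simp [chenForm₂, c4]
        · simp [chenForm₂, c4']
        · by_cases hij : i = j
          · subst hij
            simp [chenForm₂, c2, hνm r hr]
          · simp [chenForm₂, c5 i j hij]
  · rintro ⟨e', ν', he', hν', hspan, hform₁, hform₂⟩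
    obtain ⟨e, he⟩ := exists_orthonormalBasis_of_orthonormal (by simpa using hX) he'
    obtain rfl : (fun i => e i) = e' := funext he
    obtain ⟨ν, hν⟩ := exists_orthonormalBasis_of_orthonormal (by simpa using hZ) hν'
    obtain rfl : (fun i => ν i) = ν' := funext hν
    obtain ⟨h1, h2, h3⟩ := hadapt e hspan
    rw [h1, h2, h3]
    have hchen : ∀ r, IsChenMatrix (Matrix.of fun i j => inner ℝ (s (e i) (e j)) (ν r)) := by
      intro r
      by_cases hr : r.val = 0
      · obtain ⟨a₁, a₂, h⟩ := hform₁ r hr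
        rw [h]
        exact isChenMatrix_chenForm₁ a₁ a₂
      · obtain ⟨c₁, d₁, h⟩ := hform₂ r hr
        rw [h]
        exact isChenMatrix_chenForm₂ c₁ d₁
    have hext : ∀ v w : Z, (∀ r, inner ℝ v (ν r) = inner ℝ w (ν r)) → v = w := by
      intro v w h
      rw [← ν.sum_repr' v, ← ν.sum_repr' w]
      refine Finset.sum_congr rfl fun r _ => ?_
      rw [real_inner_comm, h, real_inner_comm]
    refine (chen_adapted hs e).2.2 ⟨?_, fun i => ?_, fun i => ?_, fun i => ?_, fun i j hij => ?_⟩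
    · refine hext _ _ fun r => ?_
      rw [inner_add_left, real_inner_smul_left, sum_inner]
      exact (hchen r).plane
    · refine hext _ _ fun r => ?_
      rw [real_inner_smul_left, sum_inner]
      exact (hchen r).diag i
    · refine hext _ _ fun r => ?_
      rw [inner_zero_left]
      exact (hchen r).zero i
    · refine hext _ _ fun r => ?_
      rw [inner_zero_left]
      exact (hchen r).one i
    · refine hext _ _ fun r => ?_
      rw [inner_zero_left]
      exact (hchen r).off i j hij

end Chen

/-! ### From manifolds to charts -/

section Charts

variable {d : ℕ} {N : Type*} [TopologicalSpace N] [ChartedSpace (Mod d) N] [IsManifold (𝓡 d) ∞ N]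

theorem symm_mem_source {x₀ : N} {y : Mod d} (hy : y ∈ (extChartAt (𝓡 d) x₀).target) :
    (extChartAt (𝓡 d) x₀).symm y ∈ (chartAt (Mod d) x₀).source := by
  have := (extChartAt (𝓡 d) x₀).map_target hy
  rwa [extChartAt_source] at this

/-- The frames of a chart are the inverse trivializations of the tangent bundle, so that smooth
sections have smooth expressions in charts. -/
theorem frame_eq_symmL {x₀ : N} {y : Mod d} (hy : y ∈ (extChartAt (𝓡 d) x₀).target) :
    frame x₀ y = (trivializationAt (Mod d) (TangentSpace (𝓡 d)) x₀).symmL ℝ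
      ((extChartAt (𝓡 d) x₀).symm y) := by
  have : IsManifold (𝓡 d) 1 N := IsManifold.of_le (n := ∞) (by simp)
  have h := TangentBundle.symmL_trivializationAt (I := 𝓡 d) (symm_mem_source hy)
  refine Eq.trans ?_ h.symm
  have key : ∀ z, z = y →
      (mfderivWithin 𝓘(ℝ, Mod d) (𝓡 d) (extChartAt (𝓡 d) x₀).symm (Set.range (𝓡 d)) z :
        Mod d →L[ℝ] Mod d) = mfderiv 𝓘(ℝ, Mod d) (𝓡 d) (extChartAt (𝓡 d) x₀).symm y := by
    rintro z rfl
    rw [ModelWithCorners.range_eq_univ, mfderivWithin_univ]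
  exact (key _ ((extChartAt (𝓡 d) x₀).right_inv hy)).symm

theorem coframe_eq_continuousLinearMapAt {x₀ : N} {y : Mod d}
    (hy : y ∈ (extChartAt (𝓡 d) x₀).target) :
    coframe x₀ y = (trivializationAt (Mod d) (TangentSpace (𝓡 d)) x₀).continuousLinearMapAt ℝ
      ((extChartAt (𝓡 d) x₀).symm y) := by
  have : IsManifold (𝓡 d) 1 N := IsManifold.of_le (n := ∞) (by simp)
  exact (TangentBundle.continuousLinearMapAt_trivializationAt (I := 𝓡 d) (symm_mem_source hy)).symm

theorem coframe_frame {x₀ : N} {y : Mod d} (hy : y ∈ (extChartAt (𝓡 d) x₀).target) (v : Mod d) :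
    coframe x₀ y (frame x₀ y v) = v := by
  rw [frame_eq_symmL hy, coframe_eq_continuousLinearMapAt hy]
  exact Bundle.Trivialization.continuousLinearMapAt_symmL _ (symm_mem_source hy) v

theorem frame_coframe {x₀ : N} {y : Mod d} (hy : y ∈ (extChartAt (𝓡 d) x₀).target)
    (v : TangentSpace (𝓡 d) ((extChartAt (𝓡 d) x₀).symm y)) :
    frame x₀ y (coframe x₀ y v) = v := by
  rw [frame_eq_symmL hy, coframe_eq_continuousLinearMapAt hy]
  exact Bundle.Trivialization.symmL_continuousLinearMapAt _ (symm_mem_source hy) v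

/-- At the base point of the chart, the frame is the identity: `TangentSpace` is by definition the
model space, identified with the tangent space by this chart. -/
theorem frame_self (p : N) (v : Mod d) : frame p (extChartAt (𝓡 d) p p) v = v := by
  have : IsManifold (𝓡 d) 1 N := IsManifold.of_le (n := ∞) (by simp)
  have h := mfderivWithin_range_extChartAt_symm (I := 𝓡 d) (x := p)
  rw [ModelWithCorners.range_eq_univ, mfderivWithin_univ] at h
  exact congrArg (fun L : Mod d →L[ℝ] Mod d => L v) h

theorem coframe_self (p : N) (v : Mod d) : coframe p (extChartAt (𝓡 d) p p) v = v := by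
  have h := coframe_frame (mem_extChartAt_target (I := 𝓡 d) p) v
  rwa [frame_self] at h

theorem contDiffOn_comp_symm {F : Type*} [NormedAddCommGroup F] [NormedSpace ℝ F] {x₀ : N}
    {G : N → F} (hG : ContMDiffOn (𝓡 d) 𝓘(ℝ, F) ∞ G (chartAt (Mod d) x₀).source) :
    ContDiffOn ℝ ∞ (fun y => G ((extChartAt (𝓡 d) x₀).symm y)) (extChartAt (𝓡 d) x₀).target := by
  rw [← contMDiffOn_iff_contDiffOn]
  exact hG.comp (contMDiffOn_extChartAt_symm x₀) fun y hy => symm_mem_source hy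

theorem contDiffOn_metricIn (g : Metric d N) (x₀ : N) :
    ContDiffOn ℝ ∞ (metricIn g x₀) (extChartAt (𝓡 d) x₀).target := by
  have h := ((Bundle.Trivialization.contMDiffOn_section_iff
    (trivializationAt (Mod d →L[ℝ] Mod d →L[ℝ] ℝ)
      (fun p : N => TangentSpace (𝓡 d) p →L[ℝ] TangentSpace (𝓡 d) p →L[ℝ] Bundle.Trivial N ℝ p) x₀)
    (chartAt (Mod d) x₀).open_source (n := ∞) (IB := 𝓡 d) (s := g.inner) ?_).1
    g.contMDiff.contMDiffOn)
  · refine (contDiffOn_comp_symm h).congr fun y hy => ?_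
    ext u v
    rw [metricIn_apply, frame_eq_symmL hy]
    have hm := symm_mem_source hy
    rw [hom_trivializationAt_apply]
    dsimp only
    rw [inCoordinates_apply_eq₂ hm hm (by simp)]
    have hs : ∀ w, (trivializationAt (Mod d) (TangentSpace (𝓡 d)) x₀).symmL ℝ
        ((extChartAt (𝓡 d) x₀).symm y) w = (trivializationAt (Mod d) (TangentSpace (𝓡 d)) x₀).symm
        ((extChartAt (𝓡 d) x₀).symm y) w :=
      fun w => Bundle.Trivialization.symmL_apply _ hm w
    rw [hs, hs]
    simp
  · intro x hx
    simp [hx]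

theorem contDiffOn_fieldIn {ξ : ∀ p : N, TangentSpace (𝓡 d) p}
    (hξ : ContMDiff (𝓡 d) ((𝓡 d).prod 𝓘(ℝ, Mod d)) ∞
      (fun p => Bundle.TotalSpace.mk' (Mod d) (E := fun p : N => TangentSpace (𝓡 d) p) p (ξ p)))
    (x₀ : N) : ContDiffOn ℝ ∞ (fieldIn ξ x₀) (extChartAt (𝓡 d) x₀).target := by
  have h := ((Bundle.Trivialization.contMDiffOn_section_iff
    (trivializationAt (Mod d) (fun p : N => TangentSpace (𝓡 d) p) x₀)
    (chartAt (Mod d) x₀).open_source (n := ∞) (IB := 𝓡 d) (s := ξ) ?_).1 hξ.contMDiffOn)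
  · refine (contDiffOn_comp_symm h).congr fun y hy => ?_
    rw [fieldIn, coframe_eq_continuousLinearMapAt hy,
      Bundle.Trivialization.continuousLinearMapAt_apply,
      Bundle.Trivialization.coe_linearMapAt_of_mem _ (symm_mem_source hy)]
  · intro x hx
    simpa using hx

theorem contDiffOn_endoIn {φ : ∀ p : N, TangentSpace (𝓡 d) p →L[ℝ] TangentSpace (𝓡 d) p}
    (hφ : ContMDiff (𝓡 d) ((𝓡 d).prod 𝓘(ℝ, Mod d →L[ℝ] Mod d)) ∞
      (fun p => Bundle.TotalSpace.mk' (Mod d →L[ℝ] Mod d)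
      (E := fun p : N => TangentSpace (𝓡 d) p →L[ℝ] TangentSpace (𝓡 d) p) p (φ p)))
    (x₀ : N) : ContDiffOn ℝ ∞ (endoIn φ x₀) (extChartAt (𝓡 d) x₀).target := by
  have h := ((Bundle.Trivialization.contMDiffOn_section_iff
    (trivializationAt (Mod d →L[ℝ] Mod d)
      (fun p : N => TangentSpace (𝓡 d) p →L[ℝ] TangentSpace (𝓡 d) p) x₀)
    (chartAt (Mod d) x₀).open_source (n := ∞) (IB := 𝓡 d) (s := φ) ?_).1 hφ.contMDiffOn)
  · refine (contDiffOn_comp_symm h).congr fun y hy => ?_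
    rw [endoIn, coframe_eq_continuousLinearMapAt hy, frame_eq_symmL hy]
    rfl
  · intro x hx
    simpa using hx

theorem contDiffOn_formIn {η : ∀ p : N, TangentSpace (𝓡 d) p →L[ℝ] ℝ}
    (hη : ContMDiff (𝓡 d) ((𝓡 d).prod 𝓘(ℝ, Mod d →L[ℝ] ℝ)) ∞
      (fun p => Bundle.TotalSpace.mk' (Mod d →L[ℝ] ℝ)
      (E := fun p : N => TangentSpace (𝓡 d) p →L[ℝ] Bundle.Trivial N ℝ p) p (η p)))
    (x₀ : N) : ContDiffOn ℝ ∞ (formIn η x₀) (extChartAt (𝓡 d) x₀).target := by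
  have h := ((Bundle.Trivialization.contMDiffOn_section_iff
    (trivializationAt (Mod d →L[ℝ] ℝ)
      (fun p : N => TangentSpace (𝓡 d) p →L[ℝ] Bundle.Trivial N ℝ p) x₀)
    (chartAt (Mod d) x₀).open_source (n := ∞) (IB := 𝓡 d) (s := η) ?_).1 hη.contMDiffOn)
  · refine (contDiffOn_comp_symm h).congr fun y hy => ?_
    rw [formIn, frame_eq_symmL hy]
    ext v
    rw [hom_trivializationAt_apply]
    simp [ContinuousLinearMap.inCoordinates]
    rfl
  · intro x hx
    simpa using hx

theorem isMetricOn_metricIn (g : Metric d N) (x₀ : N) :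
    IsMetricOn (metricIn g x₀) (extChartAt (𝓡 d) x₀).target where
  isOpen := isOpen_extChartAt_target x₀
  contDiffOn := contDiffOn_metricIn g x₀
  symm y _ u v := g.symm _ _ _
  pos y hy v hv := by
    rw [metricIn_apply]
    refine g.pos _ _ fun h => hv ?_
    rw [← coframe_frame hy v, h, map_zero]

theorem fieldIn_self (ξ : ∀ p : N, TangentSpace (𝓡 d) p) (p : N) :
    fieldIn ξ p (extChartAt (𝓡 d) p p) = ξ p := by
  exact (coframe_self p _).trans <| congrArg (fun q => (ξ q : Mod d)) (extChartAt_to_inv (I := 𝓡 d) p)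

theorem formIn_self (η : ∀ p : N, TangentSpace (𝓡 d) p →L[ℝ] ℝ) (p : N) :
    formIn η p (extChartAt (𝓡 d) p p) = η p := by
  ext u
  change η _ (frame p _ u) = _
  rw [frame_self]
  exact congrArg (fun q => (η q : Mod d →L[ℝ] ℝ) u) (extChartAt_to_inv (I := 𝓡 d) p)

theorem endoIn_self (φ : ∀ p : N, TangentSpace (𝓡 d) p →L[ℝ] TangentSpace (𝓡 d) p) (p : N) :
    endoIn φ p (extChartAt (𝓡 d) p p) = φ p := by
  ext1 u
  change coframe p _ (φ _ (frame p _ u)) = _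
  rw [frame_self]
  exact (coframe_self p _).trans <| congrArg (fun q => (φ q : Mod d →L[ℝ] Mod d) u) (extChartAt_to_inv (I := 𝓡 d) p)

theorem frame_fieldIn {x₀ : N} {y : Mod d} (hy : y ∈ (extChartAt (𝓡 d) x₀).target)
    (ξ : ∀ p : N, TangentSpace (𝓡 d) p) : frame x₀ y (fieldIn ξ x₀ y) =
      ξ ((extChartAt (𝓡 d) x₀).symm y) := frame_coframe hy _

theorem frame_endoIn {x₀ : N} {y : Mod d} (hy : y ∈ (extChartAt (𝓡 d) x₀).target)
    (φ : ∀ p : N, TangentSpace (𝓡 d) p →L[ℝ] TangentSpace (𝓡 d) p) (u : Mod d) :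
    frame x₀ y (endoIn φ x₀ y u) = φ ((extChartAt (𝓡 d) x₀).symm y) (frame x₀ y u) :=
  frame_coframe hy _

theorem frame_injective {x₀ : N} {y : Mod d} (hy : y ∈ (extChartAt (𝓡 d) x₀).target) :
    Function.Injective (frame x₀ y) :=
  Function.LeftInverse.injective (coframe_frame hy)

theorem AlmostContactMetric.isKappaMuOn {g : Metric d N} (S : AlmostContactMetric g) {κ μ : ℝ}
    (hcm : S.IsContactMetric) (hnull : S.XiMemNullity κ μ) (x₀ : N) :
    IsKappaMuOn κ μ (metricIn g x₀) (endoIn S.phi x₀) (fieldIn S.xi x₀) (formIn S.eta x₀)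
      (extChartAt (𝓡 d) x₀).target where
  toIsMetricOn := isMetricOn_metricIn g x₀
  contDiffOn_phi := contDiffOn_endoIn S.contMDiff_phi x₀
  contDiffOn_xi := contDiffOn_fieldIn S.contMDiff_xi x₀
  contDiffOn_eta := contDiffOn_formIn S.contMDiff_eta x₀
  phi_phi y hy u := by
    apply frame_injective hy
    rw [frame_endoIn hy, frame_endoIn hy, S.phi_phi, map_add, map_neg, map_smul, frame_fieldIn hy]
    rfl
  eta_xi y hy := by
    change S.eta _ (frame x₀ y _) = _
    rw [frame_fieldIn hy, S.eta_xi]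
  phi_xi y hy := by
    apply frame_injective hy
    rw [frame_endoIn hy, frame_fieldIn hy, S.phi_xi, map_zero]
  eta_phi y hy u := by
    change S.eta _ (frame x₀ y _) = _
    rw [frame_endoIn hy, S.eta_phi]
  inner_phi_phi y hy u v := by
    rw [metricIn_apply, metricIn_apply, frame_endoIn hy, frame_endoIn hy, S.inner_phi_phi]
    rfl
  inner_xi y hy u := by
    rw [metricIn_apply, frame_fieldIn hy, S.inner_xi]
    rfl
  contact := hcm x₀
  nullity := hnull x₀

end Charts

section Immersion

variable {n D : ℕ} {M N : Type*}
  [TopologicalSpace M] [ChartedSpace (Mod n) M] [IsManifold (𝓡 n) ∞ M]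
  [TopologicalSpace N] [ChartedSpace (Mod D) N] [IsManifold (𝓡 D) ∞ N]
  {gM : Metric n M} {gN : Metric D N} {f : M → N}

theorem mfderiv_eq_fderiv_writtenInExtChartAt (hf : ContMDiff (𝓡 n) (𝓡 D) ∞ f) (p : M) :
    mfderiv (𝓡 n) (𝓡 D) f p =
      fderiv ℝ (writtenInExtChartAt (𝓡 n) (𝓡 D) p f) (extChartAt (𝓡 n) p p) := by
  have h : MDifferentiableAt (𝓡 n) (𝓡 D) f p := hf.mdifferentiableAt (by simp)
  rw [h.mfderiv, ModelWithCorners.range_eq_univ, fderivWithin_univ]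

/-- In the preferred charts around `p` and `f p`, an isometric immersion `f` is an isometric
immersion between open subsets of the model spaces. -/
theorem IsIsometricImmersion.isIsometricOn (hf : IsIsometricImmersion gM gN f) (p : M) :
    IsIsometricOn (metricIn gM p)
      ((extChartAt (𝓡 n) p).target ∩
        (extChartAt (𝓡 n) p).symm ⁻¹' (f ⁻¹' (chartAt (Mod D) (f p)).source))
      (metricIn gN (f p)) (extChartAt (𝓡 D) (f p)).target
      (writtenInExtChartAt (𝓡 n) (𝓡 D) p f) := by
  have hopen : IsOpen ((extChartAt (𝓡 n) p).target ∩
        (extChartAt (𝓡 n) p).symm ⁻¹' (f ⁻¹' (chartAt (Mod D) (f p)).source)) :=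
    (continuousOn_extChartAt_symm p).isOpen_inter_preimage (isOpen_extChartAt_target p)
      ((chartAt (Mod D) (f p)).open_source.preimage hf.1.continuous)
  have hM := isMetricOn_metricIn gM p
  have hsm : ContMDiffOn 𝓘(ℝ, Mod n) 𝓘(ℝ, Mod D) ∞ (writtenInExtChartAt (𝓡 n) (𝓡 D) p f)
      ((extChartAt (𝓡 n) p).target ∩
        (extChartAt (𝓡 n) p).symm ⁻¹' (f ⁻¹' (chartAt (Mod D) (f p)).source)) :=
    (contMDiffOn_extChartAt (n := ∞) (I := 𝓡 D) (x := f p)).comp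
      (hf.1.comp_contMDiffOn ((contMDiffOn_extChartAt_symm p).mono Set.inter_subset_left))
      fun y hy => hy.2
  refine ⟨⟨hopen, hM.contDiffOn.mono Set.inter_subset_left, fun y hy => hM.symm y hy.1,
    fun y hy => hM.pos y hy.1⟩, isMetricOn_metricIn gN (f p), contMDiffOn_iff_contDiffOn.1 hsm,
    fun y hy => ?_, fun y hy u v => ?_⟩
  · refine (extChartAt (𝓡 D) (f p)).map_source ?_
    rw [extChartAt_source]
    exact hy.2
  · set F := writtenInExtChartAt (𝓡 n) (𝓡 D) p f with hF
    have hFy : F y ∈ (extChartAt (𝓡 D) (f p)).target := by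
      refine (extChartAt (𝓡 D) (f p)).map_source ?_
      rw [extChartAt_source]
      exact hy.2
    have hback : ∀ z ∈ (extChartAt (𝓡 n) p).target ∩
        (extChartAt (𝓡 n) p).symm ⁻¹' (f ⁻¹' (chartAt (Mod D) (f p)).source),
        (extChartAt (𝓡 D) (f p)).symm (F z) = f ((extChartAt (𝓡 n) p).symm z) := by
      intro z hz
      refine (extChartAt (𝓡 D) (f p)).left_inv ?_
      rw [extChartAt_source]
      exact hz.2
    have hsymmM : MDifferentiableAt 𝓘(ℝ, Mod n) (𝓡 n) (extChartAt (𝓡 n) p).symm y :=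
      ((contMDiffOn_extChartAt_symm (n := ∞) p).contMDiffAt
        ((isOpen_extChartAt_target p).mem_nhds hy.1)).mdifferentiableAt (by simp)
    have hsymmN : MDifferentiableAt 𝓘(ℝ, Mod D) (𝓡 D) (extChartAt (𝓡 D) (f p)).symm (F y) :=
      ((contMDiffOn_extChartAt_symm (n := ∞) (f p)).contMDiffAt
        ((isOpen_extChartAt_target (f p)).mem_nhds hFy)).mdifferentiableAt (by simp)
    have hFd : MDifferentiableAt 𝓘(ℝ, Mod n) 𝓘(ℝ, Mod D) F y :=
      (hsm.contMDiffAt (hopen.mem_nhds hy)).mdifferentiableAt (by simp)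
    have hfd : MDifferentiableAt (𝓡 n) (𝓡 D) f ((extChartAt (𝓡 n) p).symm y) :=
      hf.1.mdifferentiableAt (by simp)
    have hcomp : (mfderiv 𝓘(ℝ, Mod n) (𝓡 D) ((extChartAt (𝓡 D) (f p)).symm ∘ F) y :
        Mod n →L[ℝ] Mod D) =
        mfderiv 𝓘(ℝ, Mod n) (𝓡 D) (f ∘ (extChartAt (𝓡 n) p).symm) y :=
      Filter.EventuallyEq.mfderiv_eq
        (Filter.eventually_of_mem (hopen.mem_nhds hy) fun z hz => hback z hz)
    rw [mfderiv_comp y hsymmN hFd, mfderiv_comp y hfd hsymmM, mfderiv_eq_fderiv] at hcomp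
    have key : ∀ w : Mod n, (frame (f p) (F y) (fderiv ℝ F y w) : Mod D) =
        mfderiv (𝓡 n) (𝓡 D) f ((extChartAt (𝓡 n) p).symm y) (frame p y w) :=
      fun w => congrArg (fun L : Mod n →L[ℝ] Mod D => L w) hcomp
    refine (hf.2 _ (frame p y u) (frame p y v)).symm.trans ?_
    refine Eq.trans ?_ (congrArg (fun q => (gN.inner q : Mod D →L[ℝ] Mod D →L[ℝ] ℝ)
      (frame (f p) (F y) (fderiv ℝ F y u)) (frame (f p) (F y) (fderiv ℝ F y v)))
        (hback y hy)).symm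
    exact (congrArg₂ (fun a b : Mod D => (gN.inner _ : Mod D →L[ℝ] Mod D →L[ℝ] ℝ) a b)
      (key u) (key v)).symm

end Immersion

/-! ### The second fundamental form at a point -/

section Forms

variable {d : ℕ} {N : Type*} [TopologicalSpace N] [ChartedSpace (Mod d) N] [IsManifold (𝓡 d) ∞ N]

/-- The inner product at `q` as a bilinear form on the model space, which is by definition the
tangent space at `q`. -/
def Metric.form (g : Metric d N) (q : N) : Mod d →L[ℝ] Mod d →L[ℝ] ℝ := g.inner q

theorem Metric.form_symm (g : Metric d N) (q : N) (u v : Mod d) : g.form q u v = g.form q v u :=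
  g.symm q u v

theorem Metric.form_pos (g : Metric d N) (q : N) (v : Mod d) (hv : v ≠ 0) : 0 < g.form q v v :=
  g.pos q v hv

theorem metricIn_self (g : Metric d N) (p : N) :
    metricIn g p (extChartAt (𝓡 d) p p) = g.form p := by
  ext u v
  rw [metricIn_apply, frame_self, frame_self]
  exact congrArg (fun q => g.form q u v) (extChartAt_to_inv (I := 𝓡 d) p)

variable {g : Metric d N}

/-- The endomorphism `φ` of the model space, which is by definition the tangent space at `q`. -/
def AlmostContactMetric.phiAt (S : AlmostContactMetric g) (q : N) : Mod d →L[ℝ] Mod d := S.phi q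

/-- The endomorphism `h` of the model space, which is by definition the tangent space at `q`. -/
noncomputable def AlmostContactMetric.hAt (S : AlmostContactMetric g) (q : N) : Mod d →L[ℝ] Mod d := S.h q

/-- The form `η` on the model space, which is by definition the tangent space at `q`. -/
def AlmostContactMetric.etaAt (S : AlmostContactMetric g) (q : N) : Mod d →L[ℝ] ℝ := S.eta q

/-- The vector `ξ` of the model space, which is by definition the tangent space at `q`. -/
def AlmostContactMetric.xiAt (S : AlmostContactMetric g) (q : N) : Mod d := S.xi q

variable {S : AlmostContactMetric g} {κ μ c : ℝ}

theorem AlmostContactMetric.IsSpaceForm.inner_curvature (hS : S.IsSpaceForm κ μ c) (q : N)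
    (u v : Mod d) :
    g.form q (riemann g q u v v) u =
      (c + 3) / 4 * (g.form q u u * g.form q v v - g.form q u v ^ 2)
      - (c + 3 - 4 * κ) / 4 * (S.etaAt q u ^ 2 * g.form q v v + S.etaAt q v ^ 2 * g.form q u u
          - 2 * S.etaAt q u * S.etaAt q v * g.form q u v)
      + 3 * (c - 1) / 4 * g.form q u (S.phiAt q v) ^ 2
      + 1 / 2 * (g.form q (S.hAt q u) u * g.form q (S.hAt q v) v - g.form q (S.hAt q u) v ^ 2
        - (g.form q (S.phiAt q (S.hAt q u)) u * g.form q (S.phiAt q (S.hAt q v)) v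
          - g.form q (S.phiAt q (S.hAt q u)) v ^ 2))
      + (g.form q u u * g.form q (S.hAt q v) v + g.form q v v * g.form q (S.hAt q u) u
        - 2 * g.form q u v * g.form q (S.hAt q u) v)
      + (μ - 1) * (S.etaAt q u ^ 2 * g.form q (S.hAt q v) v
        + S.etaAt q v ^ 2 * g.form q (S.hAt q u) u
        - 2 * S.etaAt q u * S.etaAt q v * g.form q (S.hAt q u) v) := by
  have hq := mem_extChartAt_target (I := 𝓡 d) q
  have h := (S.isKappaMuOn hS.1 hS.2.1 q).inner_curvature hq (hS.2.2 q _ hq) u v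
  rw [metricIn_self, formIn_self, endoIn_self] at h
  exact h

theorem AlmostContactMetric.IsSpaceForm.inner_hAt (hS : S.IsSpaceForm κ μ c) (q : N)
    (u v : Mod d) : g.form q (S.hAt q u) v = g.form q (S.hAt q v) u := by
  have hq := mem_extChartAt_target (I := 𝓡 d) q
  have h := (S.isKappaMuOn hS.1 hS.2.1 q).hTensor_symm hq u v
  rw [metricIn_self] at h
  rw [g.form_symm q (S.hAt q v)]
  exact h

theorem AlmostContactMetric.IsSpaceForm.inner_phiAt_hAt (hS : S.IsSpaceForm κ μ c) (q : N)
    (u v : Mod d) :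
    g.form q (S.phiAt q (S.hAt q u)) v = g.form q (S.phiAt q (S.hAt q v)) u := by
  have hq := mem_extChartAt_target (I := 𝓡 d) q
  have h := (S.isKappaMuOn hS.1 hS.2.1 q).phiH_symm hq u v
  rw [phiH, metricIn_self, endoIn_self] at h
  rw [g.form_symm q (S.phiAt q (S.hAt q v))]
  exact h

theorem AlmostContactMetric.IsSpaceForm.hAt_xiAt (hS : S.IsSpaceForm κ μ c) (q : N) :
    S.hAt q (S.xiAt q) = 0 := by
  have hq := mem_extChartAt_target (I := 𝓡 d) q
  have h := (S.isKappaMuOn hS.1 hS.2.1 q).hTensor_xi hq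
  rw [fieldIn_self] at h
  exact h

theorem AlmostContactMetric.IsSpaceForm.form_phiAt (hS : S.IsSpaceForm κ μ c) (q : N)
    (u v : Mod d) : g.form q (S.phiAt q u) v = - g.form q u (S.phiAt q v) := by
  have hq := mem_extChartAt_target (I := 𝓡 d) q
  have h := (S.isKappaMuOn hS.1 hS.2.1 q).phi_skew hq u v
  rw [metricIn_self, endoIn_self] at h
  exact h

end Forms

section Immersion

variable {n D : ℕ} {M N : Type*}
  [TopologicalSpace M] [ChartedSpace (Mod n) M] [IsManifold (𝓡 n) ∞ M]
  [TopologicalSpace N] [ChartedSpace (Mod D) N] [IsManifold (𝓡 D) ∞ N]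

/-- The differential of `f` at `p` as a map between model spaces. -/
noncomputable def differential (f : M → N) (p : M) : Mod n →L[ℝ] Mod D := mfderiv (𝓡 n) (𝓡 D) f p

/-- The second fundamental form at `p` as a bilinear map between model spaces. -/
noncomputable def sff (gM : Metric n M) (gN : Metric D N) (f : M → N) (p : M) :
    Mod n →L[ℝ] Mod n →L[ℝ] Mod D := secondFF gM gN f p

variable {gM : Metric n M} {gN : Metric D N} {f : M → N}

theorem IsIsometricImmersion.form_differential (hf : IsIsometricImmersion gM gN f) (p : M)
    (u v : Mod n) : gN.form (f p) (differential f p u) (differential f p v) = gM.form p u v :=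
  hf.2 p u v

theorem form_tangentialPart (p : M) (w : Mod D) (u : Mod n) :
    gM.form p (tangentialPart (gM.form p) (gN.form (f p)) (differential f p) w) u =
      gN.form (f p) w (differential f p u) := by
  rw [tangentialPart_apply, apply_inverse_of_pos (gM.form_pos p)]
  rfl

theorem inner_tangentialEndo (p : M)
    (Q : TangentSpace (𝓡 D) (f p) →L[ℝ] TangentSpace (𝓡 D) (f p)) (u v : TangentSpace (𝓡 n) p) :
    gM.inner p (tangentialEndo gM gN f p Q u) v =
      gN.inner (f p) (Q (mfderiv (𝓡 n) (𝓡 D) f p u)) (mfderiv (𝓡 n) (𝓡 D) f p v) :=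
  form_tangentialPart p _ v

theorem inner_shapeOperator (p : M) (ν : Mod D) (u v : Mod n) :
    gM.form p (shapeOperator gM gN f p ν u) v = gN.form (f p) ν (sff gM gN f p u v) :=
  apply_inverse_of_pos (gM.form_pos p) _ v

theorem sff_apply (p : M) (u v : Mod n) :
    sff gM gN f p u v = mapDeriv (metricIn gN (f p)) (writtenInExtChartAt (𝓡 n) (𝓡 D) p f)
      (extChartAt (𝓡 n) p p) u v - differential f p
        (tangentialPart (gM.form p) (gN.form (f p)) (differential f p)
        (mapDeriv (metricIn gN (f p)) (writtenInExtChartAt (𝓡 n) (𝓡 D) p f)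
          (extChartAt (𝓡 n) p p) u v)) := by
  have h : writtenInExtChartAt (𝓡 n) (𝓡 D) p f (extChartAt (𝓡 n) p p) =
      extChartAt (𝓡 D) (f p) (f p) := by simp [writtenInExtChartAt]
  have h2 : mapDeriv (metricIn gN (f p)) (writtenInExtChartAt (𝓡 n) (𝓡 D) p f)
      (extChartAt (𝓡 n) p p) = ambientDeriv (n := n) gN f p := by
    unfold mapDeriv
    rw [h]
    rfl
  rw [h2]
  exact normalPart_apply (E := Mod n) (V := Mod D) (gM.form p) (gN.form (f p))
    (differential f p) (ambientDeriv (n := n) gN f p) u v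

/-- The second fundamental form takes normal values. -/
theorem form_sff_differential (hf : IsIsometricImmersion gM gN f) (p : M) (u v w : Mod n) :
    gN.form (f p) (sff gM gN f p u v) (differential f p w) = 0 := by
  rw [sff_apply, map_sub, sub_apply, hf.form_differential, form_tangentialPart, sub_self]

theorem writtenInExtChartAt_self (f : M → N) (p : M) :
    writtenInExtChartAt (𝓡 n) (𝓡 D) p f (extChartAt (𝓡 n) p p) =
      extChartAt (𝓡 D) (f p) (f p) := by
  simp [writtenInExtChartAt]

theorem mem_chart_domain (f : M → N) (p : M) :
    extChartAt (𝓡 n) p p ∈ (extChartAt (𝓡 n) p).target ∩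
        (extChartAt (𝓡 n) p).symm ⁻¹' (f ⁻¹' (chartAt (Mod D) (f p)).source) := by
  refine ⟨mem_extChartAt_target p, ?_⟩
  simp

theorem differential_eq (hf : IsIsometricImmersion gM gN f) (p : M) : differential f p =
    fderiv ℝ (writtenInExtChartAt (𝓡 n) (𝓡 D) p f) (extChartAt (𝓡 n) p p) :=
  mfderiv_eq_fderiv_writtenInExtChartAt hf.1 p

/-- The Gauss formula. -/
theorem sff_eq (hf : IsIsometricImmersion gM gN f) (p : M) (u v : Mod n) :
    sff gM gN f p u v =
      mapDeriv (metricIn gN (f p)) (writtenInExtChartAt (𝓡 n) (𝓡 D) p f)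
        (extChartAt (𝓡 n) p p) u v -
      differential f p (christoffel (metricIn gM p) (extChartAt (𝓡 n) p p) u v) := by
  rw [sff_apply]
  congr 2
  refine eq_of_forall_apply_eq (gM.form_pos p) fun z => ?_
  have h := (hf.isIsometricOn p).inner_mapDeriv (mem_chart_domain f p) u v z
  rw [metricIn_self gM p, writtenInExtChartAt_self, metricIn_self gN (f p),
    ← differential_eq hf] at h
  rw [form_tangentialPart, h]

theorem sff_symm (hf : IsIsometricImmersion gM gN f) (p : M) (u v : Mod n) :
    sff gM gN f p u v = sff gM gN f p v u := by
  have hI := hf.isIsometricOn p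
  have hp := mem_chart_domain (n := n) (D := D) f p
  rw [sff_eq hf, sff_eq hf, hI.mapDeriv_symm hp, hI.source.christoffel_symm hp]

/-- The Gauss equation. -/
theorem form_riemann (hf : IsIsometricImmersion gM gN f) (p : M) (u v : Mod n) :
    gM.form p (riemann gM p u v v) u =
      gN.form (f p) (riemann gN (f p) (differential f p u) (differential f p v)
        (differential f p v)) (differential f p u)
      + gN.form (f p) (sff gM gN f p u u) (sff gM gN f p v v)
      - gN.form (f p) (sff gM gN f p u v) (sff gM gN f p u v) := by
  have h := (hf.isIsometricOn p).gauss (mem_chart_domain f p) u v v u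
  rw [metricIn_self gM p, writtenInExtChartAt_self, metricIn_self gN (f p),
    ← differential_eq hf, ← sff_eq hf p, ← sff_eq hf p, ← sff_eq hf p, ← sff_eq hf p,
    sff_symm hf p v u] at h
  rw [gN.form_symm _ (sff gM gN f p u u)]
  exact h

end Immersion

/-! ### Summing the curvature over an orthonormal basis -/

section Sums

open Module

theorem exists_linearEquiv_inner {V : Type*} [AddCommGroup V] [Module ℝ V] [FiniteDimensional ℝ V]
    {d : ℕ} (hd : finrank ℝ V = d) (B : V →ₗ[ℝ] V →ₗ[ℝ] ℝ) (hsymm : ∀ u v, B u v = B v u)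
    (hpos : ∀ v, v ≠ 0 → 0 < B v v) :
    ∃ L : V ≃ₗ[ℝ] EuclideanSpace ℝ (Fin d), ∀ u v, inner ℝ (L u) (L v) = B u v := by
  let core : InnerProductSpace.Core ℝ V :=
    { inner := fun u v => B u v
      conj_inner_symm := fun u v => hsymm v u
      re_inner_nonneg := fun v => by
        by_cases hv : v = 0
        · simp [hv]
        · exact (hpos v hv).le
      add_left := fun u v w => by simp
      smul_left := fun u v r => by simp
      definite := fun v hv => by
        by_contra h
        exact (hpos v h).ne' hv }
  let _ : NormedAddCommGroup V := core.toNormedAddCommGroup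
  let _ : InnerProductSpace ℝ V := InnerProductSpace.ofCore core.toCore
  subst hd
  exact ⟨(stdOrthonormalBasis ℝ V).repr.toLinearEquiv, fun u v =>
    (stdOrthonormalBasis ℝ V).repr.inner_map_map u v⟩

theorem exists_linearEquiv_inner_form {d : ℕ} {G : Mod d →L[ℝ] Mod d →L[ℝ] ℝ}
    (hsymm : ∀ u v, G u v = G v u) (hpos : ∀ v, v ≠ 0 → 0 < G v v) :
    ∃ L : Mod d ≃ₗ[ℝ] Mod d, ∀ u v, inner ℝ (L u) (L v) = G u v :=
  exists_linearEquiv_inner (by simp) (G.toBilinForm) hsymm hpos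

/-- The expansion of a vector in an orthonormal basis. -/
theorem sum_form_smul {d : ℕ} {G : Mod d →L[ℝ] Mod d →L[ℝ] ℝ}
    (hsymm : ∀ u v, G u v = G v u) (hpos : ∀ v, v ≠ 0 → 0 < G v v) {u : Fin d → Mod d}
    (hu : ∀ i j, G (u i) (u j) = if i = j then 1 else 0) (w : Mod d) :
    ∑ i, G (u i) w • u i = w := by
  obtain ⟨L, hL⟩ := exists_linearEquiv_inner_form hsymm hpos
  have hon : Orthonormal ℝ fun i => L (u i) := by
    rw [orthonormal_iff_ite]
    intro i j
    rw [hL, hu]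
  obtain ⟨e, he⟩ := exists_orthonormalBasis_of_orthonormal (by simp) hon
  apply L.injective
  rw [map_sum]
  conv_rhs => rw [← e.sum_repr' (L w)]
  refine Finset.sum_congr rfl fun i _ => ?_
  rw [map_smul, he, hL]

theorem sum_lt_eq {n : ℕ} (K : Fin n → Fin n → ℝ) (hK : ∀ i j, K i j = K j i) :
    ∑ i, ∑ j, (if i < j then K i j else 0) = (1 / 2) * (∑ i, ∑ j, K i j - ∑ i, K i i) := by
  have h1 : ∑ i, ∑ j, (if i < j then K i j else 0) = ∑ i, ∑ j, (if j < i then K i j else 0) := by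
    rw [Finset.sum_comm]
    simp_rw [hK]
  have h2 : ∑ i, K i i = ∑ i, ∑ j, (if i = j then K i j else 0) := by simp
  have h3 : ∑ i, ∑ j, K i j = ∑ i, ∑ j, (if i < j then K i j else 0)
      + ∑ i, ∑ j, (if j < i then K i j else 0) + ∑ i, ∑ j, (if i = j then K i j else 0) := by
    simp_rw [← Finset.sum_add_distrib]
    refine Finset.sum_congr rfl fun i _ => Finset.sum_congr rfl fun j _ => ?_
    rcases lt_trichotomy i j with h | h | h
    · simp [h, h.not_gt, h.ne]
    · simp [h]
    · simp [h, h.not_gt, h.ne']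
  linarith

/-- The sum over all pairs of an orthonormal basis of the curvature of a contact space form, where
`η i = η(e_i)`, `H i j = ⟨h e_i, e_j⟩`, `Ψ i j = ⟨φ h e_i, e_j⟩` and `P i j = ⟨e_i, φ e_j⟩`. The
hypotheses say that the span of the basis contains `ξ`, and that `h ξ = 0`. -/
theorem sum_curvature_terms {n : ℕ} (κ μ c : ℝ) (η : Fin n → ℝ) (H Ψ P : Fin n → Fin n → ℝ)
    (hη : ∑ i, η i ^ 2 = 1) (hH : ∀ j, ∑ i, η i * H i j = 0) :
    ∑ i, ∑ j, ((c + 3) / 4 * (1 - if i = j then 1 else 0)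
      - (c + 3 - 4 * κ) / 4 * (η i ^ 2 + η j ^ 2 - 2 * η i * η j * if i = j then 1 else 0)
      + 3 * (c - 1) / 4 * P i j ^ 2
      + 1 / 2 * (H i i * H j j - H i j ^ 2 - (Ψ i i * Ψ j j - Ψ i j ^ 2))
      + (H j j + H i i - 2 * (if i = j then 1 else 0) * H i j)
      + (μ - 1) * (η i ^ 2 * H j j + η j ^ 2 * H i i - 2 * η i * η j * H i j)) =
    (c + 3) / 4 * (n * (n - 1)) - (c + 3 - 4 * κ) / 4 * (2 * (n - 1))
      + 3 * (c - 1) / 4 * ∑ i, ∑ j, P i j ^ 2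
      + 1 / 2 * ((∑ i, H i i) ^ 2 - ∑ i, ∑ j, H i j ^ 2 - (∑ i, Ψ i i) ^ 2 + ∑ i, ∑ j, Ψ i j ^ 2)
      + 2 * (n + μ - 2) * ∑ i, H i i := by
  have hδ : ∑ i : Fin n, ∑ j : Fin n, (if i = j then (1 : ℝ) else 0) = n := by simp
  have hηδ : ∑ i : Fin n, ∑ j : Fin n, (2 * η i * η j * if i = j then 1 else 0) = 2 := by
    simp only [mul_ite, mul_one, mul_zero, Finset.sum_ite_eq, Finset.mem_univ, if_true]
    calc ∑ i, 2 * η i * η i = 2 * ∑ i, η i ^ 2 := by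
          rw [Finset.mul_sum]
          exact Finset.sum_congr rfl fun i _ => by ring
      _ = 2 := by rw [hη, mul_one]
  have hHδ : ∑ i : Fin n, ∑ j : Fin n, (2 * (if i = j then 1 else 0) * H i j) = 2 * ∑ i, H i i := by
    simp [Finset.mul_sum]
  have hηH : ∑ i, ∑ j, 2 * η i * η j * H i j = 0 := by
    rw [Finset.sum_comm]
    refine Finset.sum_eq_zero fun j _ => ?_
    have : ∑ i, 2 * η i * η j * H i j = 2 * η j * ∑ i, η i * H i j := by
      rw [Finset.mul_sum]
      exact Finset.sum_congr rfl fun i _ => by ring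
    rw [this, hH, mul_zero]
  simp only [Finset.sum_add_distrib, Finset.sum_sub_distrib, ← Finset.mul_sum,
    ← Finset.sum_mul, hη,
    hδ, hηδ, hηH, hHδ, Finset.sum_const, Finset.card_univ, Fintype.card_fin, nsmul_eq_mul]
  ring

end Sums

section Bound

variable {n D : ℕ} {M N : Type*}
  [TopologicalSpace M] [ChartedSpace (Mod n) M] [IsManifold (𝓡 n) ∞ M]
  [TopologicalSpace N] [ChartedSpace (Mod D) N] [IsManifold (𝓡 D) ∞ N]
  {gM : Metric n M} {gN : Metric D N} {f : M → N}

theorem inner_tangentialEndo_right (p : M)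
    (Q : TangentSpace (𝓡 D) (f p) →L[ℝ] TangentSpace (𝓡 D) (f p)) (u v : TangentSpace (𝓡 n) p) :
    gM.inner p u (tangentialEndo gM gN f p Q v) =
      gN.inner (f p) (Q (mfderiv (𝓡 n) (𝓡 D) f p v)) (mfderiv (𝓡 n) (𝓡 D) f p u) := by
  rw [gM.symm, inner_tangentialEndo]

/-- The bound in terms of the ambient inner product. -/
theorem chenBound_eq (S : AlmostContactMetric gN) (κ μ c : ℝ) (p : M) (u : Fin n → TangentSpace (𝓡 n) p)
    (b : Fin 2 → TangentSpace (𝓡 n) p) :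
    chenBound gM f p S κ μ c u b =
      (n : ℝ) ^ 2 * ((n : ℝ) - 2) / (2 * ((n : ℝ) - 1))
      * gN.form (f p) ((1 / (n : ℝ)) • ∑ i, sff gM gN f p (u i) (u i))
          ((1 / (n : ℝ)) • ∑ i, sff gM gN f p (u i) (u i))
    + (1 / 8) * n * ((n : ℝ) - 3) * (c + 3) + ((n : ℝ) - 1) * κ
    + 3 * (c - 1) / 8 * (∑ i, ∑ j, gN.form (f p) (S.phiAt (f p) (differential f p (u j)))
        (differential f p (u i)) ^ 2
      - 2 * gN.form (f p) (S.phiAt (f p) (differential f p (b 1))) (differential f p (b 0)) ^ 2)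
    + (1 / 4) * (c + 3 - 4 * κ) * (S.etaAt (f p) (differential f p (b 0)) ^ 2
        + S.etaAt (f p) (differential f p (b 1)) ^ 2)
    - (μ - 1) * (S.etaAt (f p) (differential f p (b 0)) ^ 2
          * gN.form (f p) (S.hAt (f p) (differential f p (b 1))) (differential f p (b 1))
        + S.etaAt (f p) (differential f p (b 1)) ^ 2
          * gN.form (f p) (S.hAt (f p) (differential f p (b 0))) (differential f p (b 0))
        - 2 * S.etaAt (f p) (differential f p (b 0)) * S.etaAt (f p) (differential f p (b 1))
          * gN.form (f p) (S.hAt (f p) (differential f p (b 0))) (differential f p (b 1)))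
    - (1 / 2) * (2 * (gN.form (f p) (S.hAt (f p) (differential f p (b 0))) (differential f p (b 0))
          + gN.form (f p) (S.hAt (f p) (differential f p (b 1))) (differential f p (b 1)))
        + (gN.form (f p) (S.hAt (f p) (differential f p (b 0))) (differential f p (b 0))
          * gN.form (f p) (S.hAt (f p) (differential f p (b 1))) (differential f p (b 1))
          - gN.form (f p) (S.hAt (f p) (differential f p (b 1))) (differential f p (b 0))
          * gN.form (f p) (S.hAt (f p) (differential f p (b 0))) (differential f p (b 1)))
        - (gN.form (f p) (S.phiAt (f p) (S.hAt (f p) (differential f p (b 0))))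
            (differential f p (b 0))
          * gN.form (f p) (S.phiAt (f p) (S.hAt (f p) (differential f p (b 1))))
            (differential f p (b 1))
          - gN.form (f p) (S.phiAt (f p) (S.hAt (f p) (differential f p (b 1))))
            (differential f p (b 0))
          * gN.form (f p) (S.phiAt (f p) (S.hAt (f p) (differential f p (b 0))))
            (differential f p (b 1))))
    + (μ + n - 2) * ∑ i, gN.form (f p) (S.hAt (f p) (differential f p (u i)))
        (differential f p (u i))
    + (1 / 4) * (∑ i, ∑ j, gN.form (f p) (S.phiAt (f p) (S.hAt (f p) (differential f p (u j))))
          (differential f p (u i)) ^ 2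
        - ∑ i, ∑ j, gN.form (f p) (S.hAt (f p) (differential f p (u j)))
          (differential f p (u i)) ^ 2
        - (∑ i, gN.form (f p) (S.phiAt (f p) (S.hAt (f p) (differential f p (u i))))
          (differential f p (u i))) ^ 2
        + (∑ i, gN.form (f p) (S.hAt (f p) (differential f p (u i)))
        (differential f p (u i))) ^ 2) := by
  unfold chenBound normSq traceOf alpha gamma beta opP opH opPhiH
  simp only [planeMatrix, Matrix.trace_fin_two, Matrix.det_fin_two, Matrix.of_apply,
    inner_tangentialEndo_right, inner_tangentialEndo]
  rfl

end Bound

/-! ### Chen's inequality for a second fundamental form -/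

section ChenForm

open Module

/-- `chen_inequality` for inner products given by bilinear forms `G` and `G'`, an isometric linear
map `T` and a symmetric bilinear map `σ` with values orthogonal to the range of `T`. -/
theorem chen_inequality_form {n D : ℕ} (hn : 3 ≤ n) {G : Mod n →L[ℝ] Mod n →L[ℝ] ℝ}
    {G' : Mod D →L[ℝ] Mod D →L[ℝ] ℝ} (hsymm : ∀ u v, G u v = G v u)
    (hpos : ∀ v, v ≠ 0 → 0 < G v v) (hsymm' : ∀ u v, G' u v = G' v u)
    (hpos' : ∀ v, v ≠ 0 → 0 < G' v v) {T : Mod n →L[ℝ] Mod D}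
    (hT : ∀ u v, G' (T u) (T v) = G u v) {σ : Mod n →L[ℝ] Mod n →L[ℝ] Mod D}
    (hσ : ∀ u v, σ u v = σ v u) (hσT : ∀ u v w, G' (σ u v) (T w) = 0)
    {u : Fin n → Mod n} (hu : ∀ i j, G (u i) (u j) = if i = j then 1 else 0)
    {b : Fin 2 → Mod n} (hb : ∀ i j, G (b i) (b j) = if i = j then 1 else 0) :
    (1 / 2) * (G' (∑ i, σ (u i) (u i)) (∑ i, σ (u i) (u i))
        - ∑ i, ∑ j, G' (σ (u i) (u j)) (σ (u i) (u j)))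
      - (G' (σ (b 0) (b 0)) (σ (b 1) (b 1)) - G' (σ (b 0) (b 1)) (σ (b 0) (b 1))) ≤
      ((n : ℝ) - 2) / (2 * ((n : ℝ) - 1)) * G' (∑ i, σ (u i) (u i)) (∑ i, σ (u i) (u i)) ∧
    ((1 / 2) * (G' (∑ i, σ (u i) (u i)) (∑ i, σ (u i) (u i))
        - ∑ i, ∑ j, G' (σ (u i) (u j)) (σ (u i) (u j)))
      - (G' (σ (b 0) (b 0)) (σ (b 1) (b 1)) - G' (σ (b 0) (b 1)) (σ (b 0) (b 1))) =
      ((n : ℝ) - 2) / (2 * ((n : ℝ) - 1)) * G' (∑ i, σ (u i) (u i)) (∑ i, σ (u i) (u i)) ↔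
      ∃ (e : Fin n → Mod n) (ν : Fin (D - n) → Mod D),
        (∀ i j, G (e i) (e j) = if i = j then 1 else 0) ∧
        (∀ i j, G' (ν i) (ν j) = if i = j then 1 else 0) ∧
        (∀ r v, G' (ν r) (T v) = 0) ∧
        Submodule.span ℝ (Set.range b) =
          Submodule.span ℝ {e ⟨0, Nat.zero_lt_of_lt hn⟩, e ⟨1, Nat.lt_of_succ_lt hn⟩} ∧
        (∀ r, r.val = 0 → ∃ a₁ a₂ : ℝ,
          (Matrix.of fun i j => G' (ν r) (σ (e j) (e i))) = chenForm₁ n a₁ a₂) ∧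
        (∀ r, r.val ≠ 0 → ∃ c₁ d₁ : ℝ,
          (Matrix.of fun i j => G' (ν r) (σ (e j) (e i))) = chenForm₂ n c₁ d₁)) := by
  obtain ⟨L, hL⟩ := exists_linearEquiv_inner_form hsymm hpos
  obtain ⟨L', hL'⟩ := exists_linearEquiv_inner_form hsymm' hpos'
  have hTinj : Function.Injective T := by
    rw [injective_iff_map_eq_zero]
    intro v hv
    by_contra hne
    have := hpos v hne
    rw [← hT, hv] at this
    simp at this
  set R : Submodule ℝ (Mod D) := LinearMap.range (L'.toLinearMap ∘ₗ T.toLinearMap) with hR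
  have hRdim : finrank ℝ R = n := by
    have hinj : Function.Injective (L'.toLinearMap ∘ₗ T.toLinearMap) :=
      L'.injective.comp hTinj
    rw [hR, LinearMap.finrank_range_of_inj hinj]
    simp
  have hZdim : finrank ℝ Rᗮ = D - n := by
    have := R.finrank_add_finrank_orthogonal
    rw [hRdim, finrank_euclideanSpace_fin] at this
    omega
  have hmem : ∀ w, L' w ∈ Rᗮ ↔ ∀ v, G' w (T v) = 0 := by
    intro w
    rw [Submodule.mem_orthogonal']
    constructor
    · intro h v
      rw [← hL']
      exact h _ ⟨v, rfl⟩
    · rintro h _ ⟨v, rfl⟩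
      exact (hL' _ _).trans (h v)
  let s : Mod n →ₗ[ℝ] Mod n →ₗ[ℝ] Rᗮ := LinearMap.mk₂ ℝ
    (fun x y => ⟨L' (σ (L.symm x) (L.symm y)), (hmem _).2 (hσT _ _)⟩)
    (fun x y z => Subtype.ext (by simp)) (fun r x y => Subtype.ext (by simp))
    (fun x y z => Subtype.ext (by simp)) (fun r x y => Subtype.ext (by simp))
  have hs_coe : ∀ x y, (s (L x) (L y) : Mod D) = L' (σ x y) := fun x y => by simp [s]
  have hs : ∀ x y, s x y = s y x := fun x y => Subtype.ext (by
    change L' (σ (L.symm x) (L.symm y)) = L' (σ (L.symm y) (L.symm x))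
    rw [hσ])
  have hinner : ∀ x y z w, inner ℝ (s (L x) (L y)) (s (L z) (L w)) = G' (σ x y) (σ z w) := by
    intro x y z w
    rw [Submodule.coe_inner, hs_coe, hs_coe, hL']
  have hnorm : ∀ x y, ‖s (L x) (L y)‖ ^ 2 = G' (σ x y) (σ x y) := fun x y => by
    rw [← real_inner_self_eq_norm_sq, hinner]
  have hnorm' : ‖∑ i, s (L (u i)) (L (u i))‖ ^ 2 =
      G' (∑ i, σ (u i) (u i)) (∑ i, σ (u i) (u i)) := by
    rw [← real_inner_self_eq_norm_sq, sum_inner]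
    simp only [inner_sum, hinner, map_sum, sum_apply]
    rw [Finset.sum_comm]
  have hon : ∀ {k : ℕ} (e : Fin k → Mod n), Orthonormal ℝ (fun i => L (e i)) ↔
      ∀ i j, G (e i) (e j) = if i = j then 1 else 0 := fun e => by
    simp only [orthonormal_iff_ite, hL]
  have hchen := chen_inequality hn (by simp) hZdim hs ((hon u).2 hu) ((hon b).2 hb)
  have hrange : Set.range b = {b 0, b 1} := by
    ext x
    simp [Fin.exists_fin_two, eq_comm]
  have hspan : ∀ e₀ e₁ : Mod n, Submodule.span ℝ {L (b 0), L (b 1)} =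
      Submodule.span ℝ {L e₀, L e₁} ↔
      Submodule.span ℝ (Set.range b) = Submodule.span ℝ {e₀, e₁} := by
    intro e₀ e₁
    have h : ∀ x y : Mod n, Submodule.span ℝ {L x, L y} =
        (Submodule.span ℝ {x, y}).map L.toLinearMap := fun x y => by
      rw [Submodule.map_span, Set.image_pair]
      rfl
    rw [h, h, hrange]
    exact (Submodule.map_injective_of_injective L.injective).eq_iff
  rw [gaussTerm, hinner, hnorm, hnorm'] at hchen
  simp only [hnorm] at hchen
  refine ⟨hchen.1, hchen.2.trans ⟨?_, ?_⟩⟩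
  · rintro ⟨e, ν, he, hν, hπ, h1, h2⟩
    obtain ⟨e, rfl⟩ : ∃ e' : Fin n → Mod n, e = fun i => L (e' i) :=
      ⟨fun i => L.symm (e i), by simp⟩
    obtain ⟨ν', hν'⟩ : ∃ ν' : Fin (D - n) → Mod D, ∀ r, L' (ν' r) = ν r :=
      ⟨fun r => L'.symm (ν r), by simp⟩
    have hshape : ∀ r i j, inner ℝ (s (L (e i)) (L (e j))) (ν r) =
        G' (ν' r) (σ (e j) (e i)) := fun r i j => by
      rw [Submodule.coe_inner, hs_coe, ← hν', hL', hsymm', hσ]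
    simp only [hshape] at h1 h2
    refine ⟨e, ν', (hon e).1 he, fun i j => ?_, fun r v => ?_, (hspan _ _).1 hπ, h1, h2⟩
    · rw [← hL', hν', hν', ← Submodule.coe_inner]
      exact orthonormal_iff_ite.1 hν i j
    · exact (hmem _).1 (by rw [hν']; exact (ν r).2) v
  · rintro ⟨e, ν, he, hν, hνT, hπ, h1, h2⟩
    have hshape : ∀ r i j, inner ℝ (s (L (e i)) (L (e j))) ⟨L' (ν r), (hmem _).2 (hνT r)⟩ =
        G' (ν r) (σ (e j) (e i)) := fun r i j => by
      rw [Submodule.coe_inner, hs_coe, hL', hsymm', hσ]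
    refine ⟨fun i => L (e i), fun r => ⟨L' (ν r), (hmem _).2 (hνT r)⟩, (hon e).2 he, ?_,
      (hspan _ _).2 hπ, ?_⟩
    · rw [orthonormal_iff_ite]
      intro i j
      rw [Submodule.coe_inner, hL', hν]
    · simp only [hshape]
      exact ⟨h1, h2⟩

end ChenForm

section Final

variable {n D : ℕ} {M N : Type*}
  [TopologicalSpace M] [ChartedSpace (Mod n) M] [IsManifold (𝓡 n) ∞ M]
  [TopologicalSpace N] [ChartedSpace (Mod D) N] [IsManifold (𝓡 D) ∞ N]
  {gM : Metric n M} {gN : Metric D N} {f : M → N}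

/-- All terms of the difference between `τ - K(π)` and the bound cancel, by the Gauss equation,
except those in the second fundamental form. -/
theorem scalarCurvature_sub_sectional_sub_chenBound (hn : 3 ≤ n) {S : AlmostContactMetric gN}
    {κ μ c : ℝ} (hS : S.IsSpaceForm κ μ c) (hf : IsIsometricImmersion gM gN f) (p : M)
    {w : Mod n} (hw : differential f p w = S.xiAt (f p)) {u : Fin n → Mod n}
    (hu : ∀ i j, gM.form p (u i) (u j) = if i = j then 1 else 0) {b : Fin 2 → Mod n}
    (hb : ∀ i j, gM.form p (b i) (b j) = if i = j then 1 else 0) :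
    scalarCurvature gM p u - sectional gM p (b 0) (b 1) - chenBound gM f p S κ μ c u b =
      (1 / 2) * (gN.form (f p) (∑ i, sff gM gN f p (u i) (u i)) (∑ i, sff gM gN f p (u i) (u i))
        - ∑ i, ∑ j, gN.form (f p) (sff gM gN f p (u i) (u j)) (sff gM gN f p (u i) (u j)))
      - (gN.form (f p) (sff gM gN f p (b 0) (b 0)) (sff gM gN f p (b 1) (b 1))
        - gN.form (f p) (sff gM gN f p (b 0) (b 1)) (sff gM gN f p (b 0) (b 1)))
      - ((n : ℝ) - 2) / (2 * ((n : ℝ) - 1)) *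
        gN.form (f p) (∑ i, sff gM gN f p (u i) (u i)) (∑ i, sff gM gN f p (u i) (u i)) := by
  have hn1 : ((n : ℝ) - 1) ≠ 0 := by
    have : (3 : ℝ) ≤ n := by exact_mod_cast hn
    linarith
  have hn0 : (n : ℝ) ≠ 0 := by
    have : (3 : ℝ) ≤ n := by exact_mod_cast hn
    linarith
  refine (congrArg (fun t => _ - t) (chenBound_eq S κ μ c p u b)).trans ?_
  set T : Mod n →L[ℝ] Mod D := differential f p with hTdef
  set σ := sff gM gN f p with hσdef
  set G := gN.form (f p) with hGdef
  set φ := S.phiAt (f p) with hφdef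
  set h := S.hAt (f p) with hhdef
  set η := S.etaAt (f p) with hηdef
  have hG : ∀ x y, G x y = G y x := gN.form_symm (f p)
  have hGT : ∀ x y, G (T x) (T y) = gM.form p x y := hf.form_differential p
  have hh : ∀ x y, G (h x) y = G (h y) x := hS.inner_hAt (f p)
  have hφh : ∀ x y, G (φ (h x)) y = G (φ (h y)) x := hS.inner_phiAt_hAt (f p)
  have hφ : ∀ x y, G (φ x) y = - G x (φ y) := hS.form_phiAt (f p)
  have hσs : ∀ x y, σ x y = σ y x := sff_symm hf p
  have hGξ : ∀ x, G x (T w) = η x := fun x => by rw [hw]; exact S.inner_xi (f p) x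
  have hww : gM.form p w w = 1 := by
    rw [← hGT, hGξ, hw]
    exact S.eta_xi (f p)
  have hexp := sum_form_smul (gM.form_symm p) (gM.form_pos p) hu w
  have hη : ∀ x, η (T x) = gM.form p x w := fun x => by rw [← hGξ, hGT]
  have hη1 : ∑ i, η (T (u i)) ^ 2 = 1 := by
    rw [← hww]
    conv_rhs => enter [1]; rw [← hexp]
    simp only [map_sum, map_smul, sum_apply, smul_apply, smul_eq_mul, hη, pow_two]
  have hH : ∀ j, ∑ i, η (T (u i)) * G (h (T (u i))) (T (u j)) = 0 := by
    intro j
    have h0 : G (h (T w)) (T (u j)) = 0 := by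
      rw [hw, hhdef, hS.hAt_xiAt (f p)]
      simp
    rw [← h0]
    conv_rhs => rw [← hexp]
    simp only [map_sum, map_smul, sum_apply, smul_apply, smul_eq_mul, hη]
  -- the curvature of `M` from the Gauss equation and the curvature of the ambient space form
  obtain ⟨K, hKdef⟩ : ∃ K : Mod n → Mod n → ℝ, ∀ x y : Mod n, K x y = sectional gM p x y :=
    ⟨_, fun _ _ => rfl⟩
  have hK : ∀ x y : Mod n, K x y = _ := fun x y =>
    (hKdef x y).trans <| (form_riemann hf p x y).trans (congrArg (fun t => t + _ - _)
      (hS.inner_curvature (f p) (differential f p x) (differential f p y)))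
  simp only [← hTdef, ← hσdef, ← hGdef, ← hφdef, ← hhdef, ← hηdef, hGT] at hK
  have hKu : ∀ i j, K (u i) (u j) =
      ((c + 3) / 4 * (1 - if i = j then 1 else 0)
      - (c + 3 - 4 * κ) / 4 * (η (T (u i)) ^ 2 + η (T (u j)) ^ 2
        - 2 * η (T (u i)) * η (T (u j)) * if i = j then 1 else 0)
      + 3 * (c - 1) / 4 * G (T (u i)) (φ (T (u j))) ^ 2
      + 1 / 2 * (G (h (T (u i))) (T (u i)) * G (h (T (u j))) (T (u j))
        - G (h (T (u i))) (T (u j)) ^ 2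
        - (G (φ (h (T (u i)))) (T (u i)) * G (φ (h (T (u j)))) (T (u j))
          - G (φ (h (T (u i)))) (T (u j)) ^ 2))
      + (G (h (T (u j))) (T (u j)) + G (h (T (u i))) (T (u i))
        - 2 * (if i = j then 1 else 0) * G (h (T (u i))) (T (u j)))
      + (μ - 1) * (η (T (u i)) ^ 2 * G (h (T (u j))) (T (u j))
        + η (T (u j)) ^ 2 * G (h (T (u i))) (T (u i))
        - 2 * η (T (u i)) * η (T (u j)) * G (h (T (u i))) (T (u j))))
      + (G (σ (u i) (u i)) (σ (u j) (u j)) - G (σ (u i) (u j)) (σ (u i) (u j))) := by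
    intro i j
    rw [hK, hu, hu, hu]
    by_cases hij : i = j
    · simp only [hij, if_true]
      ring
    · simp only [hij, if_true, if_false]
      ring
  have hPsq : ∀ x y, G (T x) (φ (T y)) ^ 2 = G (T y) (φ (T x)) ^ 2 := fun x y => by
    rw [hG, hφ, neg_sq]
  have hPxx : ∀ x, G (T x) (φ (T x)) = 0 := fun x => by
    have h1 := hφ (T x) (T x)
    rw [hG] at h1
    linarith
  have hKsymm : ∀ i j, K (u i) (u j) =
      K (u j) (u i) := by
    intro i j
    rw [hK, hK, hPsq (u i), hh (T (u i)) (T (u j)), hφh (T (u i)) (T (u j)), hσs (u i) (u j),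
      gM.form_symm p (u i) (u j), hG (σ (u i) (u i))]
    ring
  have hKdiag : ∀ i, K (u i) (u i) = 0 := by
    intro i
    rw [hK, hPxx]
    ring
  have hsum := sum_curvature_terms κ μ c (fun i => η (T (u i)))
    (fun i j => G (h (T (u i))) (T (u j))) (fun i j => G (φ (h (T (u i)))) (T (u j)))
    (fun i j => G (T (u i)) (φ (T (u j)))) hη1 hH
  have hscal : scalarCurvature gM p u =
      (1 / 2) * ∑ i, ∑ j, K (u i) (u j) := by
    refine Eq.trans (Finset.sum_congr rfl fun i _ => Finset.sum_congr rfl fun j _ => by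
      rw [← hKdef]) <| (sum_lt_eq (fun i j => K (u i) (u j)) hKsymm).trans ?_
    simp [hKdiag]
  have hsec : sectional gM p (b 0) (b 1) = _ := (hKdef (b 0) (b 1)).symm.trans (hK (b 0) (b 1))
  have hσsum : ∑ i, ∑ j, (G (σ (u i) (u i)) (σ (u j) (u j)) - G (σ (u i) (u j)) (σ (u i) (u j))) =
      G (∑ i, σ (u i) (u i)) (∑ i, σ (u i) (u i))
        - ∑ i, ∑ j, G (σ (u i) (u j)) (σ (u i) (u j)) := by
    simp only [Finset.sum_sub_distrib, map_sum, sum_apply]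
    rw [Finset.sum_comm]
  have hPsum : ∑ i, ∑ j, G (φ (T (u j))) (T (u i)) ^ 2 =
      ∑ i, ∑ j, G (T (u i)) (φ (T (u j))) ^ 2 := by
    simp only [hG (φ _)]
  have hHsum : ∑ i, ∑ j, G (h (T (u j))) (T (u i)) ^ 2 =
      ∑ i, ∑ j, G (h (T (u i))) (T (u j)) ^ 2 := Finset.sum_comm
  have hΨsum : ∑ i, ∑ j, G (φ (h (T (u j)))) (T (u i)) ^ 2 =
      ∑ i, ∑ j, G (φ (h (T (u i)))) (T (u j)) ^ 2 := Finset.sum_comm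
  have hscal' : scalarCurvature gM p u = _ := hscal.trans (by
    simp only [hKu]
    rw [Finset.sum_congr rfl fun i _ => Finset.sum_add_distrib, Finset.sum_add_distrib, hsum,
      hσsum])
  rw [hb, hb, hb] at hsec
  rw [if_pos rfl, if_pos rfl, if_neg (by decide)] at hsec
  refine (congrArg₂ (fun s t => s - t - _) hscal' hsec).trans ?_
  rw [hPsum, hHsum, hΨsum, hh (T (b 1)) (T (b 0)), hφh (T (b 1)) (T (b 0)), hG (φ (T (b 1)))]
  simp only [map_smul, smul_apply, smul_eq_mul]
  field_simp
  ring

theorem shapeMatrix_eq (gM : Metric n M) (gN : Metric D N) (f : M → N) (p : M) (ν : Mod D)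
    (e : Fin n → Mod n) : shapeMatrix gM gN f p ν e =
      Matrix.of fun i j => gN.form (f p) ν (sff gM gN f p (e j) (e i)) := by
  ext i j
  exact (gM.symm p _ _).trans (inner_shapeOperator p ν (e j) (e i))

end Final

end KMContact

theorem theorem3p1 (n m : ℕ) (hn : 3 ≤ n)
    {M N : Type*}
    [TopologicalSpace M] [ChartedSpace (KMContact.Mod n) M] [IsManifold (𝓡 n) ∞ M]
    [TopologicalSpace N] [ChartedSpace (KMContact.Mod (2 * m + 1)) N]
    [IsManifold (𝓡 (2 * m + 1)) ∞ N]
    (gM : KMContact.Metric n M) (gN : KMContact.Metric (2 * m + 1) N)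
    (S : KMContact.AlmostContactMetric gN) (κ μ c : ℝ) (hS : S.IsSpaceForm κ μ c)
    (f : M → N) (hf : KMContact.IsIsometricImmersion gM gN f)
    (hξ : ∀ q : M, S.xi (f q) ∈ Set.range (mfderiv (𝓡 n) (𝓡 (2 * m + 1)) f q))
    (p : M) (π : Submodule ℝ (TangentSpace (𝓡 n) p))
    -- an orthonormal basis of `T_p M`, in which the scalar curvature, norms and traces are computed
    (u : Fin n → TangentSpace (𝓡 n) p) (hu : KMContact.IsOrthonormal gM u)
    -- an orthonormal basis of the plane section `π`
    (b : Fin 2 → TangentSpace (𝓡 n) p) (hb : KMContact.IsOrthonormal gM b)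
    (hπ : Submodule.span ℝ (Set.range b) = π) :
    KMContact.scalarCurvature gM p u - KMContact.sectional gM p (b 0) (b 1)
        ≤ KMContact.chenBound gM f p S κ μ c u b ∧
    (KMContact.scalarCurvature gM p u - KMContact.sectional gM p (b 0) (b 1)
        = KMContact.chenBound gM f p S κ μ c u b ↔
      -- orthonormal bases `e` of the tangent space and `ν` of the normal space
      ∃ (e : Fin n → TangentSpace (𝓡 n) p)
        (ν : Fin (2 * m + 1 - n) → TangentSpace (𝓡 (2 * m + 1)) (f p)),
        KMContact.IsOrthonormal gM e ∧
        KMContact.IsOrthonormal gN ν ∧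
        (∀ r v, gN.inner (f p) (ν r) (mfderiv (𝓡 n) (𝓡 (2 * m + 1)) f p v) = 0) ∧
        π = Submodule.span ℝ {e ⟨0, by omega⟩, e ⟨1, by omega⟩} ∧
        (∀ r, r.val = 0 → ∃ a₁ a₂ : ℝ,
          KMContact.shapeMatrix gM gN f p (ν r) e = KMContact.chenForm₁ n a₁ a₂) ∧
        (∀ r, r.val ≠ 0 → ∃ c₁ d₁ : ℝ,
          KMContact.shapeMatrix gM gN f p (ν r) e = KMContact.chenForm₂ n c₁ d₁)) := by
  obtain ⟨w, hw⟩ := hξ p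
  have hchen := KMContact.chen_inequality_form hn (gM.form_symm p) (gM.form_pos p)
    (gN.form_symm (f p)) (gN.form_pos (f p)) (hf.form_differential p) (KMContact.sff_symm hf p)
    (KMContact.form_sff_differential hf p) hu hb
  have hdiff := KMContact.scalarCurvature_sub_sectional_sub_chenBound hn hS hf p hw hu hb
  simp only [← KMContact.shapeMatrix_eq] at hchen
  subst hπ
  refine ⟨?_, Iff.trans ?_ hchen.2⟩
  · have h := sub_nonpos.2 hchen.1
    rw [← hdiff] at h
    exact sub_nonpos.1 h
  · rw [← sub_eq_zero, hdiff, sub_eq_zero]
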